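/- Let $S$ be a connected oriented surface and $f:S\to S^5(1)\subset\mathbb R^6$ a minimal immersion; $S$ carries the Riemann surface structure for which $f$ is conformal. The ellipse of curvature of $f$ at a point is the image of the unit tangent circle under the second fundamental form $II$; assume that at every point it is not a circle and is non-degenerate (not a point or a segment), and fix a continuous unit vector field $e$ along its major axes. A local complex coordinate $z=x+iy$ is called adapted to an immersion $g$ of this kind if $f_2=II(\partial_z,\partial_z)$ (with $II$ extended complex bilinearly) satisfies $(f_2,f_2)=-1$ for the complex bilinear inner product on $\mathbb C^6$. Then $f_2=a-ib$ with real $a\perp b$, $|a|=\sinh\phi$, $|b|=\cosh\phi$. Let $N$ be the unit vector orthogonal to $g,\ g_x,\ g_y,\ II(\partial_x,\partial_x),\ II(\partial_x,\partial_y)$ which makes $(g,\ g_x,\ g_y,\ II(\partial_x,\partial_x),\ II(\partial_x,\partial_y),\ N)$ positively oriented, let $\alpha=(\partial_z f_2,N)$, and define the transforms $$g^{\pm}=-\frac1{\cosh\phi}\frac b{|b|}\pm\tanh\phi\; N .$$ Use throughout the adapted coordinates of $f$ for which $b/|b|=e$ (they are determined up to translations and $z\mapsto -z$), and let $f^0=f$,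 $f^{p+1}=(f^p)^+$ for $p\ge 0$ and $f^{p-1}=(f^p)^-$ for $p\le 0$. Assume that every $f^p$, $p\in\mathbb Z$, has non-degenerate ellipse of curvature at every point. Write $\alpha^q$ for the function $\alpha$ of $f^q$ in its adapted coordinates. Then for each $q\in\mathbb Z$ the following are equivalent: 1. $\alpha^q=0$ identically; 2. $f^q$ is not linearly full, i.e. its image lies in a proper linear subspace of $\mathbb R^6$; 3. there is an orientation-reversing isometry $A\in O(6)$ with $f^{q+1}=A(f^{q-1})$. Moreover, in this case the image of $f^q$ spans a $5$-dimensional subspace of $\mathbb R^6$, and for every $r\in\mathbb Z$ the immersions $f^{q-r}$ and $f^{q+r}$ are congruent by reflection in that subspace, i.e. in the (unique) great $4$-sphere containing $f^q$. -/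

import Mathlib

open scoped Manifold ContDiff Matrix

noncomputable section

namespace MinimalSphere

/-- Euclidean 6-space; the unit 5-sphere is the set of its unit vectors. -/
abbrev E6 : Type := EuclideanSpace ℝ (Fin 6)

section Surface

variable {S : Type*} [TopologicalSpace S] [ChartedSpace ℂ S]

/-- `z` is a local complex coordinate of the Riemann surface `S`. -/
def IsComplexCoord (z : OpenPartialHomeomorph S ℂ) : Prop :=
  z ∈ IsManifold.maximalAtlas 𝓘(ℂ) ω S

/-- The differential of `f` at `x`, applied to the tangent vector whose components in the local
coordinate `z = x₁ + i x₂` are the real and imaginary parts of `u`. Thus `u = 1` gives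
`∂f/∂x₁` and `u = Complex.I` gives `∂f/∂x₂`. -/
def dmap (z : OpenPartialHomeomorph S ℂ) (f : S → E6) (x : S) : ℂ →L[ℝ] E6 :=
  fderiv ℝ (f ∘ z.symm) (z x)

/-- The normal space at `x` of `f` in the sphere: the vectors orthogonal to the position vector
`f x` and to the tangent plane. -/
def normalSpace (z : OpenPartialHomeomorph S ℂ) (f : S → E6) (x : S) : Submodule ℝ E6 :=
  (Submodule.span ℝ {f x} ⊔ LinearMap.range (dmap z f x).toLinearMap)ᗮ

/-- The second fundamental form of `f` in the sphere (tangent vectors given by their components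
in the coordinate `z`): the normal component of the second derivative. -/
def II (z : OpenPartialHomeomorph S ℂ) (f : S → E6) (x : S) (u v : ℂ) : E6 :=
  (normalSpace z f x).starProjection
    (fderiv ℝ (fun w => fderiv ℝ (f ∘ z.symm) w v) (z x) u)

/-- `f` is a minimal immersion of `S` into the unit 5-sphere which is conformal for the complex
structure of `S`, i.e. the complex structure of `S` is the one given by its orientation and by
the metric induced by `f`. -/
structure IsMinimalImmersion (f : S → E6) : Prop where
  smooth : ContMDiff 𝓘(ℝ, ℂ) 𝓘(ℝ, E6) ∞ f
  norm_eq_one : ∀ x, ‖f x‖ = 1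
  conformal : ∀ z : OpenPartialHomeomorph S ℂ, IsComplexCoord z → ∀ x ∈ z.source,
    IsConformalMap (dmap z f x)
  /-- The trace of the second fundamental form with respect to the induced metric vanishes. -/
  minimal : ∀ z : OpenPartialHomeomorph S ℂ, IsComplexCoord z → ∀ x ∈ z.source, ∀ u v : ℂ,
    ‖dmap z f x u‖ = 1 → ‖dmap z f x v‖ = 1 → inner ℝ (dmap z f x u) (dmap z f x v) = 0 →
      II z f x u u + II z f x v v = 0

/-- The ellipse of curvature at `x`: the image of the unit tangent circle under the second
fundamental form. -/
def ellipse (f : S → E6) (x : S) : Set E6 :=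
  {n | ∃ u : ℂ, ‖dmap (chartAt ℂ x) f x u‖ = 1 ∧ n = II (chartAt ℂ x) f x u u}

/-- The ellipse of curvature at `x` is not a point or a line segment. -/
def NondegenerateEllipse (f : S → E6) (x : S) : Prop :=
  Module.finrank ℝ (Submodule.span ℝ (ellipse f x)) = 2

/-- The (central) ellipse of curvature at `x` is not a circle. -/
def NoncircularEllipse (f : S → E6) (x : S) : Prop :=
  ¬ ∃ r : ℝ, ∀ n ∈ ellipse f x, ‖n‖ = r

/-- `e` is a continuous choice of unit vectors along the major axes of the ellipses of
curvature. -/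
structure IsMajorAxisField (f e : S → E6) : Prop where
  cont : Continuous e
  norm_eq_one : ∀ x, ‖e x‖ = 1
  major : ∀ x, ∃ n ∈ ellipse f x, (∀ m ∈ ellipse f x, ‖m‖ ≤ ‖n‖) ∧ n = ‖n‖ • e x

/-- The real vectors `a`, `b` with `II(∂, ∂) = a - i b`, where `∂ = (∂/∂x₁ - i ∂/∂x₂) / 2`. -/
def aVec (z : OpenPartialHomeomorph S ℂ) (f : S → E6) (x : S) : E6 :=
  (1 / 4 : ℝ) • (II z f x 1 1 - II z f x Complex.I Complex.I)

/-- See `aVec`. -/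
def bVec (z : OpenPartialHomeomorph S ℂ) (f : S → E6) (x : S) : E6 :=
  (1 / 2 : ℝ) • II z f x 1 Complex.I

/-- `f₂ = II(∂, ∂)`, with `II` extended complex bilinearly. -/
def f2 (z : OpenPartialHomeomorph S ℂ) (f : S → E6) (x : S) : Fin 6 → ℂ :=
  fun j => (aVec z f x j : ℂ) - Complex.I * (bVec z f x j : ℂ)

/-- `z` is an adapted complex coordinate for `f`: `(f₂, f₂) = -1` for the complex bilinear
inner product. -/
def IsAdapted (f : S → E6) (z : OpenPartialHomeomorph S ℂ) : Prop :=
  IsComplexCoord z ∧ ∀ x ∈ z.source, f2 z f x ⬝ᵥ f2 z f x = -1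

/-- The determinant of `f, ∂f/∂x₁, ∂f/∂x₂, II(∂/∂x₁, ∂/∂x₁), II(∂/∂x₁, ∂/∂x₂), v`. -/
def frameVol (z : OpenPartialHomeomorph S ℂ) (f : S → E6) (x : S) (v : E6) : ℝ :=
  Matrix.det (Matrix.of fun i j : Fin 6 =>
    (![f x, dmap z f x 1, dmap z f x Complex.I, II z f x 1 1, II z f x 1 Complex.I, v] i) j)

/-- The vector representing the linear form `frameVol z f x`. -/
def crossVec (z : OpenPartialHomeomorph S ℂ) (f : S → E6) (x : S) : E6 :=
  WithLp.toLp 2 fun j => frameVol z f x (EuclideanSpace.single j 1)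

/-- The unit vector `N` that completes `f, ∂f/∂x₁, ∂f/∂x₂, II(∂/∂x₁, ∂/∂x₁),
II(∂/∂x₁, ∂/∂x₂)` to a positively oriented frame and is orthogonal to these vectors. -/
def unitN (z : OpenPartialHomeomorph S ℂ) (f : S → E6) (x : S) : E6 :=
  ‖crossVec z f x‖⁻¹ • crossVec z f x

/-- The function `φ` with `|a| = sinh φ` (and `|b| = cosh φ` in adapted coordinates). -/
def phi (z : OpenPartialHomeomorph S ℂ) (f : S → E6) (x : S) : ℝ :=
  Real.arsinh ‖aVec z f x‖

/-- The operator `∂ = (∂/∂x₁ - i ∂/∂x₂) / 2` in the coordinate `z`. -/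
def del (z : OpenPartialHomeomorph S ℂ) (g : S → Fin 6 → ℂ) (x : S) : Fin 6 → ℂ :=
  (1 / 2 : ℂ) • (fderiv ℝ (g ∘ z.symm) (z x) 1 -
    Complex.I • fderiv ℝ (g ∘ z.symm) (z x) Complex.I)

/-- The invariant `α = (∂ f₂, N)`. -/
def alpha (z : OpenPartialHomeomorph S ℂ) (f : S → E6) (x : S) : ℂ :=
  del z (f2 z f) x ⬝ᵥ fun j => (unitN z f x j : ℂ)

/-- The value at `x` of the (+)transform (for `ε = 1`) and of the (-)transform (for `ε = -1`),
computed in the coordinate `z`: `-(1 / cosh φ) b / |b| + ε tanh φ N`. -/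
def transformAt (ε : ℝ) (z : OpenPartialHomeomorph S ℂ) (f : S → E6) (x : S) : E6 :=
  -((1 / Real.cosh (phi z f x)) • (‖bVec z f x‖⁻¹ • bVec z f x)) +
    (ε * Real.tanh (phi z f x)) • unitN z f x

/-- `z` is an adapted coordinate for which `b / |b|` is the given unit vector field `e` along the
major axes. Such a `z` is unique up to translations and `z ↦ -z`; without `e` there is also
`z ↦ i z`, which replaces `b` by `-b`. -/
def IsPositivelyAdapted (f e : S → E6) (z : OpenPartialHomeomorph S ℂ) : Prop :=
  IsAdapted f z ∧ ∀ x ∈ z.source, bVec z f x = ‖bVec z f x‖ • e x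

open Classical in
/-- Around each point, an adapted coordinate with `b / |b| = e`. -/
def adaptedCoord (f e : S → E6) (x : S) : OpenPartialHomeomorph S ℂ :=
  if h : ∃ z : OpenPartialHomeomorph S ℂ, IsPositivelyAdapted f e z ∧ x ∈ z.source then h.choose
  else chartAt ℂ x

/-- The sequence `f^p`, `p ∈ ℤ`: `f^0 = f`, with the (+)construction iterated for `p > 0` and the
(-)construction iterated for `p < 0`, all of them in the same adapted coordinates. -/
def transformSeq (f e : S → E6) : ℤ → S → E6
  | Int.ofNat n => (fun g x => transformAt 1 (adaptedCoord f e x) g x)^[n] f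
  | Int.negSucc n => (fun g x => transformAt (-1) (adaptedCoord f e x) g x)^[n + 1] f

/-- The image is not contained in a proper linear subspace (equivalently, in a proper great
subsphere). -/
def LinearlyFull (g : S → E6) : Prop :=
  Submodule.span ℝ (Set.range g) = ⊤

end Surface

end MinimalSphere

end

noncomputable section

namespace MinimalSphere

open Complex Filter Topology

/-! The argument takes place in complexified 6-space with the complex bilinear product and the
operators `dz` (∂) and `dzb` (∂̄). For a conformal harmonic map F into the sphere, the Codazzi
equation says that ∂̄ of `sec F` = II(∂, ∂) is a multiple of ∂F. Hence (sec F, sec F) dz⁴ is a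
holomorphic quartic differential. It vanishes only where the ellipse of curvature is a circle, so
elsewhere a fourth root of it integrates to an adapted coordinate, and the field e leaves only
coordinate changes with derivative ±1.

In an adapted coordinate the two transforms of F are exactly the unit vectors G orthogonal to F and
to its tangent plane with (sec F, G) = i; the sign of `frameVol` tells them apart
(`transformAt_spec`, `eq_transformAt`). Differentiating these relations shows that ∂G is orthogonal
to F, ∂̄F, the conjugate of sec F, and G. It therefore lies in the isotropic plane spanned by ∂̄F
and conj(sec F) + iG, so G is conformal. G is also harmonic (`Polar.harm`), and sec G - iF lies in
the same isotropic plane. Hence the coordinate is adapted to G as well, and (sec G, F) = i: the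
relation between F and G is symmetric. The two frames have opposite orientations
(`Polar.det_frameMat`), so the (+)transform and the (-)transform are inverse to each other
(`transformAt_transform`). Thus all f^p share their adapted coordinates, and f^{p±1} = (f^p)^± for
every integer p.

For the criterion, -α is the only pairing of ∂N with the frame that does not vanish automatically.
So α = 0 makes N constant and puts the image in the hyperplane orthogonal to N; conversely, a vector
orthogonal to the image is parallel to N and forces α = 0. An orientation-reversing isometry
exchanges the two transforms (`transformAt_comp`). If f^q is not full, the reflection in its span
fixes f^q, hence carries f^{q-r} to f^{q+r} by induction. If f^{q+1} = A f^{q-1} with det A = -1,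
then f^q = (A f^{q-1})^- = A (f^{q-1})^+ = A f^q; a full image would force A to be the identity. -/

/-- Complex 6-space, with the complex bilinear inner product `⬝ᵥ`. -/
abbrev C6 : Type := Fin 6 → ℂ

/-! ### Wirtinger calculus for maps into complex 6-space. -/

section Wirtinger

variable {V : Type*} [NormedAddCommGroup V] [NormedSpace ℝ V] [NormedSpace ℂ V]

/-- The Wirtinger derivative `∂/∂z`. -/
def dz (F : ℂ → V) (w : ℂ) : V :=
  (1 / 2 : ℂ) • (fderiv ℝ F w 1 - I • fderiv ℝ F w I)

/-- The Wirtinger derivative `∂/∂z̄`. -/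
def dzb (F : ℂ → V) (w : ℂ) : V :=
  (1 / 2 : ℂ) • (fderiv ℝ F w 1 + I • fderiv ℝ F w I)

theorem dz_congr {F G : ℂ → V} {w : ℂ} (h : F =ᶠ[𝓝 w] G) : dz F w = dz G w := by
  simp only [dz, h.fderiv_eq]

theorem dzb_congr {F G : ℂ → V} {w : ℂ} (h : F =ᶠ[𝓝 w] G) : dzb F w = dzb G w := by
  simp only [dzb, h.fderiv_eq]

theorem dz_const (c : V) (w : ℂ) : dz (fun _ => c) w = 0 := by simp [dz]

theorem dzb_const (c : V) (w : ℂ) : dzb (fun _ => c) w = 0 := by simp [dzb]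

theorem dzb_sub {F G : ℂ → V} {w : ℂ} (hF : DifferentiableAt ℝ F w)
    (hG : DifferentiableAt ℝ G w) : dzb (fun x => F x - G x) w = dzb F w - dzb G w := by
  simp only [dzb, fderiv_fun_sub hF hG, _root_.sub_apply, smul_sub, smul_add]; abel

theorem fderiv_one_eq (F : ℂ → V) (w : ℂ) : fderiv ℝ F w 1 = dz F w + dzb F w := by
  simp only [dz, dzb, ← smul_add]
  rw [show ∀ a b : V, a - b + (a + b) = (2 : ℂ) • a by intro a b; rw [two_smul]; abel, smul_smul]
  norm_num

theorem fderiv_I_eq (F : ℂ → V) (w : ℂ) : fderiv ℝ F w I = I • (dz F w - dzb F w) := by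
  simp only [dz, dzb, ← smul_sub]
  rw [show ∀ a b : V, a - I • b - (a + I • b) = (-2 * I : ℂ) • b by
    intro a b; module, smul_smul, smul_smul]
  rw [show I * (1 / 2) * (-2 * I) = 1 by ring_nf; simp, one_smul]

theorem fderiv_eq_zero_of_dz {F : ℂ → V} {w : ℂ} (h : dz F w = 0) (h' : dzb F w = 0) :
    fderiv ℝ F w = 0 := by
  have h1 : fderiv ℝ F w 1 = 0 := by rw [fderiv_one_eq, h, h', add_zero]
  have h2 : fderiv ℝ F w I = 0 := by rw [fderiv_I_eq, h, h', sub_zero, smul_zero]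
  ext u
  have : u = u.re • (1 : ℂ) + u.im • I := by
    apply Complex.ext <;> simp
  rw [this, map_add, map_smul, map_smul, h1, h2]; simp

end Wirtinger

theorem dz_star {F : ℂ → C6} (w : ℂ) : dz (fun x => star (F x)) w = star (dzb F w) := by
  have h : fderiv ℝ (fun x => star (F x)) w = _ := fderiv_star
  simp only [dz, dzb, h]
  ext j
  simp [starL']
  ring

theorem dzb_star {F : ℂ → C6} (w : ℂ) : dzb (fun x => star (F x)) w = star (dz F w) := by
  have h : fderiv ℝ (fun x => star (F x)) w = _ := fderiv_star
  simp only [dz, dzb, h]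
  ext j
  simp [starL']

theorem fderiv_dot {F G : ℂ → C6} {w : ℂ} (hF : DifferentiableAt ℝ F w)
    (hG : DifferentiableAt ℝ G w) (u : ℂ) :
    fderiv ℝ (fun x => F x ⬝ᵥ G x) w u = fderiv ℝ F w u ⬝ᵥ G w + F w ⬝ᵥ fderiv ℝ G w u := by
  have hF' := hasFDerivAt_pi'.1 hF.hasFDerivAt
  have hG' := hasFDerivAt_pi'.1 hG.hasFDerivAt
  have := HasFDerivAt.fun_sum (u := Finset.univ) fun i _ => (hF' i).mul (hG' i)
  have h2 : (fun x => F x ⬝ᵥ G x) = fun x => ∑ i, ((fun x => F x i) * (fun x => G x i)) x := by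
    ext x; simp [dotProduct]
  rw [h2, this.fderiv]
  simp [dotProduct, Finset.sum_add_distrib]
  rw [add_comm]
  congr 1
  exact Finset.sum_congr rfl fun _ _ => mul_comm _ _

theorem dz_dot {F G : ℂ → C6} {w : ℂ} (hF : DifferentiableAt ℝ F w)
    (hG : DifferentiableAt ℝ G w) :
    dz (fun x => F x ⬝ᵥ G x) w = dz F w ⬝ᵥ G w + F w ⬝ᵥ dz G w := by
  simp only [dz, fderiv_dot hF hG, smul_dotProduct, dotProduct_smul, sub_dotProduct,
    dotProduct_sub, smul_eq_mul]
  ring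

theorem dzb_dot {F G : ℂ → C6} {w : ℂ} (hF : DifferentiableAt ℝ F w)
    (hG : DifferentiableAt ℝ G w) :
    dzb (fun x => F x ⬝ᵥ G x) w = dzb F w ⬝ᵥ G w + F w ⬝ᵥ dzb G w := by
  simp only [dzb, fderiv_dot hF hG, smul_dotProduct, dotProduct_smul, add_dotProduct,
    dotProduct_add, smul_eq_mul]
  ring

theorem dzb_smul {f : ℂ → ℂ} {G : ℂ → C6} {w : ℂ} (hF : DifferentiableAt ℝ f w)
    (hG : DifferentiableAt ℝ G w) :
    dzb (fun x => f x • G x) w = dzb f w • G w + f w • dzb G w := by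
  have : fderiv ℝ (fun x => f x • G x) w = _ := fderiv_smul hF hG
  simp only [dzb, this]
  ext j
  simp
  ring

theorem dz_smul {f : ℂ → ℂ} {G : ℂ → C6} {w : ℂ} (hF : DifferentiableAt ℝ f w)
    (hG : DifferentiableAt ℝ G w) :
    dz (fun x => f x • G x) w = dz f w • G w + f w • dz G w := by
  have : fderiv ℝ (fun x => f x • G x) w = _ := fderiv_smul hF hG
  simp only [dz, this]
  ext j
  simp
  ring

theorem dz_neg {V : Type*} [NormedAddCommGroup V] [NormedSpace ℝ V] [NormedSpace ℂ V]
    (F : ℂ → V) (w : ℂ) : dz (fun x => -F x) w = -dz F w := by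
  simp only [dz, fderiv_fun_neg, _root_.neg_apply, smul_neg]
  module

theorem fderiv_fderiv_apply {E W : Type*} [NormedAddCommGroup E] [NormedSpace ℝ E]
    [NormedAddCommGroup W] [NormedSpace ℝ W] {F : E → W} {w : E}
    (hF : ContDiffAt ℝ 2 F w) (u v : E) :
    fderiv ℝ (fun x => fderiv ℝ F x v) w u = fderiv ℝ (fderiv ℝ F) w u v := by
  have h : DifferentiableAt ℝ (fderiv ℝ F) w :=
    (hF.fderiv_right (m := 1) (by norm_num)).differentiableAt (by norm_num)
  rw [fderiv_clm_apply h (differentiableAt_const v)]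
  simp

theorem fderiv_fderiv_comm {E W : Type*} [NormedAddCommGroup E] [NormedSpace ℝ E]
    [NormedAddCommGroup W] [NormedSpace ℝ W] {F : E → W} {w : E}
    (hF : ContDiffAt ℝ 2 F w) (u v : E) :
    fderiv ℝ (fun x => fderiv ℝ F x v) w u = fderiv ℝ (fun x => fderiv ℝ F x u) w v := by
  rw [fderiv_fderiv_apply hF, fderiv_fderiv_apply hF]
  exact (hF.isSymmSndFDerivAt (by simp)) u v

theorem differentiableAt_fderiv_apply {E W : Type*} [NormedAddCommGroup E] [NormedSpace ℝ E]
    [NormedAddCommGroup W] [NormedSpace ℝ W] {F : E → W} {w : E}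
    (hF : ContDiffAt ℝ 2 F w) (v : E) : DifferentiableAt ℝ (fun x => fderiv ℝ F x v) w :=
  ((hF.fderiv_right (m := 1) (by norm_num)).differentiableAt (by norm_num)).clm_apply
    (differentiableAt_const v)

theorem fderiv_dz {F : ℂ → C6} {w : ℂ} (hF : ContDiffAt ℝ 2 F w) (u : ℂ) :
    fderiv ℝ (dz F) w u = (1 / 2 : ℂ) • (fderiv ℝ (fun x => fderiv ℝ F x 1) w u -
      I • fderiv ℝ (fun x => fderiv ℝ F x I) w u) := by
  have h1 := (differentiableAt_fderiv_apply hF 1).hasFDerivAt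
  have h2 := (differentiableAt_fderiv_apply hF I).hasFDerivAt
  have : HasFDerivAt (dz F) _ w := (h1.sub (h2.const_smul I)).const_smul (1 / 2 : ℂ)
  rw [this.fderiv]; rfl

theorem fderiv_dzb {F : ℂ → C6} {w : ℂ} (hF : ContDiffAt ℝ 2 F w) (u : ℂ) :
    fderiv ℝ (dzb F) w u = (1 / 2 : ℂ) • (fderiv ℝ (fun x => fderiv ℝ F x 1) w u +
      I • fderiv ℝ (fun x => fderiv ℝ F x I) w u) := by
  have h1 := (differentiableAt_fderiv_apply hF 1).hasFDerivAt
  have h2 := (differentiableAt_fderiv_apply hF I).hasFDerivAt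
  have : HasFDerivAt (dzb F) _ w := (h1.add (h2.const_smul I)).const_smul (1 / 2 : ℂ)
  rw [this.fderiv]; rfl

theorem dzb_dz_comm {F : ℂ → C6} {w : ℂ} (hF : ContDiffAt ℝ 2 F w) :
    dzb (dz F) w = dz (dzb F) w := by
  rw [dzb, dz, fderiv_dz hF, fderiv_dz hF, fderiv_dzb hF, fderiv_dzb hF,
    fderiv_fderiv_comm hF I 1]
  module

theorem contDiffOn_dz {V : Type*} [NormedAddCommGroup V] [NormedSpace ℝ V] [NormedSpace ℂ V]
    [IsScalarTower ℝ ℂ V] {F : ℂ → V} {U : Set ℂ} (hU : IsOpen U) (hF : ContDiffOn ℝ ∞ F U) :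
    ContDiffOn ℝ ∞ (dz F) U := by
  have h := hF.fderiv_of_isOpen hU (m := ∞) (by simp)
  exact ((h.clm_apply contDiffOn_const).sub
    ((h.clm_apply contDiffOn_const).const_smul I)).const_smul (1 / 2 : ℂ)

theorem contDiffOn_dzb {V : Type*} [NormedAddCommGroup V] [NormedSpace ℝ V] [NormedSpace ℂ V]
    [IsScalarTower ℝ ℂ V] {F : ℂ → V} {U : Set ℂ} (hU : IsOpen U) (hF : ContDiffOn ℝ ∞ F U) :
    ContDiffOn ℝ ∞ (dzb F) U := by
  have h := hF.fderiv_of_isOpen hU (m := ∞) (by simp)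
  exact ((h.clm_apply contDiffOn_const).add
    ((h.clm_apply contDiffOn_const).const_smul I)).const_smul (1 / 2 : ℂ)

theorem contDiffOn_dot {F G : ℂ → C6} {U : Set ℂ} (hF : ContDiffOn ℝ ∞ F U)
    (hG : ContDiffOn ℝ ∞ G U) : ContDiffOn ℝ ∞ (fun w => F w ⬝ᵥ G w) U := by
  simp only [dotProduct]
  exact ContDiffOn.sum fun i _ => ((contDiffOn_pi.1 hF i).mul (contDiffOn_pi.1 hG i))

theorem contDiffOn_star {F : ℂ → C6} {U : Set ℂ} (hF : ContDiffOn ℝ ∞ F U) :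
    ContDiffOn ℝ ∞ (fun w => star (F w)) U := by
  rw [contDiffOn_pi]
  intro i
  exact (Complex.conjCLE.contDiff.comp_contDiffOn (contDiffOn_pi.1 hF i))

/-! ### Conformal harmonic maps into the sphere and their structure equations. -/

/-- The complexified second fundamental form `II(∂, ∂)` of a conformal map: the second derivative
minus its component along the first one. -/
def sec (F : ℂ → C6) (w : ℂ) : C6 :=
  dz (dz F) w - ((dz (dz F) w ⬝ᵥ dzb F w) / (dz F w ⬝ᵥ dzb F w)) • dz F w

/-- `F` is real and describes a conformal harmonic immersion of `U` into the unit sphere. -/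
structure LocalMin (F : ℂ → C6) (U : Set ℂ) : Prop where
  isOpen : IsOpen U
  smooth : ContDiffOn ℝ ∞ F U
  real : ∀ w ∈ U, star (F w) = F w
  unit : ∀ w ∈ U, F w ⬝ᵥ F w = 1
  conf : ∀ w ∈ U, dz F w ⬝ᵥ dz F w = 0
  ne : ∀ w ∈ U, dz F w ≠ 0
  harm : ∀ w ∈ U, dzb (dz F) w = -(dz F w ⬝ᵥ dzb F w) • F w

theorem _root_.ContDiffOn.diffAt {V W : Type*} [NormedAddCommGroup V] [NormedSpace ℝ V]
    [NormedAddCommGroup W] [NormedSpace ℝ W] {F : V → W} {U : Set V}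
    (hF : ContDiffOn ℝ ∞ F U) (hU : IsOpen U) {w : V} (hw : w ∈ U) : DifferentiableAt ℝ F w :=
  (hF.contDiffAt (hU.mem_nhds hw)).differentiableAt (by simp)

/-- Product rule for a constant pairing. Nearly all the orthogonality relations below arise by
differentiating an earlier one in this way. -/
theorem dz_dot_of_const {A B : ℂ → C6} {U : Set ℂ} {c : ℂ} (hU : IsOpen U)
    (hA : ContDiffOn ℝ ∞ A U) (hB : ContDiffOn ℝ ∞ B U) (h : ∀ w ∈ U, A w ⬝ᵥ B w = c)
    {w : ℂ} (hw : w ∈ U) : dz A w ⬝ᵥ B w + A w ⬝ᵥ dz B w = 0 := by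
  rw [← dz_dot (hA.diffAt hU hw) (hB.diffAt hU hw), ← dz_const c w]
  exact dz_congr (Filter.eventuallyEq_of_mem (hU.mem_nhds hw) h)

theorem dzb_dot_of_const {A B : ℂ → C6} {U : Set ℂ} {c : ℂ} (hU : IsOpen U)
    (hA : ContDiffOn ℝ ∞ A U) (hB : ContDiffOn ℝ ∞ B U) (h : ∀ w ∈ U, A w ⬝ᵥ B w = c)
    {w : ℂ} (hw : w ∈ U) : dzb A w ⬝ᵥ B w + A w ⬝ᵥ dzb B w = 0 := by
  rw [← dzb_dot (hA.diffAt hU hw) (hB.diffAt hU hw), ← dzb_const c w]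
  exact dzb_congr (Filter.eventuallyEq_of_mem (hU.mem_nhds hw) h)

theorem star_dot (u v : C6) : star u ⬝ᵥ star v = star (u ⬝ᵥ v) := by
  simp [dotProduct]

theorem dzb_eq_star {F : ℂ → C6} {U : Set ℂ} (hU : IsOpen U)
    (h : ∀ w ∈ U, star (F w) = F w) {w : ℂ} (hw : w ∈ U) : dzb F w = star (dz F w) := by
  rw [← dzb_star]
  exact dzb_congr (Filter.eventuallyEq_of_mem (hU.mem_nhds hw) fun x hx => (h x hx).symm)

namespace LocalMin

variable {F : ℂ → C6} {U : Set ℂ} (h : LocalMin F U) {w : ℂ} (hw : w ∈ U)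
include h

theorem smooth_dz : ContDiffOn ℝ ∞ (dz F) U := contDiffOn_dz h.isOpen h.smooth
theorem smooth_dzb : ContDiffOn ℝ ∞ (dzb F) U := contDiffOn_dzb h.isOpen h.smooth
theorem smooth_dzz : ContDiffOn ℝ ∞ (dz (dz F)) U := contDiffOn_dz h.isOpen h.smooth_dz

theorem contDiffAt (hw : w ∈ U) : ContDiffAt ℝ 2 F w :=
  mod_cast contDiffAt_infty.1 (h.smooth.contDiffAt (h.isOpen.mem_nhds hw)) 2

theorem dzb_eq (hw : w ∈ U) : dzb F w = star (dz F w) := dzb_eq_star h.isOpen h.real hw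

theorem star_dzb (hw : w ∈ U) : star (dzb F w) = dz F w := by rw [h.dzb_eq hw, star_star]

theorem dz_dzb (hw : w ∈ U) : dz (dzb F) w = -(dz F w ⬝ᵥ dzb F w) • F w := by
  rw [← dzb_dz_comm (h.contDiffAt hw), h.harm w hw]

theorem confb (hw : w ∈ U) : dzb F w ⬝ᵥ dzb F w = 0 := by
  rw [h.dzb_eq hw, star_dot, h.conf w hw, star_zero]

theorem rho_ne (hw : w ∈ U) : dz F w ⬝ᵥ dzb F w ≠ 0 := by
  rw [h.dzb_eq hw]
  open ComplexOrder in
  exact fun h0 => h.ne w hw (dotProduct_self_star_eq_zero.1 h0)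

theorem star_rho (hw : w ∈ U) : star (dz F w ⬝ᵥ dzb F w) = dz F w ⬝ᵥ dzb F w := by
  rw [← star_dot, h.star_dzb hw, ← h.dzb_eq hw, dotProduct_comm]

theorem dz_dot_self (hw : w ∈ U) : dz F w ⬝ᵥ F w = 0 := by
  have := dz_dot_of_const h.isOpen h.smooth h.smooth h.unit hw
  rw [dotProduct_comm (F w), ← two_mul] at this
  simpa using this

theorem dzb_dot_self (hw : w ∈ U) : dzb F w ⬝ᵥ F w = 0 := by
  rw [h.dzb_eq hw, ← star_eq_zero, ← star_dot, star_star, h.real w hw, h.dz_dot_self hw]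

theorem dzz_dot_self (hw : w ∈ U) : dz (dz F) w ⬝ᵥ F w = 0 := by
  have := dz_dot_of_const h.isOpen h.smooth_dz h.smooth (fun _ => h.dz_dot_self) hw
  rwa [h.conf w hw, add_zero] at this

theorem dzz_dot_dz (hw : w ∈ U) : dz (dz F) w ⬝ᵥ dz F w = 0 := by
  have := dz_dot_of_const h.isOpen h.smooth_dz h.smooth_dz h.conf hw
  rw [dotProduct_comm (dz F w), ← two_mul] at this
  simpa using this

theorem sec_dot_self (hw : w ∈ U) : sec F w ⬝ᵥ F w = 0 := by
  simp [sec, h.dzz_dot_self hw, h.dz_dot_self hw]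

theorem sec_dot_dz (hw : w ∈ U) : sec F w ⬝ᵥ dz F w = 0 := by
  simp [sec, h.dzz_dot_dz hw, h.conf w hw]

theorem sec_dot_dzb (hw : w ∈ U) : sec F w ⬝ᵥ dzb F w = 0 := by
  simp [sec, h.rho_ne hw]

theorem star_sec_dot_self (hw : w ∈ U) : star (sec F w) ⬝ᵥ F w = 0 := by
  rw [← star_eq_zero, ← star_dot, star_star, h.real w hw, h.sec_dot_self hw]

theorem star_sec_dot_dz (hw : w ∈ U) : star (sec F w) ⬝ᵥ dz F w = 0 := by
  rw [← h.star_dzb hw, star_dot, h.sec_dot_dzb hw, star_zero]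

theorem star_sec_dot_dzb (hw : w ∈ U) : star (sec F w) ⬝ᵥ dzb F w = 0 := by
  rw [h.dzb_eq hw, star_dot, h.sec_dot_dz hw, star_zero]

theorem smooth_mu :
    ContDiffOn ℝ ∞ (fun w => (dz (dz F) w ⬝ᵥ dzb F w) / (dz F w ⬝ᵥ dzb F w)) U := by
  simp only [div_eq_mul_inv]
  exact (contDiffOn_dot h.smooth_dzz h.smooth_dzb).mul
    ((contDiffOn_dot h.smooth_dz h.smooth_dzb).inv fun w => h.rho_ne)

theorem smooth_sec : ContDiffOn ℝ ∞ (sec F) U := h.smooth_dzz.sub (h.smooth_mu.smul h.smooth_dz)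

theorem smooth_star_sec : ContDiffOn ℝ ∞ (fun w => star (sec F w)) U :=
  contDiffOn_star h.smooth_sec

theorem dz_rho (hw : w ∈ U) :
    dz (fun w => dz F w ⬝ᵥ dzb F w) w = dz (dz F) w ⬝ᵥ dzb F w := by
  rw [dz_dot (h.smooth_dz.diffAt h.isOpen hw) (h.smooth_dzb.diffAt h.isOpen hw), h.dz_dzb hw]
  simp [h.dz_dot_self hw]

theorem dzb_dzz (hw : w ∈ U) : dzb (dz (dz F)) w =
    -(dz (dz F) w ⬝ᵥ dzb F w) • F w - (dz F w ⬝ᵥ dzb F w) • dz F w := by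
  rw [dzb_dz_comm (by
      exact_mod_cast contDiffAt_infty.1 (h.smooth_dz.contDiffAt (h.isOpen.mem_nhds hw)) 2),
    dz_congr (Filter.eventuallyEq_of_mem (h.isOpen.mem_nhds hw) h.harm), ← h.dz_rho hw]
  have h1 := (contDiffOn_dot h.smooth_dz h.smooth_dzb).diffAt h.isOpen hw
  rw [dz_smul h1.fun_neg (h.smooth.diffAt h.isOpen hw), dz_neg]
  module

theorem exists_dzb_sec (hw : w ∈ U) : ∃ κ : ℂ, dzb (sec F) w = κ • dz F w := by
  refine ⟨-(dz F w ⬝ᵥ dzb F w) -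
    dzb (fun w => (dz (dz F) w ⬝ᵥ dzb F w) / (dz F w ⬝ᵥ dzb F w)) w, ?_⟩
  have h1 := h.smooth_mu.diffAt h.isOpen hw
  have h2 := h.smooth_dz.diffAt h.isOpen hw
  have h3 := h.smooth_dzz.diffAt h.isOpen hw
  have : dzb (sec F) w = _ := dzb_sub h3 (h1.fun_smul h2)
  rw [this, dzb_smul h1 h2, h.dzb_dzz hw, h.harm w hw]
  have := h.rho_ne hw
  ext j
  simp
  field_simp
  ring

theorem exists_dz_star_sec (hw : w ∈ U) :
    ∃ κ : ℂ, dz (fun w => star (sec F w)) w = κ • dzb F w := by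
  obtain ⟨κ, hκ⟩ := h.exists_dzb_sec hw
  exact ⟨star κ, by rw [dz_star, hκ, h.dzb_eq hw, star_smul]⟩

/-- Holomorphy of the quartic differential, on which the existence of adapted coordinates rests. -/
theorem dzb_sec_dot_sec (hw : w ∈ U) : dzb (fun w => sec F w ⬝ᵥ sec F w) w = 0 := by
  have h1 := h.smooth_sec.diffAt h.isOpen hw
  obtain ⟨κ, hκ⟩ := h.exists_dzb_sec hw
  rw [dzb_dot h1 h1, dotProduct_comm (sec F w), hκ]
  simp [dotProduct_comm (dz F w), h.sec_dot_dz hw]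

end LocalMin

/-! ### Polar pairs: the transform of a minimal immersion is minimal, and the relation is symmetric.
-/

/-- The complex frame `F, ∂F, ∂̄F, II(∂, ∂), II(∂̄, ∂̄), v`, as the rows of a matrix. -/
def frameMat (F : ℂ → C6) (w : ℂ) (v : C6) : Matrix (Fin 6) (Fin 6) ℂ :=
  Matrix.of ![F w, dz F w, dzb F w, sec F w, star (sec F w), v]

/-- The rows of the frame form a basis, so vectors can be identified through their pairings with it,
without inverting a Gram matrix. -/
theorem eq_zero_of_frameMat {F : ℂ → C6} {w : ℂ} {v u : C6} (hdet : (frameMat F w v).det ≠ 0)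
    (h0 : u ⬝ᵥ F w = 0) (h1 : u ⬝ᵥ dz F w = 0) (h2 : u ⬝ᵥ dzb F w = 0)
    (h3 : u ⬝ᵥ sec F w = 0) (h4 : u ⬝ᵥ star (sec F w) = 0) (h5 : u ⬝ᵥ v = 0) : u = 0 := by
  refine Matrix.eq_zero_of_mulVec_eq_zero hdet (funext fun i => ?_)
  rw [Matrix.mulVec, dotProduct_comm]
  fin_cases i <;> assumption

/-- `G` is a smooth unit vector field orthogonal to `F` and `∂F` with `(II(∂, ∂), G) = i`, where
`F` is an adapted conformal harmonic immersion. -/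
structure Polar (F G : ℂ → C6) (U : Set ℂ) : Prop where
  min : LocalMin F U
  adapted : ∀ w ∈ U, sec F w ⬝ᵥ sec F w = -1
  nondeg : ∀ w ∈ U, sec F w ⬝ᵥ star (sec F w) ≠ 1
  smooth : ContDiffOn ℝ ∞ G U
  real : ∀ w ∈ U, star (G w) = G w
  unit : ∀ w ∈ U, G w ⬝ᵥ G w = 1
  self_dot : ∀ w ∈ U, F w ⬝ᵥ G w = 0
  dz_dot : ∀ w ∈ U, dz F w ⬝ᵥ G w = 0
  sec_dot : ∀ w ∈ U, sec F w ⬝ᵥ G w = I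
  frame : ∀ w ∈ U, (frameMat F w (G w)).det ≠ 0

namespace Polar

variable {F G : ℂ → C6} {U : Set ℂ} (h : Polar F G U) {w : ℂ} (hw : w ∈ U)
include h

theorem smooth_dz : ContDiffOn ℝ ∞ (dz G) U := contDiffOn_dz h.min.isOpen h.smooth

theorem dzb_eq (hw : w ∈ U) : dzb G w = star (dz G w) := dzb_eq_star h.min.isOpen h.real hw

theorem star_dzb (hw : w ∈ U) : star (dzb G w) = dz G w := by rw [h.dzb_eq hw, star_star]

theorem contDiffAt (hw : w ∈ U) : ContDiffAt ℝ 2 G w :=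
  mod_cast contDiffAt_infty.1 (h.smooth.contDiffAt (h.min.isOpen.mem_nhds hw)) 2

theorem dzb_dot (hw : w ∈ U) : dzb F w ⬝ᵥ G w = 0 := by
  rw [h.min.dzb_eq hw, ← h.real w hw, star_dot, h.dz_dot w hw, star_zero]

theorem star_sec_dot (hw : w ∈ U) : star (sec F w) ⬝ᵥ G w = -I := by
  rw [← h.real w hw, star_dot, h.sec_dot w hw]; simp

theorem star_sec_dot_star_sec (hw : w ∈ U) : star (sec F w) ⬝ᵥ star (sec F w) = -1 := by
  rw [star_dot, h.adapted w hw]; simp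

/-- The vectors orthogonal to `F, ∂̄F, II(∂̄, ∂̄), G`. -/
theorem eq_of_orthogonal (hw : w ∈ U) {v : C6} (h0 : v ⬝ᵥ F w = 0) (h1 : v ⬝ᵥ dzb F w = 0)
    (h2 : v ⬝ᵥ star (sec F w) = 0) (h3 : v ⬝ᵥ G w = 0) :
    v = (v ⬝ᵥ dz F w / (dz F w ⬝ᵥ dzb F w)) • dzb F w +
      (v ⬝ᵥ sec F w / (sec F w ⬝ᵥ star (sec F w) - 1)) • (star (sec F w) + I • G w) := by
  have hρ := h.min.rho_ne hw
  -- This denominator is the pairing of sec F with conj(sec F) + iG, since (sec F, iG) = -1.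
  have hC : sec F w ⬝ᵥ star (sec F w) - 1 ≠ 0 := sub_ne_zero.2 (h.nondeg w hw)
  have e1 := h.min.dzb_dot_self hw
  have e2 := h.min.star_sec_dot_self hw
  have e3 := h.self_dot w hw
  have e4 := h.min.star_sec_dot_dz hw
  have e5 := h.dz_dot w hw
  have e6 := h.min.confb hw
  have e7 := h.min.star_sec_dot_dzb hw
  have e8 := h.dzb_dot hw
  have e9 := h.min.sec_dot_dzb hw
  have e10 := h.sec_dot w hw
  have e11 := h.star_sec_dot hw
  have e12 := h.star_sec_dot_star_sec hw
  have e13 := h.unit w hw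
  have II := Complex.I_mul_I
  rw [dotProduct_comm] at e3 e5 e8 e9 e10
  rw [← sub_eq_zero]
  refine eq_zero_of_frameMat (h.frame w hw) ?_ ?_ ?_ ?_ ?_ ?_ <;>
    simp only [sub_dotProduct, add_dotProduct, smul_dotProduct, smul_eq_mul]
  · rw [h0, e1, e2, e3]; ring
  · rw [dotProduct_comm (dzb F w), e4, e5]; field_simp; ring
  · rw [h1, e6, e7, e8]; ring
  · rw [e9, e10, dotProduct_comm (star (sec F w)), II]; field_simp; ring
  · rw [h2, e12, dotProduct_comm (dzb F w), e7, dotProduct_comm (G w), e11]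
    linear_combination (v ⬝ᵥ sec F w / (sec F w ⬝ᵥ star (sec F w) - 1)) * II
  · rw [h3, h.dzb_dot hw, e11, e13]; ring

theorem dz_dot_G (hw : w ∈ U) : dz G w ⬝ᵥ G w = 0 := by
  have := dz_dot_of_const h.min.isOpen h.smooth h.smooth h.unit hw
  rw [dotProduct_comm (G w), ← two_mul] at this
  simpa using this

theorem dz_dot_F (hw : w ∈ U) : dz G w ⬝ᵥ F w = 0 := by
  have := dz_dot_of_const h.min.isOpen h.min.smooth h.smooth h.self_dot hw
  rwa [h.dz_dot w hw, zero_add, dotProduct_comm] at this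

theorem dz_dot_dzF (hw : w ∈ U) : dz G w ⬝ᵥ dz F w = -I := by
  have := dz_dot_of_const h.min.isOpen h.min.smooth_dz h.smooth h.dz_dot hw
  have e := h.sec_dot w hw
  simp only [sec, sub_dotProduct, smul_dotProduct, h.dz_dot w hw, smul_zero, sub_zero] at e
  rw [e] at this
  rw [dotProduct_comm]
  linear_combination this

theorem dz_dot_dzbF (hw : w ∈ U) : dz G w ⬝ᵥ dzb F w = 0 := by
  have := dz_dot_of_const h.min.isOpen h.min.smooth_dzb h.smooth (fun _ => h.dzb_dot) hw
  rw [h.min.dz_dzb hw, smul_dotProduct, h.self_dot w hw, smul_zero, zero_add] at this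
  rwa [dotProduct_comm]

/-- The pairing of conj(sec F) with G is the constant -i, and by the conjugate Codazzi equation ∂ of
conj(sec F) is a multiple of ∂̄F, which is orthogonal to G. -/
theorem dz_dot_star_sec (hw : w ∈ U) : dz G w ⬝ᵥ star (sec F w) = 0 := by
  have := dz_dot_of_const h.min.isOpen h.min.smooth_star_sec h.smooth
    (fun _ => h.star_sec_dot) hw
  obtain ⟨κ, hκ⟩ := h.min.exists_dz_star_sec hw
  rw [hκ, smul_dotProduct, h.dzb_dot hw, smul_zero, zero_add] at this
  rwa [dotProduct_comm]

theorem dz_eq (hw : w ∈ U) : dz G w = (-I / (dz F w ⬝ᵥ dzb F w)) • dzb F w +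
    (dz G w ⬝ᵥ sec F w / (sec F w ⬝ᵥ star (sec F w) - 1)) • (star (sec F w) + I • G w) := by
  have := h.eq_of_orthogonal hw (h.dz_dot_F hw) (h.dz_dot_dzbF hw) (h.dz_dot_star_sec hw)
    (h.dz_dot_G hw)
  rwa [h.dz_dot_dzF hw] at this

/-- The span of `∂̄F` and `II(∂̄, ∂̄) + i G` is isotropic. -/
theorem isotropic (hw : w ∈ U) (x y : ℂ) :
    (x • dzb F w + y • (star (sec F w) + I • G w)) ⬝ᵥ
      (x • dzb F w + y • (star (sec F w) + I • G w)) = 0 := by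
  have e6 := h.min.confb hw
  have e7 := h.min.star_sec_dot_dzb hw
  have e8 := h.dzb_dot hw
  have e11 := h.star_sec_dot hw
  have e12 := h.star_sec_dot_star_sec hw
  have e13 := h.unit w hw
  simp only [add_dotProduct, smul_dotProduct, smul_eq_mul, dotProduct_add, dotProduct_smul]
  rw [dotProduct_comm (dzb F w) (star (sec F w)), dotProduct_comm (G w) (dzb F w),
    dotProduct_comm (G w) (star _), e6, e7, e8, e11, e12, e13]
  linear_combination (-y * y) * Complex.I_mul_I

theorem conf (hw : w ∈ U) : dz G w ⬝ᵥ dz G w = 0 := by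
  rw [h.dz_eq hw]; exact h.isotropic hw _ _

theorem dz_ne (hw : w ∈ U) : dz G w ≠ 0 := by
  intro h0
  have := h.dz_dot_dzF hw
  rw [h0, zero_dotProduct] at this
  exact Complex.I_ne_zero (by linear_combination this)

theorem dzb_dot_sec (hw : w ∈ U) : dzb G w ⬝ᵥ sec F w = 0 := by
  rw [h.dzb_eq hw, ← star_star (sec F w), star_dot, h.dz_dot_star_sec hw, star_zero]

theorem dzb_dot_F (hw : w ∈ U) : dzb G w ⬝ᵥ F w = 0 := by
  rw [h.dzb_eq hw, ← h.min.real w hw, star_dot, h.dz_dot_F hw, star_zero]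

theorem dzb_eq' (hw : w ∈ U) : dzb G w = (I / (dz F w ⬝ᵥ dzb F w)) • dz F w +
    star (dz G w ⬝ᵥ sec F w / (sec F w ⬝ᵥ star (sec F w) - 1)) • (sec F w - I • G w) := by
  rw [h.dzb_eq hw]
  conv_lhs => rw [h.dz_eq hw]
  rw [star_add, star_smul, star_smul, star_add, star_star, star_smul, h.real w hw,
    h.min.star_dzb hw, star_div₀, h.min.star_rho hw]
  simp [sub_eq_add_neg]

theorem smooth_dzb : ContDiffOn ℝ ∞ (dzb G) U := contDiffOn_dzb h.min.isOpen h.smooth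

theorem dzb_dz (hw : w ∈ U) : dzb (dz G) w = dz (dzb G) w := dzb_dz_comm (h.contDiffAt hw)

theorem star_dzb_dz (hw : w ∈ U) : star (dzb (dz G) w) = dzb (dz G) w := by
  conv_rhs => rw [h.dzb_dz hw]
  rw [← dz_star]
  exact dz_congr (Filter.eventuallyEq_of_mem (h.min.isOpen.mem_nhds hw)
    fun x hx => (h.dzb_eq hx).symm)

/-- Differentiating (sec F, ∂F) = 0 leaves -(sec F, ∂²F). This equals -(sec F, sec F) = 1, as ∂²F
and sec F differ by a multiple of ∂F. -/
theorem sec_dot_dz (hw : w ∈ U) : dz (sec F) w ⬝ᵥ dz F w = 1 := by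
  have := dz_dot_of_const h.min.isOpen h.min.smooth_sec h.min.smooth_dz
    (fun _ => h.min.sec_dot_dz) hw
  have e := h.adapted w hw
  have e' := h.min.sec_dot_dz hw
  nth_rw 2 [sec] at e
  simp only [dotProduct_sub, dotProduct_smul, e', smul_zero, sub_zero] at e
  linear_combination this - e

theorem dz_sec_dot_sec (hw : w ∈ U) : dz (sec F) w ⬝ᵥ sec F w = 0 := by
  have := dz_dot_of_const h.min.isOpen h.min.smooth_sec h.min.smooth_sec h.adapted hw
  rw [dotProduct_comm (sec F w), ← two_mul] at this
  simpa using this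

theorem dz_sec_dot_G (hw : w ∈ U) : dz (sec F) w ⬝ᵥ G w = -(dz G w ⬝ᵥ sec F w) := by
  have := dz_dot_of_const h.min.isOpen h.min.smooth_sec h.smooth h.sec_dot hw
  rw [dotProduct_comm (sec F w)] at this
  linear_combination this

/-- ∂̄∂G is a real vector, a quarter of the Laplacian of G. Its pairings with the whole frame are
compared with those of a multiple of G, and reality halves the work. -/
theorem harm (hw : w ∈ U) : dzb (dz G) w = -(dz G w ⬝ᵥ dzb G w) • G w := by
  have hU := h.min.isOpen
  have hρ := h.min.rho_ne hw
  have hC : sec F w ⬝ᵥ star (sec F w) - 1 ≠ 0 := sub_ne_zero.2 (h.nondeg w hw)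
  have v0 : dzb (dz G) w ⬝ᵥ F w = 0 := by
    have := dzb_dot_of_const hU h.smooth_dz h.min.smooth (fun _ => h.dz_dot_F) hw
    rwa [h.dz_dot_dzbF hw, add_zero] at this
  have v1 : dzb (dz G) w ⬝ᵥ dz F w = 0 := by
    have := dzb_dot_of_const hU h.smooth_dz h.min.smooth_dz (fun _ => h.dz_dot_dzF) hw
    rwa [h.min.harm w hw, dotProduct_smul, h.dz_dot_F hw, smul_zero, add_zero] at this
  have v2 : dzb (dz G) w ⬝ᵥ dzb F w = 0 := by
    rw [← h.star_dzb_dz hw, h.min.dzb_eq hw, star_dot, v1, star_zero]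
  have vG : dzb (dz G) w ⬝ᵥ G w = -(dz G w ⬝ᵥ dzb G w) := by
    have := dzb_dot_of_const hU h.smooth_dz h.smooth (fun _ => h.dz_dot_G) hw
    linear_combination this
  -- Differentiating (∂̄G, sec F) = 0 reduces this to (∂̄G, ∂ sec F), which the expansion of ∂̄G
  -- turns into i (∂G, ∂̄G).
  have v3 : dzb (dz G) w ⬝ᵥ sec F w = -I * (dz G w ⬝ᵥ dzb G w) := by
    have e := dz_dot_of_const hU h.smooth_dzb h.min.smooth_sec (fun _ => h.dzb_dot_sec) hw
    rw [← h.dzb_dz hw, h.dzb_eq' hw] at e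
    simp only [add_dotProduct, smul_dotProduct, sub_dotProduct, smul_eq_mul] at e
    rw [dotProduct_comm _ (dz (sec F) w), dotProduct_comm _ (dz (sec F) w),
      dotProduct_comm _ (dz (sec F) w), h.sec_dot_dz hw, h.dz_sec_dot_sec hw,
      h.dz_sec_dot_G hw] at e
    have e2 : dz G w ⬝ᵥ dzb G w = 1 / (dz F w ⬝ᵥ dzb F w) +
        star (dz G w ⬝ᵥ sec F w / (sec F w ⬝ᵥ star (sec F w) - 1)) * (dz G w ⬝ᵥ sec F w) := by
      rw [h.dzb_eq' hw]
      simp only [dotProduct_add, dotProduct_smul, dotProduct_sub, smul_eq_mul, h.dz_dot_dzF hw,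
        h.dz_dot_G hw]
      linear_combination (-(1 / (dz F w ⬝ᵥ dzb F w))) * Complex.I_mul_I
    rw [e2]
    linear_combination e
  have v4 : dzb (dz G) w ⬝ᵥ star (sec F w) = I * (dz G w ⬝ᵥ dzb G w) := by
    rw [← h.star_dzb_dz hw, star_dot, v3, star_mul', ← star_dot, h.star_dzb hw, ← h.dzb_eq hw,
      dotProduct_comm (dzb G w)]
    simp
  rw [← sub_eq_zero]
  have e3 := h.self_dot w hw
  have e5 := h.dz_dot w hw
  have e8 := h.dzb_dot hw
  have e10 := h.sec_dot w hw
  have e11 := h.star_sec_dot hw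
  rw [dotProduct_comm] at e3 e5 e8 e10 e11
  refine eq_zero_of_frameMat (h.frame w hw) ?_ ?_ ?_ ?_ ?_ ?_ <;>
    simp only [sub_dotProduct, smul_dotProduct, smul_eq_mul]
  · rw [v0, e3]; ring
  · rw [v1, e5]; ring
  · rw [v2, e8]; ring
  · rw [v3, e10]; ring
  · rw [v4, e11]; ring
  · rw [vG, h.unit w hw]; ring

theorem localMin : LocalMin G U where
  isOpen := h.min.isOpen
  smooth := h.smooth
  real := h.real
  unit := h.unit
  conf _ := h.conf
  ne _ := h.dz_ne
  harm _ := h.harm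

/-- Once its F-component i is removed, ∂²G is orthogonal to F, ∂̄F, conj(sec F) and G, so it lies in
the isotropic plane that already contains ∂G. -/
theorem dzz_eq (hw : w ∈ U) : ∃ x y : ℂ, dz (dz G) w =
    I • F w + (x • dzb F w + y • (star (sec F w) + I • G w)) := by
  have hU := h.min.isOpen
  have v0 : dz (dz G) w ⬝ᵥ F w = I := by
    have := dz_dot_of_const hU h.smooth_dz h.min.smooth (fun _ => h.dz_dot_F) hw
    rw [h.dz_dot_dzF hw] at this
    linear_combination this
  have v1 : dz (dz G) w ⬝ᵥ dzb F w = 0 := by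
    have := dz_dot_of_const hU h.smooth_dz h.min.smooth_dzb (fun _ => h.dz_dot_dzbF) hw
    rwa [h.min.dz_dzb hw, dotProduct_smul, h.dz_dot_F hw, smul_zero, add_zero] at this
  have v2 : dz (dz G) w ⬝ᵥ star (sec F w) = 0 := by
    have := dz_dot_of_const hU h.smooth_dz h.min.smooth_star_sec
      (fun _ => h.dz_dot_star_sec) hw
    obtain ⟨κ, hκ⟩ := h.min.exists_dz_star_sec hw
    rwa [hκ, dotProduct_smul, h.dz_dot_dzbF hw, smul_zero, add_zero] at this
  have e1 := h.min.dzb_dot_self hw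
  have e2 := h.min.star_sec_dot_self hw
  rw [dotProduct_comm] at e1 e2
  have := h.eq_of_orthogonal hw (v := dz (dz G) w - I • F w)
    (by rw [sub_dotProduct, smul_dotProduct, v0, h.min.unit w hw]; simp)
    (by rw [sub_dotProduct, smul_dotProduct, v1, e1]; simp)
    (by rw [sub_dotProduct, smul_dotProduct, v2, e2]; simp)
    (by rw [sub_dotProduct, smul_dotProduct, h.localMin.dzz_dot_self hw, h.self_dot w hw]; simp)
  exact ⟨_, _, eq_add_of_sub_eq' this⟩

theorem sec_eq (hw : w ∈ U) : ∃ x y : ℂ, sec G w =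
    I • F w + (x • dzb F w + y • (star (sec F w) + I • G w)) := by
  obtain ⟨x, y, hxy⟩ := h.dzz_eq hw
  rw [sec, hxy]
  generalize (I • F w + (x • dzb F w + y • (star (sec F w) + I • G w))) ⬝ᵥ dzb G w /
    (dz G w ⬝ᵥ dzb G w) = m
  rw [h.dz_eq hw]
  exact ⟨x - m * (-I / (dz F w ⬝ᵥ dzb F w)),
    y - m * (dz G w ⬝ᵥ sec F w / (sec F w ⬝ᵥ star (sec F w) - 1)), by module⟩

/-- The symmetry of the construction: F satisfies with respect to G the equation that defines G from
F. -/
theorem sec_dot_F (hw : w ∈ U) : sec G w ⬝ᵥ F w = I := by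
  obtain ⟨x, y, hxy⟩ := h.sec_eq hw
  rw [hxy]
  simp [h.min.unit w hw, h.min.dzb_dot_self hw, h.min.star_sec_dot_self hw,
    dotProduct_comm (G w), h.self_dot w hw]

theorem adapted' (hw : w ∈ U) : sec G w ⬝ᵥ sec G w = -1 := by
  obtain ⟨x, y, hxy⟩ := h.sec_eq hw
  have hn : (x • dzb F w + y • (star (sec F w) + I • G w)) ⬝ᵥ F w = 0 := by
    simp [h.min.dzb_dot_self hw, h.min.star_sec_dot_self hw,
      dotProduct_comm (G w), h.self_dot w hw]
  have hn2 := h.isotropic hw x y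
  rw [hxy]
  generalize x • dzb F w + y • (star (sec F w) + I • G w) = n at hn hn2
  simp only [dotProduct_add, add_dotProduct, dotProduct_smul, smul_dotProduct, hn, hn2,
    h.min.unit w hw, dotProduct_comm (F w) n]
  simp

/-- The frames of `F` and of `G` have opposite orientations. -/
theorem det_frameMat (hw : w ∈ U) :
    ∃ Δ : ℂ, (frameMat G w (F w)).det = -(Complex.normSq Δ : ℂ) * (frameMat F w (G w)).det := by
  obtain ⟨x, y, hxy⟩ := h.sec_eq hw
  obtain ⟨s, t, hst⟩ : ∃ s t : ℂ, dz G w = s • dzb F w + t • (star (sec F w) + I • G w) :=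
    ⟨_, _, h.dz_eq hw⟩
  have hst' : dzb G w = star s • dz F w + star t • (sec F w - I • G w) := by
    rw [h.dzb_eq hw, hst, star_add, star_smul, star_smul, star_add, star_star, star_smul,
      h.real w hw, h.min.star_dzb hw]
    simp [sub_eq_add_neg]
  have hxy' : star (sec G w) = (-I) • F w + (star x • dz F w + star y • (sec F w - I • G w)) := by
    rw [hxy, star_add, star_smul, star_add, star_smul, star_smul, star_add, star_star, star_smul,
      h.real w hw, h.min.real w hw, h.min.star_dzb hw]
    simp [sub_eq_add_neg]
  -- Δ is the determinant of the components of ∂G and sec G in the basis ∂̄F, conj(sec F) + iG of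
  -- the isotropic plane. The conjugate vectors contribute its conjugate, whence the squared
  -- modulus.
  refine ⟨s * y - t * x, ?_⟩
  have hmul : frameMat G w (F w) = !![0, 0, 0, 0, 0, 1; 0, 0, s, 0, t, t * I;
      0, star s, 0, star t, 0, -star t * I; I, 0, x, 0, y, y * I;
      -I, star x, 0, star y, 0, -star y * I; 1, 0, 0, 0, 0, 0] * frameMat F w (G w) := by
    rw [frameMat, hxy', hxy, hst', hst]
    ext i j
    fin_cases i <;>
      simp [frameMat, Matrix.mul_apply, Fin.sum_univ_succ] <;> ring
  rw [hmul, Matrix.det_mul]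
  congr 1
  rw [← Complex.mul_conj]
  simp [Matrix.det_succ_row_zero, Fin.sum_univ_succ, Fin.succAbove]
  ring

end Polar

/-! ### Dictionary between the real second fundamental form and the complex calculus. -/

/-- The inclusion of real into complex 6-space. -/
def cx : E6 →L[ℝ] C6 :=
  ContinuousLinearMap.pi fun j => Complex.ofRealCLM ∘L (EuclideanSpace.proj j : E6 →L[ℝ] ℝ)

/-- The real part of a complex 6-vector. -/
def rePart : C6 →L[ℝ] E6 :=
  ((EuclideanSpace.equiv (Fin 6) ℝ).symm : (Fin 6 → ℝ) →L[ℝ] E6) ∘L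
    ContinuousLinearMap.pi fun j => Complex.reCLM ∘L ContinuousLinearMap.proj j

theorem cx_apply (v : E6) (j : Fin 6) : cx v j = (v j : ℂ) := rfl

theorem rePart_cx (v : E6) : rePart (cx v) = v := by
  ext j
  simp [rePart, cx]

theorem cx_injective : Function.Injective cx := Function.LeftInverse.injective rePart_cx

theorem cx_eq_zero {v : E6} : cx v = 0 ↔ v = 0 := map_eq_zero_iff _ cx_injective

theorem star_cx (v : E6) : star (cx v) = cx v := by
  ext j
  simp [cx_apply]

theorem cx_smul (r : ℝ) (v : E6) : cx (r • v) = (r : ℂ) • cx v := by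
  ext j
  simp [cx_apply]

theorem cx_dot (u v : E6) : cx u ⬝ᵥ cx v = ((inner ℝ u v : ℝ) : ℂ) := by
  simp [dotProduct, cx_apply, PiLp.inner_apply, mul_comm]

/-- The local representation of `g` in the coordinate `z`, as a map into complex 6-space. -/
def lift {S : Type*} [TopologicalSpace S] (z : OpenPartialHomeomorph S ℂ) (g : S → E6) : ℂ → C6 :=
  fun w => cx (g (z.symm w))

theorem fderiv_cx {E : Type*} [NormedAddCommGroup E] [NormedSpace ℝ E] {γ : E → E6} {w : E}
    (hγ : DifferentiableAt ℝ γ w) (u : E) :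
    fderiv ℝ (fun w => cx (γ w)) w u = cx (fderiv ℝ γ w u) := by
  have := cx.hasFDerivAt.comp w hγ.hasFDerivAt
  have : fderiv ℝ (fun w => cx (γ w)) w = _ := this.fderiv
  rw [this]; rfl

theorem fderiv_fderiv_cx {E : Type*} [NormedAddCommGroup E] [NormedSpace ℝ E] {γ : E → E6} {w : E}
    (hγ : ContDiffAt ℝ 2 γ w) (u v : E) :
    fderiv ℝ (fun w => fderiv ℝ (fun w => cx (γ w)) w v) w u =
      cx (fderiv ℝ (fun w => fderiv ℝ γ w v) w u) := by
  rw [← fderiv_cx (differentiableAt_fderiv_apply hγ v)]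
  have : ∀ᶠ x in 𝓝 w, ContDiffAt ℝ 2 γ x := hγ.eventually (by simp)
  have : (fun w => fderiv ℝ (fun w => cx (γ w)) w v) =ᶠ[𝓝 w] fun w => cx (fderiv ℝ γ w v) := by
    filter_upwards [this] with x hx
    exact fderiv_cx (hx.differentiableAt (by norm_num)) v
  rw [this.fderiv_eq]

theorem dzb_dz_cx {γ : ℂ → E6} {w : ℂ} (hc : ContDiffAt ℝ 2 γ w) :
    dzb (dz fun w => cx (γ w)) w = (1 / 4 : ℂ) •
      cx (fderiv ℝ (fun w => fderiv ℝ γ w 1) w 1 + fderiv ℝ (fun w => fderiv ℝ γ w I) w I) := by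
  have hc' : ContDiffAt ℝ 2 (fun w => cx (γ w)) w := cx.contDiff.contDiffAt.comp w hc
  rw [dzb, fderiv_dz hc', fderiv_dz hc', fderiv_fderiv_comm hc' I 1, map_add,
    ← fderiv_fderiv_cx hc, ← fderiv_fderiv_cx hc]
  ext j
  simp only [Pi.sub_apply, Pi.add_apply, Pi.smul_apply, smul_eq_mul]
  ring_nf
  simp only [Complex.I_sq]
  ring

theorem starProjection_normal {p X Y : E6} {D : ℂ →L[ℝ] E6} {r : ℝ} (hr : r ≠ 0)
    (hX : D 1 = X) (hY : D I = Y) (hp : inner ℝ p p = (1 : ℝ)) (hpX : inner ℝ p X = (0 : ℝ))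
    (hpY : inner ℝ p Y = (0 : ℝ)) (hXY : inner ℝ X Y = (0 : ℝ)) (hXX : inner ℝ X X = r)
    (hYY : inner ℝ Y Y = r) (v : E6) :
    (Submodule.span ℝ {p} ⊔ LinearMap.range D.toLinearMap)ᗮ.starProjection v =
      v - (inner ℝ v p : ℝ) • p - (inner ℝ v X / r : ℝ) • X - (inner ℝ v Y / r : ℝ) • Y := by
  have hD : ∀ u : ℂ, D u = u.re • X + u.im • Y := by
    intro u
    conv_lhs => rw [show u = u.re • (1 : ℂ) + u.im • I by apply Complex.ext <;> simp]
    rw [map_add, map_smul, map_smul, hX, hY]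
  have hXp : inner ℝ X p = (0 : ℝ) := by rw [real_inner_comm, hpX]
  have hYp : inner ℝ Y p = (0 : ℝ) := by rw [real_inner_comm, hpY]
  have hYX : inner ℝ Y X = (0 : ℝ) := by rw [real_inner_comm, hXY]
  refine Submodule.eq_starProjection_of_mem_orthogonal
    (K := (Submodule.span ℝ {p} ⊔ LinearMap.range D.toLinearMap)ᗮ) ?_ ?_
  · rw [Submodule.mem_orthogonal]
    intro u hu
    obtain ⟨y, hy, t, ht, rfl⟩ := Submodule.mem_sup.1 hu
    obtain ⟨c, rfl⟩ := Submodule.mem_span_singleton.1 hy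
    obtain ⟨s, rfl⟩ := ht
    simp only [ContinuousLinearMap.coe_coe, hD]
    simp only [inner_add_left, inner_smul_left, inner_sub_right, inner_smul_right, hp, hpX, hpY,
      hXp, hYp, hXY, hYX, hXX, hYY, real_inner_comm v p, real_inner_comm v X, real_inner_comm v Y,
      conj_trivial]
    field_simp
    ring
  · refine Submodule.le_orthogonal_orthogonal _ ?_
    have e : v - (v - (inner ℝ v p : ℝ) • p - (inner ℝ v X / r : ℝ) • X - (inner ℝ v Y / r : ℝ) • Y)
      = (inner ℝ v p : ℝ) • p + D (⟨inner ℝ v X / r, inner ℝ v Y / r⟩ : ℂ) := by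
      rw [hD]; module
    rw [e]
    exact Submodule.add_mem_sup (Submodule.smul_mem _ _ (Submodule.mem_span_singleton_self p))
      ⟨_, rfl⟩

section Local

variable {S : Type*} [TopologicalSpace S] {z : OpenPartialHomeomorph S ℂ}
  {g : S → E6}

theorem lift_apply {x : S} (hx : x ∈ z.source) : lift z g (z x) = cx (g x) := by
  rw [lift, z.left_inv hx]

theorem contDiffOn_of_lift {U : Set ℂ} (h : ContDiffOn ℝ ∞ (lift z g) U) :
    ContDiffOn ℝ ∞ (g ∘ z.symm) U := by
  have := rePart.contDiff.comp_contDiffOn h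
  refine this.congr fun w _ => ?_
  simp [lift, rePart_cx]

theorem f2_eq (x : S) : f2 z g x = cx (aVec z g x) - I • cx (bVec z g x) := by
  ext j
  simp [f2, cx_apply]

theorem star_f2_eq (x : S) : star (f2 z g x) = cx (aVec z g x) + I • cx (bVec z g x) := by
  rw [f2_eq, star_sub, star_smul, star_cx, star_cx]; simp

theorem f2_dot_self (x : S) : f2 z g x ⬝ᵥ f2 z g x =
    ((inner ℝ (aVec z g x) (aVec z g x) - inner ℝ (bVec z g x) (bVec z g x) : ℝ) : ℂ) -
      I * ((2 * inner ℝ (aVec z g x) (bVec z g x) : ℝ) : ℂ) := by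
  rw [f2_eq]
  simp only [sub_dotProduct, dotProduct_sub, smul_dotProduct, dotProduct_smul, cx_dot, smul_eq_mul]
  rw [real_inner_comm (aVec z g x) (bVec z g x)]
  push_cast
  linear_combination ((inner ℝ (bVec z g x) (bVec z g x) : ℝ) : ℂ) * Complex.I_mul_I

theorem f2_dot_star (x : S) : f2 z g x ⬝ᵥ star (f2 z g x) =
    ((inner ℝ (aVec z g x) (aVec z g x) + inner ℝ (bVec z g x) (bVec z g x) : ℝ) : ℂ) := by
  rw [star_f2_eq, f2_eq]
  simp only [sub_dotProduct, dotProduct_add, smul_dotProduct, dotProduct_smul, cx_dot, smul_eq_mul]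
  rw [real_inner_comm (aVec z g x) (bVec z g x)]
  push_cast
  linear_combination -((inner ℝ (bVec z g x) (bVec z g x) : ℝ) : ℂ) * Complex.I_mul_I

theorem f2_dot_self_eq_neg_one {x : S} (h : f2 z g x ⬝ᵥ f2 z g x = -1) :
    inner ℝ (aVec z g x) (bVec z g x) = (0 : ℝ) ∧ ‖bVec z g x‖ ^ 2 = 1 + ‖aVec z g x‖ ^ 2 := by
  rw [f2_dot_self] at h
  have h1 := congrArg Complex.re h
  have h2 := congrArg Complex.im h
  rw [← real_inner_self_eq_norm_sq, ← real_inner_self_eq_norm_sq]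
  generalize inner ℝ (aVec z g x) (aVec z g x) = p at *
  generalize inner ℝ (bVec z g x) (bVec z g x) = q at *
  simp at h1 h2
  exact ⟨h2, by linarith⟩

theorem II_one_I (x : S) : II z g x 1 I = (2 : ℝ) • bVec z g x := by
  rw [bVec]; module

variable (h : LocalMin (lift z g) z.target) {x : S} (hx : x ∈ z.source)
include h

theorem lift_contDiffAt (hx : x ∈ z.source) : ContDiffAt ℝ 2 (g ∘ z.symm) (z x) :=
  mod_cast contDiffAt_infty.1 ((contDiffOn_of_lift h.smooth).contDiffAt
    (z.open_target.mem_nhds (z.map_source hx))) 2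

theorem lift_fderiv (hx : x ∈ z.source) (u : ℂ) :
    fderiv ℝ (lift z g) (z x) u = cx (dmap z g x u) :=
  fderiv_cx (γ := g ∘ z.symm) ((lift_contDiffAt h hx).differentiableAt (by norm_num)) u

theorem dz_lift (hx : x ∈ z.source) :
    dz (lift z g) (z x) = (1 / 2 : ℂ) • (cx (dmap z g x 1) - I • cx (dmap z g x I)) := by
  rw [dz, lift_fderiv h hx, lift_fderiv h hx]

theorem dzb_lift (hx : x ∈ z.source) :
    dzb (lift z g) (z x) = (1 / 2 : ℂ) • (cx (dmap z g x 1) + I • cx (dmap z g x I)) := by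
  rw [dzb, lift_fderiv h hx, lift_fderiv h hx]

theorem cx_dmap_one (hx : x ∈ z.source) :
    cx (dmap z g x 1) = dz (lift z g) (z x) + dzb (lift z g) (z x) := by
  rw [← lift_fderiv h hx, fderiv_one_eq]

theorem cx_dmap_I (hx : x ∈ z.source) :
    cx (dmap z g x I) = I • (dz (lift z g) (z x) - dzb (lift z g) (z x)) := by
  rw [← lift_fderiv h hx, fderiv_I_eq]

theorem inner_self_of_localMin (hx : x ∈ z.source) : inner ℝ (g x) (g x) = (1 : ℝ) := by
  have := h.unit _ (z.map_source hx)
  rw [lift_apply hx, cx_dot] at this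
  exact_mod_cast this

theorem inner_dmap_of_localMin (hx : x ∈ z.source) (u : ℂ) :
    inner ℝ (g x) (dmap z g x u) = (0 : ℝ) := by
  have h1 := h.dz_dot_self (z.map_source hx)
  have h2 := h.dzb_dot_self (z.map_source hx)
  rw [lift_apply hx, dz_lift h hx] at h1
  rw [lift_apply hx, dzb_lift h hx] at h2
  simp only [smul_dotProduct, sub_dotProduct, add_dotProduct, cx_dot, smul_eq_mul] at h1 h2
  have e1 : ((inner ℝ (dmap z g x 1) (g x) : ℝ) : ℂ) = 0 := by linear_combination h1 + h2
  have e2 : ((inner ℝ (dmap z g x I) (g x) : ℝ) : ℂ) = 0 := by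
    linear_combination I * h1 - I * h2 + ((inner ℝ (dmap z g x I) (g x) : ℝ) : ℂ) * Complex.I_mul_I
  rw [show u = u.re • (1 : ℂ) + u.im • I by apply Complex.ext <;> simp, map_add, map_smul,
    map_smul, inner_add_right, inner_smul_right, inner_smul_right, real_inner_comm,
    Complex.ofReal_eq_zero.1 e1, real_inner_comm, Complex.ofReal_eq_zero.1 e2]
  simp

theorem conf_of_localMin (hx : x ∈ z.source) :
    inner ℝ (dmap z g x 1) (dmap z g x I) = (0 : ℝ) ∧
    inner ℝ (dmap z g x 1) (dmap z g x 1) =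
      2 * (dz (lift z g) (z x) ⬝ᵥ dzb (lift z g) (z x)).re ∧
    inner ℝ (dmap z g x I) (dmap z g x I) =
      2 * (dz (lift z g) (z x) ⬝ᵥ dzb (lift z g) (z x)).re := by
  have h1 := h.conf _ (z.map_source hx)
  rw [dz_lift h hx] at h1
  rw [dzb_lift h hx, dz_lift h hx]
  simp only [smul_dotProduct, dotProduct_smul, dotProduct_sub, dotProduct_add, sub_dotProduct,
    cx_dot, smul_eq_mul] at h1 ⊢
  rw [real_inner_comm (dmap z g x 1) (dmap z g x I)] at h1 ⊢
  have e1 := congrArg Complex.re h1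
  have e2 := congrArg Complex.im h1
  generalize inner ℝ (dmap z g x 1) (dmap z g x 1) = p at *
  generalize inner ℝ (dmap z g x I) (dmap z g x I) = q at *
  simp at e1 e2 ⊢
  refine ⟨by linarith, by linarith, by linarith⟩

theorem rho_re_ne (hx : x ∈ z.source) :
    2 * (dz (lift z g) (z x) ⬝ᵥ dzb (lift z g) (z x)).re ≠ 0 := by
  intro h0
  have := (conf_of_localMin h hx).2
  rw [h0, inner_self_eq_zero, inner_self_eq_zero] at this
  refine h.ne _ (z.map_source hx) ?_
  rw [dz_lift h hx, this.1, this.2]; simp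

theorem rho_eq_re (hx : x ∈ z.source) :
    ((dz (lift z g) (z x) ⬝ᵥ dzb (lift z g) (z x)).re : ℂ) =
      dz (lift z g) (z x) ⬝ᵥ dzb (lift z g) (z x) :=
  Complex.conj_eq_iff_re.1 (h.star_rho (z.map_source hx))

/-- The complex tangent plane has the isotropic basis ∂F, ∂̄F, so each coefficient comes from the
pairing with the other basis vector. -/
theorem cx_starProjection (hx : x ∈ z.source) (v : E6) :
    cx ((normalSpace z g x).starProjection v) = cx v - (cx v ⬝ᵥ lift z g (z x)) • lift z g (z x) -
      ((cx v ⬝ᵥ dzb (lift z g) (z x)) / (dz (lift z g) (z x) ⬝ᵥ dzb (lift z g) (z x))) •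
        dz (lift z g) (z x) -
      ((cx v ⬝ᵥ dz (lift z g) (z x)) / (dz (lift z g) (z x) ⬝ᵥ dzb (lift z g) (z x))) •
        dzb (lift z g) (z x) := by
  obtain ⟨c1, c2, c3⟩ := conf_of_localMin h hx
  have hr := rho_re_ne h hx
  rw [normalSpace, starProjection_normal hr rfl rfl (inner_self_of_localMin h hx)
    (inner_dmap_of_localMin h hx 1) (inner_dmap_of_localMin h hx I) c1 c2 c3]
  simp only [map_sub, cx_smul]
  push_cast
  simp only [← cx_dot]
  rw [rho_eq_re h hx, cx_dmap_one h hx, cx_dmap_I h hx, lift_apply hx]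
  have hr := h.rho_ne (z.map_source hx)
  ext j
  simp only [Pi.sub_apply, Pi.add_apply, Pi.smul_apply, smul_eq_mul, dotProduct_add,
    dotProduct_smul, dotProduct_sub]
  field_simp
  ring_nf
  simp only [Complex.I_sq]
  ring

/-- ∂²F is orthogonal to F and to ∂F, so projecting it to the normal space only removes its
∂F-component, which is how `sec` is defined. -/
theorem f2_eq_sec (hx : x ∈ z.source) : f2 z g x = sec (lift z g) (z x) := by
  have hc := lift_contDiffAt h hx
  have hc' : ContDiffAt ℝ 2 (lift z g) (z x) := h.contDiffAt (z.map_source hx)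
  have hdd : dz (dz (lift z g)) (z x) = (1 / 4 : ℂ) •
      (cx (fderiv ℝ (fun w => fderiv ℝ (g ∘ z.symm) w 1) (z x) 1) -
       cx (fderiv ℝ (fun w => fderiv ℝ (g ∘ z.symm) w I) (z x) I) -
       (2 * I) • cx (fderiv ℝ (fun w => fderiv ℝ (g ∘ z.symm) w I) (z x) 1)) := by
    rw [dz, fderiv_dz hc', fderiv_dz hc', fderiv_fderiv_comm hc' I 1]
    rw [← fderiv_fderiv_cx hc, ← fderiv_fderiv_cx hc, ← fderiv_fderiv_cx hc]
    change (1 / 2 : ℂ) • ((1 / 2 : ℂ) • (fderiv ℝ (fun w => fderiv ℝ (lift z g) w 1) (z x) 1 - _) -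
      I • (1 / 2 : ℂ) • (_ - I • (fderiv ℝ (fun w => fderiv ℝ (lift z g) w I) (z x) I))) = _
    ext j
    simp only [Pi.sub_apply, Pi.smul_apply, smul_eq_mul]
    change _ = 1 / 4 * (fderiv ℝ (fun w => fderiv ℝ (lift z g) w 1) (z x) 1 j -
      fderiv ℝ (fun w => fderiv ℝ (lift z g) w I) (z x) I j -
      2 * I * fderiv ℝ (fun w => fderiv ℝ (lift z g) w I) (z x) 1 j)
    ring_nf
    simp only [Complex.I_sq]
    ring
  have hd0 := h.dzz_dot_self (z.map_source hx)
  have hd1 := h.dzz_dot_dz (z.map_source hx)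
  rw [f2_eq, aVec, bVec, cx_smul, cx_smul, map_sub, II, II, II]
  rw [cx_starProjection h hx, cx_starProjection h hx, cx_starProjection h hx, sec]
  rw [hdd] at hd0 hd1 ⊢
  have hr := h.rho_ne (z.map_source hx)
  simp only [smul_dotProduct, sub_dotProduct, smul_eq_mul] at hd0 hd1 ⊢
  ext j
  simp only [Pi.sub_apply, Pi.smul_apply, smul_eq_mul]
  push_cast
  field_simp
  linear_combination (-8 * lift z g (z x) j * (dz (lift z g) (z x) ⬝ᵥ dzb (lift z g) (z x))) * hd0 -
    8 * dzb (lift z g) (z x) j * hd1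

theorem II_I_I (hx : x ∈ z.source) : II z g x I I = -II z g x 1 1 := by
  have hdd := dzb_dz_cx (lift_contDiffAt h hx)
  change dzb (dz (lift z g)) (z x) = _ at hdd
  rw [h.harm _ (z.map_source hx)] at hdd
  rw [eq_neg_iff_add_eq_zero, ← cx_eq_zero, II, II, ← map_add, add_comm, cx_starProjection h hx]
  have : cx (fderiv ℝ (fun w => fderiv ℝ (g ∘ z.symm) w 1) (z x) 1 +
       fderiv ℝ (fun w => fderiv ℝ (g ∘ z.symm) w I) (z x) I) =
      (-4 * (dz (lift z g) (z x) ⬝ᵥ dzb (lift z g) (z x))) • lift z g (z x) := by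
    exact ((show ∀ v u : C6, u = (1 / 4 : ℂ) • v → v = (4 : ℂ) • u by
      rintro v _ rfl; module) _ _ hdd).trans (by module)
  rw [this]
  simp only [smul_dotProduct, h.unit _ (z.map_source hx), dotProduct_comm (lift z g (z x)) (dz _ _),
    dotProduct_comm (lift z g (z x)) (dzb _ _), h.dz_dot_self (z.map_source hx),
    h.dzb_dot_self (z.map_source hx)]
  simp

theorem II_one_one (hx : x ∈ z.source) : II z g x 1 1 = (2 : ℝ) • aVec z g x := by
  rw [aVec, II_I_I h hx]; module

/-- Passing from a real pair X, Y to (X - iY)/2, (X + iY)/2 has determinant i/2. This happens for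
the tangent pair and for the normal pair, and (i/2)² = -1/4. -/
theorem det_frameMat_lift (hx : x ∈ z.source) (v : E6) :
    (frameMat (lift z g) (z x) (cx v)).det = -(1 / 4) * (frameVol z g x v : ℂ) := by
  have hmul : frameMat (lift z g) (z x) (cx v) = !![1, 0, 0, 0, 0, 0; 0, 1 / 2, -I / 2, 0, 0, 0;
      0, 1 / 2, I / 2, 0, 0, 0; 0, 0, 0, 1 / 2, -I / 2, 0; 0, 0, 0, 1 / 2, I / 2, 0;
      0, 0, 0, 0, 0, 1] * (Matrix.of fun i j : Fin 6 =>
    ((![g x, dmap z g x 1, dmap z g x Complex.I, II z g x 1 1, II z g x 1 Complex.I, v] i) j)).map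
      Complex.ofRealHom := by
    rw [frameMat, ← f2_eq_sec h hx, star_f2_eq, f2_eq, dz_lift h hx, dzb_lift h hx, lift_apply hx,
      II_one_one h hx, II_one_I]
    ext i j
    fin_cases i <;>
      simp [Matrix.mul_apply, Fin.sum_univ_succ, cx_apply] <;> ring
  rw [hmul, Matrix.det_mul, frameVol, ← RingHom.mapMatrix_apply, ← RingHom.map_det]
  congr 1
  simp [Matrix.det_succ_row_zero, Fin.sum_univ_succ, Fin.succAbove]
  ring_nf
  simp
  norm_num

end Local

/-! ### Behaviour under holomorphic changes of coordinate. -/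

section Chain

variable {V : Type*} [NormedAddCommGroup V] [NormedSpace ℝ V] {γ : ℂ → V} {τ : ℂ → ℂ} {p : ℂ}

theorem fderiv_comp_holo (hγ : DifferentiableAt ℝ γ (τ p)) (hτ : DifferentiableAt ℂ τ p) (u : ℂ) :
    fderiv ℝ (γ ∘ τ) p u = fderiv ℝ γ (τ p) (deriv τ p * u) := by
  rw [(hγ.hasFDerivAt.comp p hτ.hasDerivAt.complexToReal_fderiv).fderiv]
  simp

theorem fderiv_fderiv_comp_holo (hγ : ContDiffAt ℝ 2 γ (τ p)) (hτ : AnalyticAt ℂ τ p) (u v : ℂ) :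
    fderiv ℝ (fun w => fderiv ℝ (γ ∘ τ) w v) p u =
      fderiv ℝ (fun w => fderiv ℝ γ w (deriv τ p * v)) (τ p) (deriv τ p * u) +
        fderiv ℝ γ (τ p) (deriv (deriv τ) p * u * v) := by
  have h1 : ∀ᶠ w in 𝓝 p, ContDiffAt ℝ 2 γ (τ w) :=
    hτ.continuousAt.eventually (hγ.eventually (by simp))
  have h2 : ∀ᶠ w in 𝓝 p, DifferentiableAt ℂ τ w :=
    hτ.eventually_analyticAt.mono fun _ h => h.differentiableAt
  have h3 : (fun w => fderiv ℝ (γ ∘ τ) w v) =ᶠ[𝓝 p]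
      fun w => fderiv ℝ γ (τ w) (deriv τ w * v) := by
    filter_upwards [h1, h2] with w hw1 hw2
    exact fderiv_comp_holo (hw1.differentiableAt (by norm_num)) hw2 v
  rw [h3.fderiv_eq, fderiv_fderiv_apply hγ]
  have h4 : HasFDerivAt (fderiv ℝ γ) (fderiv ℝ (fderiv ℝ γ) (τ p)) (τ p) :=
    ((hγ.fderiv_right (m := 1) (by norm_num)).differentiableAt (by norm_num)).hasFDerivAt
  have h5 := h4.comp p hτ.differentiableAt.hasDerivAt.complexToReal_fderiv
  have h6 := (hτ.deriv.differentiableAt.hasDerivAt.mul_const v).complexToReal_fderiv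
  have h7 : fderiv ℝ (fun w => fderiv ℝ γ (τ w) (deriv τ w * v)) p = _ := (h5.clm_apply h6).fderiv
  rw [h7]
  simp
  rw [add_comm, mul_right_comm]

end Chain

variable {S : Type*} [TopologicalSpace S] [ChartedSpace ℂ S] [IsManifold 𝓘(ℂ) ω S]
  {z z' : OpenPartialHomeomorph S ℂ} {g : S → E6} {x : S}

omit [IsManifold 𝓘(ℂ) ω S] in
theorem analyticAt_transition (hz : IsComplexCoord z) (hz' : IsComplexCoord z')
    (hx : x ∈ z.source) (hx' : x ∈ z'.source) : AnalyticAt ℂ (z' ∘ z.symm) (z x) := by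
  have h := contMDiffOn_of_mem_contDiffGroupoid
    (StructureGroupoid.compatible_of_mem_maximalAtlas hz hz')
  rw [contMDiffOn_iff_contDiffOn] at h
  refine (h.contDiffAt ((z.symm ≫ₕ z').open_source.mem_nhds ?_)).analyticAt
  simp [hx, hx']

omit [ChartedSpace ℂ S] [IsManifold 𝓘(ℂ) ω S] in
theorem eventually_eq_comp_transition {α : Type*} (g : S → α) (hx : x ∈ z.source)
    (hx' : x ∈ z'.source) : g ∘ z.symm =ᶠ[𝓝 (z x)] (g ∘ z'.symm) ∘ (z' ∘ z.symm) := by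
  have h1 : ∀ᶠ w in 𝓝 (z x), z.symm w ∈ z'.source :=
    (z.continuousAt_symm (z.map_source hx)).eventually
      (z'.open_source.mem_nhds (by rwa [z.left_inv hx]))
  filter_upwards [h1] with w hw
  simp [z'.left_inv hw]

omit [IsManifold 𝓘(ℂ) ω S] in
theorem deriv_transition_ne_zero (hz : IsComplexCoord z) (hz' : IsComplexCoord z')
    (hx : x ∈ z.source) (hx' : x ∈ z'.source) : deriv (z' ∘ z.symm) (z x) ≠ 0 := by
  have h1 := (analyticAt_transition hz hz' hx hx').differentiableAt.hasDerivAt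
  have h2 := (analyticAt_transition hz' hz hx' hx).differentiableAt.hasDerivAt
  have e : (z' ∘ z.symm) (z x) = z' x := by simp [z.left_inv hx]
  rw [← e] at h2
  have h3 := h2.comp (z x) h1
  have h4 : (z ∘ z.symm) =ᶠ[𝓝 (z x)] (z ∘ z'.symm) ∘ (z' ∘ z.symm) :=
    eventually_eq_comp_transition z hx hx'
  have h5 : (z ∘ z.symm) =ᶠ[𝓝 (z x)] id := by
    filter_upwards [z.open_target.mem_nhds (z.map_source hx)] with w hw
    simp [z.right_inv hw]
  have h6 := (h3.congr_of_eventuallyEq h4).unique ((hasDerivAt_id (z x)).congr_of_eventuallyEq h5)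
  intro h0
  rw [h0, mul_zero] at h6
  exact zero_ne_one h6

section

variable (hz : IsComplexCoord z) (hz' : IsComplexCoord z') (hx : x ∈ z.source)
  (hx' : x ∈ z'.source) (hg : ContDiffAt ℝ 2 (g ∘ z'.symm) (z' x))
include hz hz' hx hx' hg

omit [IsManifold 𝓘(ℂ) ω S] in
theorem dmap_transition (u : ℂ) :
    dmap z g x u = dmap z' g x (deriv (z' ∘ z.symm) (z x) * u) := by
  have e : (z' ∘ z.symm) (z x) = z' x := by simp [z.left_inv hx]
  rw [dmap, (eventually_eq_comp_transition g hx hx').fderiv_eq, fderiv_comp_holo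
    (by rw [e]; exact hg.differentiableAt (by norm_num))
    (analyticAt_transition hz hz' hx hx').differentiableAt, e]
  rfl

omit [IsManifold 𝓘(ℂ) ω S] in
theorem normalSpace_transition : normalSpace z g x = normalSpace z' g x := by
  have hne := deriv_transition_ne_zero hz hz' hx hx'
  have : LinearMap.range (dmap z g x).toLinearMap = LinearMap.range (dmap z' g x).toLinearMap := by
    apply le_antisymm
    · rintro _ ⟨u, rfl⟩
      exact ⟨_, (dmap_transition hz hz' hx hx' hg u).symm⟩
    · rintro _ ⟨u, rfl⟩
      refine ⟨(deriv (z' ∘ z.symm) (z x))⁻¹ * u, ?_⟩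
      have := dmap_transition hz hz' hx hx' hg ((deriv (z' ∘ z.symm) (z x))⁻¹ * u)
      rw [mul_inv_cancel_left₀ hne] at this
      exact this
  rw [normalSpace, normalSpace, this]

omit [IsManifold 𝓘(ℂ) ω S] in
theorem II_transition (u v : ℂ) :
    II z g x u v = II z' g x (deriv (z' ∘ z.symm) (z x) * u) (deriv (z' ∘ z.symm) (z x) * v) := by
  have e : (z' ∘ z.symm) (z x) = z' x := by simp [z.left_inv hx]
  have h1 : (fun w => fderiv ℝ (g ∘ z.symm) w v) =ᶠ[𝓝 (z x)]
      fun w => fderiv ℝ ((g ∘ z'.symm) ∘ (z' ∘ z.symm)) w v := by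
    filter_upwards [(eventually_eq_comp_transition g hx hx').fderiv (𝕜 := ℝ)] with w hw
    rw [hw]
  have hN : ∀ y, (normalSpace z g x).starProjection y =
      (normalSpace z' g x).starProjection y := by
    simp only [normalSpace_transition hz hz' hx hx' hg, implies_true]
  rw [II, II, hN, h1.fderiv_eq,
    fderiv_fderiv_comp_holo (by rw [e]; exact hg) (analyticAt_transition hz hz' hx hx'), map_add, e]
  -- The term with the second derivative of the transition map is tangent to the surface, so the
  -- projection kills it and II is tensorial.
  have : (normalSpace z' g x).starProjection (fderiv ℝ (g ∘ z'.symm) (z' x)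
      (deriv (deriv (z' ∘ z.symm)) (z x) * u * v)) = 0 := by
    rw [Submodule.starProjection_apply_eq_zero_iff]
    refine Submodule.le_orthogonal_orthogonal _ (Submodule.mem_sup_right ⟨_, rfl⟩)
  rw [this, add_zero]

end

omit [ChartedSpace ℂ S] [IsManifold 𝓘(ℂ) ω S] in
theorem II_expand (hg : ContDiffAt ℝ 2 (g ∘ z.symm) (z x)) (u v : ℂ) :
    II z g x u v = (u.re * v.re) • II z g x 1 1 + (u.re * v.im + u.im * v.re) • II z g x 1 I +
      (u.im * v.im) • II z g x I I := by
  have hs := fderiv_fderiv_comm hg I 1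
  simp only [II]
  rw [fderiv_fderiv_apply hg, fderiv_fderiv_apply hg] at hs
  rw [fderiv_fderiv_apply hg, fderiv_fderiv_apply hg, fderiv_fderiv_apply hg,
    fderiv_fderiv_apply hg]
  have key : ∀ D : ℂ →L[ℝ] ℂ →L[ℝ] E6, D I 1 = D 1 I → D u v = (u.re * v.re) • D 1 1 +
      (u.re * v.im + u.im * v.re) • D 1 I + (u.im * v.im) • D I I := by
    intro D hD
    have hlin : ∀ (W : Type) [AddCommGroup W] [Module ℝ W] [TopologicalSpace W] (L : ℂ →L[ℝ] W)
        (w : ℂ), L w = w.re • L 1 + w.im • L I := by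
      intro W _ _ _ L w
      rw [← map_smul, ← map_smul, ← map_add]
      congr 1
      apply Complex.ext <;> simp
    rw [hlin _ D u, add_apply, smul_apply, smul_apply, hlin _ (D 1) v, hlin _ (D I) v, hD]
    module
  rw [key _ hs, map_add, map_add, map_smul, map_smul, map_smul]

omit [IsManifold 𝓘(ℂ) ω S] in
-- The operator ∂ gets multiplied by the derivative of the transition map, and II is bilinear. In
-- consequence (f₂, f₂) scales with the fourth power.
theorem f2_transition (hz : IsComplexCoord z) (hz' : IsComplexCoord z') (hx : x ∈ z.source)
    (hx' : x ∈ z'.source) (hg : ContDiffAt ℝ 2 (g ∘ z'.symm) (z' x)) :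
    f2 z g x = (deriv (z' ∘ z.symm) (z x)) ^ 2 • f2 z' g x := by
  simp only [f2_eq, aVec, bVec, II_transition hz hz' hx hx' hg]
  generalize deriv (z' ∘ z.symm) (z x) = ζ
  rw [II_expand hg (ζ * 1) (ζ * 1), II_expand hg (ζ * I) (ζ * I), II_expand hg (ζ * 1) (ζ * I)]
  generalize II z' g x 1 1 = A, II z' g x 1 I = B, II z' g x I I = C
  ext j
  simp [cx_apply]
  conv_rhs => rw [← Complex.re_add_im ζ]
  ring_nf
  simp only [Complex.I_sq, show (I : ℂ) ^ 3 = -I by rw [pow_succ, Complex.I_sq]; ring]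
  ring

theorem contDiffOn_comp_symm (hf : ContMDiff 𝓘(ℝ, ℂ) 𝓘(ℝ, E6) ∞ g) (hz : IsComplexCoord z) :
    ContDiffOn ℝ ∞ (g ∘ z.symm) z.target := by
  intro w hw
  refine ContDiffAt.contDiffWithinAt ?_
  have hx := z.map_target hw
  have hc : IsComplexCoord (chartAt ℂ (z.symm w)) :=
    StructureGroupoid.chart_mem_maximalAtlas _ _
  have hx' := mem_chart_source ℂ (z.symm w)
  have h1 := (contMDiffAt_iff.1 (hf (z.symm w))).2
  simp [extChartAt] at h1
  rw [contDiffWithinAt_univ] at h1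
  have h2 := analyticAt_transition hz hc hx hx'
  have h3 := eventually_eq_comp_transition g hx hx'
  have h4 : ContDiffAt ℝ ∞ (chartAt ℂ (z.symm w) ∘ z.symm) (z (z.symm w)) :=
    (h2.contDiffAt (n := ∞)).restrict_scalars ℝ
  have h5 := ContDiffAt.comp (z (z.symm w)) (g := g ∘ (chartAt ℂ (z.symm w)).symm)
    (by simpa [z.left_inv hx, chartAt_self_eq] using h1) h4
  rw [z.right_inv hw] at h3 h5
  exact h5.congr_of_eventuallyEq h3

/-- The Laplacian of f has no tangential part by conformality and no normal part by minimality. It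
is thus a multiple of f, and |f| = 1 fixes the factor. -/
theorem IsMinimalImmersion.localMin {f : S → E6} (hf : IsMinimalImmersion f)
    (hz : IsComplexCoord z) : LocalMin (lift z f) z.target := by
  have hU := z.open_target
  have hγ := contDiffOn_comp_symm hf.smooth hz
  have hs : ContDiffOn ℝ ∞ (lift z f) z.target := cx.contDiff.comp_contDiffOn hγ
  have hγ2 : ∀ x ∈ z.source, ContDiffAt ℝ 2 (f ∘ z.symm) (z x) := fun x hx =>
    mod_cast contDiffAt_infty.1 (hγ.contDiffAt (hU.mem_nhds (z.map_source hx))) 2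
  have hunit : ∀ w ∈ z.target, lift z f w ⬝ᵥ lift z f w = 1 := by
    intro w _
    rw [lift, cx_dot, real_inner_self_eq_norm_sq, hf.norm_eq_one]; simp
  have hreal : ∀ w ∈ z.target, star (lift z f w) = lift z f w := fun w _ => star_cx _
  have hD : ∀ x ∈ z.source, ∀ u, fderiv ℝ (lift z f) (z x) u = cx (dmap z f x u) := fun x hx u =>
    fderiv_cx (γ := f ∘ z.symm) ((hγ2 x hx).differentiableAt (by norm_num)) u
  have hconf : ∀ x ∈ z.source, ∃ r : ℝ, r ≠ 0 ∧
      inner ℝ (dmap z f x 1) (dmap z f x 1) = r ^ 2 ∧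
      inner ℝ (dmap z f x I) (dmap z f x I) = r ^ 2 ∧
      inner ℝ (dmap z f x 1) (dmap z f x I) = (0 : ℝ) := by
    intro x hx
    obtain ⟨c, hc, li, hli⟩ := hf.conformal z hz x hx
    refine ⟨c, hc, ?_, ?_, ?_⟩ <;> rw [hli] <;>
      simp [inner_smul_left, inner_smul_right, norm_smul, Complex.inner]
  have hconf' : ∀ w ∈ z.target, dz (lift z f) w ⬝ᵥ dz (lift z f) w = 0 := by
    intro w hw
    obtain ⟨r, hr, h1, h2, h3⟩ := hconf _ (z.map_target hw)
    have hD := hD _ (z.map_target hw)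
    rw [z.right_inv hw] at hD
    simp only [dz, hD, smul_dotProduct, dotProduct_smul, dotProduct_sub, sub_dotProduct, cx_dot, h1,
      h2, h3, real_inner_comm (dmap z f _ 1) (dmap z f _ I), smul_eq_mul]
    push_cast
    linear_combination (r : ℂ) ^ 2 / 4 * Complex.I_mul_I
  have hdb : ∀ w ∈ z.target, dzb (lift z f) w = star (dz (lift z f) w) :=
    fun w => dzb_eq_star hU hreal
  have h10 : ∀ w ∈ z.target, dz (lift z f) w ⬝ᵥ lift z f w = 0 := by
    intro w hw
    have := dz_dot_of_const hU hs hs hunit hw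
    rw [dotProduct_comm (lift z f w), ← two_mul] at this
    simpa using this
  refine ⟨hU, hs, hreal, hunit, hconf', ?_, ?_⟩
  · intro w hw h0
    obtain ⟨r, hr, h1, h2, h3⟩ := hconf _ (z.map_target hw)
    have hD := hD _ (z.map_target hw)
    rw [z.right_inv hw] at hD
    have e : cx (dmap z f (z.symm w) 1) = 0 := by
      rw [← hD, fderiv_one_eq, hdb w hw, h0, star_zero, add_zero]
    rw [cx_eq_zero] at e
    rw [e, inner_zero_left] at h1
    exact hr (by simpa using h1.symm)
  · intro w hw
    have hx := z.map_target hw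
    obtain ⟨r, hr, h1, h2, h3⟩ := hconf _ hx
    have hsd := contDiffOn_dz hU hs
    have t1 : dzb (dz (lift z f)) w ⬝ᵥ dz (lift z f) w = 0 := by
      have := dzb_dot_of_const hU hsd hsd hconf' hw
      rw [dotProduct_comm (dz (lift z f) w), ← two_mul] at this
      simpa using this
    have t0 : dzb (dz (lift z f)) w ⬝ᵥ lift z f w =
        -(dz (lift z f) w ⬝ᵥ dzb (lift z f) w) := by
      have := dzb_dot_of_const hU hsd hs h10 hw
      linear_combination this
    have hcc := dzb_dz_cx (hγ2 _ hx)
    rw [z.right_inv hw] at hcc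
    change dzb (dz (lift z f)) w = _ at hcc
    set Δ := fderiv ℝ (fun w => fderiv ℝ (f ∘ z.symm) w 1) w 1 +
      fderiv ℝ (fun w => fderiv ℝ (f ∘ z.symm) w I) w I with hΔ
    have t2 : dzb (dz (lift z f)) w ⬝ᵥ dzb (lift z f) w = 0 := by
      rw [hdb w hw, ← star_eq_zero, ← star_dot, star_star, hcc, star_smul, star_cx]
      rw [hcc] at t1
      simpa using t1
    have hD := hD _ hx
    rw [z.right_inv hw] at hD
    have tX : inner ℝ Δ (dmap z f (z.symm w) 1) = (0 : ℝ) := by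
      have : cx Δ ⬝ᵥ cx (dmap z f (z.symm w) 1) = 0 := by
        rw [hcc] at t1 t2
        rw [← hD, fderiv_one_eq, dotProduct_add]
        simp only [smul_dotProduct, smul_eq_mul] at t1 t2
        linear_combination 4 * t1 + 4 * t2
      rw [cx_dot] at this
      exact_mod_cast this
    have tY : inner ℝ Δ (dmap z f (z.symm w) I) = (0 : ℝ) := by
      have : cx Δ ⬝ᵥ cx (dmap z f (z.symm w) I) = 0 := by
        rw [hcc] at t1 t2
        rw [← hD, fderiv_I_eq, dotProduct_smul, dotProduct_sub]
        simp only [smul_dotProduct, smul_eq_mul] at t1 t2 ⊢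
        linear_combination 4 * I * t1 - 4 * I * t2
      rw [cx_dot] at this
      exact_mod_cast this
    have hp : inner ℝ (f (z.symm w)) (f (z.symm w)) = (1 : ℝ) := by
      rw [real_inner_self_eq_norm_sq, hf.norm_eq_one]; simp
    have hpu : ∀ u, inner ℝ (f (z.symm w)) (dmap z f (z.symm w) u) = (0 : ℝ) := by
      intro u
      have hd := (hγ2 _ hx).differentiableAt (by norm_num)
      rw [z.right_inv hw] at hd
      have e : (fun w => inner ℝ ((f ∘ z.symm) w) ((f ∘ z.symm) w)) = fun _ => (1 : ℝ) := by
        ext w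
        rw [real_inner_self_eq_norm_sq]; simp [hf.norm_eq_one]
      have := fderiv_inner_apply (𝕜 := ℝ) hd hd u
      rw [e] at this
      simp only [dmap, z.right_inv hw]
      rw [real_inner_comm ((f ∘ z.symm) w)] at this
      simp at this
      linarith
    -- With conformal factor r, the vectors with components 1/r and i/r are orthonormal, so the
    -- trace condition applies to them.
    have hP : (normalSpace z f (z.symm w)).starProjection Δ = 0 := by
      have hn : ∀ v : ℂ, ‖dmap z f (z.symm w) v‖ ^ 2 =
          inner ℝ (dmap z f (z.symm w) v) (dmap z f (z.symm w) v) := fun v =>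
        (real_inner_self_eq_norm_sq _).symm
      have e1 : ‖dmap z f (z.symm w) ((r⁻¹ : ℝ) : ℂ)‖ = 1 := by
        rw [← sq_eq_sq₀ (norm_nonneg _) zero_le_one, hn,
          show ((r⁻¹ : ℝ) : ℂ) = r⁻¹ • (1 : ℂ) by simp,
          map_smul, inner_smul_left, inner_smul_right, h1]
        simp; field_simp
      have e2 : ‖dmap z f (z.symm w) ((r⁻¹ : ℝ) * I : ℂ)‖ = 1 := by
        rw [← sq_eq_sq₀ (norm_nonneg _) zero_le_one, hn, show ((r⁻¹ : ℝ) : ℂ) * I = r⁻¹ • I by simp,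
          map_smul, inner_smul_left, inner_smul_right, h2]
        simp; field_simp
      have e3 : inner ℝ (dmap z f (z.symm w) ((r⁻¹ : ℝ) : ℂ))
          (dmap z f (z.symm w) ((r⁻¹ : ℝ) * I : ℂ)) = (0 : ℝ) := by
        rw [show ((r⁻¹ : ℝ) : ℂ) * I = r⁻¹ • I by simp,
          show ((r⁻¹ : ℝ) : ℂ) = r⁻¹ • (1 : ℂ) by simp, map_smul, map_smul, inner_smul_left,
          inner_smul_right, h3]
        simp
      have := hf.minimal z hz _ hx _ _ e1 e2 e3
      rw [II_expand (hγ2 _ hx), II_expand (hγ2 _ hx) (_ * I)] at this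
      simp only [ofReal_re, ofReal_im, mul_zero, zero_mul, add_zero, zero_smul, Complex.mul_re,
        Complex.mul_im, Complex.I_re, Complex.I_im, sub_zero, mul_one, zero_add] at this
      rw [← smul_add] at this
      have hr' : r⁻¹ * r⁻¹ ≠ 0 := by positivity
      rw [smul_eq_zero, or_iff_right hr', II, II, z.right_inv hw, ← map_add] at this
      exact this
    rw [normalSpace, starProjection_normal (pow_ne_zero 2 hr) rfl rfl hp (hpu 1) (hpu I) h3 h1 h2,
      tX, tY] at hP
    have hΔ' : Δ = (inner ℝ Δ (f (z.symm w)) : ℝ) • f (z.symm w) := by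
      rw [← sub_eq_zero]; simpa using hP
    have e : cx Δ = (cx Δ ⬝ᵥ lift z f w) • lift z f w := by
      conv_lhs => rw [hΔ']
      rw [cx_smul, ← cx_dot]; rfl
    rw [hcc, smul_dotProduct, smul_eq_mul] at t0
    rw [hcc, e, smul_smul, t0]

/-! ### Ellipses of curvature and existence of adapted coordinates. -/

section Local

variable {S : Type*} [TopologicalSpace S] {z : OpenPartialHomeomorph S ℂ} {g : S → E6}

theorem aVec_eq_rePart (x : S) : aVec z g x =
    rePart ((1 / 2 : ℂ) • (f2 z g x + star (f2 z g x))) := by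
  have : (1 / 2 : ℂ) • (f2 z g x + star (f2 z g x)) = cx (aVec z g x) := by
    rw [star_f2_eq, f2_eq]; module
  rw [this, rePart_cx]

theorem bVec_eq_rePart (x : S) : bVec z g x =
    rePart ((I / 2 : ℂ) • (f2 z g x - star (f2 z g x))) := by
  have : (I / 2 : ℂ) • (f2 z g x - star (f2 z g x)) = cx (bVec z g x) := by
    rw [star_f2_eq, f2_eq]
    ext j
    simp only [Pi.smul_apply, Pi.sub_apply, Pi.add_apply, smul_eq_mul]
    linear_combination (-(cx (bVec z g x) j)) * Complex.I_mul_I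
  rw [this, rePart_cx]

variable (h : LocalMin (lift z g) z.target) {x : S} (hx : x ∈ z.source)
include h

theorem contDiffOn_aVec : ContDiffOn ℝ ∞ (fun w => aVec z g (z.symm w)) z.target := by
  have := rePart.contDiff.comp_contDiffOn
    ((h.smooth_sec.add h.smooth_star_sec).const_smul (1 / 2 : ℂ))
  refine this.congr fun w hw => ?_
  rw [aVec_eq_rePart, f2_eq_sec h (z.map_target hw), z.right_inv hw]; rfl

theorem contDiffOn_bVec : ContDiffOn ℝ ∞ (fun w => bVec z g (z.symm w)) z.target := by
  have := rePart.contDiff.comp_contDiffOn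
    ((h.smooth_sec.sub h.smooth_star_sec).const_smul (I / 2 : ℂ))
  refine this.congr fun w hw => ?_
  rw [bVec_eq_rePart, f2_eq_sec h (z.map_target hw), z.right_inv hw]; rfl

theorem continuousOn_bVec : ContinuousOn (bVec z g) z.source := by
  have := (contDiffOn_bVec h).continuousOn.comp z.continuousOn z.mapsTo
  refine this.congr fun x hx => ?_
  simp [z.left_inv hx]

theorem II_diag (hx : x ∈ z.source) (u : ℂ) : II z g x u u =
    (2 * (u.re ^ 2 - u.im ^ 2)) • aVec z g x + (4 * (u.re * u.im)) • bVec z g x := by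
  rw [II_expand (lift_contDiffAt h hx), II_I_I h hx, II_one_one h hx, II_one_I]
  module

theorem norm_sq_dmap (hx : x ∈ z.source) : ∃ r : ℝ, 0 < r ∧
    ∀ u : ℂ, ‖dmap z g x u‖ ^ 2 = r * (u.re ^ 2 + u.im ^ 2) := by
  obtain ⟨c1, c2, c3⟩ := conf_of_localMin h hx
  have hr := rho_re_ne h hx
  refine ⟨_, lt_of_le_of_ne' (c2 ▸ real_inner_self_nonneg) hr, fun u => ?_⟩
  rw [← real_inner_self_eq_norm_sq]
  conv_lhs => rw [show u = u.re • (1 : ℂ) + u.im • I by apply Complex.ext <;> simp]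
  simp only [map_add, map_smul, inner_add_left, inner_add_right, inner_smul_left, inner_smul_right,
    c1, c2, c3, real_inner_comm (dmap z g x 1) (dmap z g x I), conj_trivial]
  ring

theorem norm_sq_II (hx : x ∈ z.source) (hab : inner ℝ (aVec z g x) (bVec z g x) = (0 : ℝ)) (u : ℂ) :
    ‖II z g x u u‖ ^ 2 = 4 * (u.re ^ 2 - u.im ^ 2) ^ 2 * ‖aVec z g x‖ ^ 2 +
      16 * (u.re * u.im) ^ 2 * ‖bVec z g x‖ ^ 2 := by
  rw [II_diag h hx, ← real_inner_self_eq_norm_sq]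
  simp only [inner_add_left, inner_add_right, inner_smul_left, inner_smul_right, hab,
    real_inner_comm (aVec z g x) (bVec z g x), conj_trivial, real_inner_self_eq_norm_sq]
  ring

end Local

variable {S : Type*} [TopologicalSpace S] [ChartedSpace ℂ S] [IsManifold 𝓘(ℂ) ω S]
  {z z' : OpenPartialHomeomorph S ℂ} {g f e : S → E6} {x : S}

theorem isComplexCoord_chartAt (x : S) : IsComplexCoord (chartAt ℂ x) :=
  StructureGroupoid.chart_mem_maximalAtlas _ _

/-- `ellipse` is defined through the preferred chart at the point; this frees it from that choice.
-/
theorem mem_ellipse_iff (hz : IsComplexCoord z) (h : LocalMin (lift z g) z.target)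
    (hx : x ∈ z.source) (n : E6) :
    n ∈ ellipse g x ↔ ∃ v : ℂ, ‖dmap z g x v‖ = 1 ∧ n = II z g x v v := by
  have hc := isComplexCoord_chartAt x
  have hx' := mem_chart_source ℂ x
  have hg := lift_contDiffAt h hx
  have hne := deriv_transition_ne_zero hc hz hx' hx
  constructor
  · rintro ⟨u, hu, rfl⟩
    exact ⟨_, by rw [← dmap_transition hc hz hx' hx hg]; exact hu,
      II_transition hc hz hx' hx hg u u⟩
  · rintro ⟨v, hv, rfl⟩
    refine ⟨(deriv (z ∘ (chartAt ℂ x).symm) (chartAt ℂ x x))⁻¹ * v, ?_, ?_⟩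
    · rw [dmap_transition hc hz hx' hx hg, mul_inv_cancel_left₀ hne]; exact hv
    · rw [II_transition hc hz hx' hx hg, mul_inv_cancel_left₀ hne]

theorem aVec_ne_zero (hz : IsComplexCoord z) (h : LocalMin (lift z g) z.target)
    (hx : x ∈ z.source) (hn : NondegenerateEllipse g x) : aVec z g x ≠ 0 := by
  intro ha
  have hle : Submodule.span ℝ (ellipse g x) ≤ Submodule.span ℝ {bVec z g x} := by
    rw [Submodule.span_le]
    intro n hn
    obtain ⟨v, -, rfl⟩ := (mem_ellipse_iff hz h hx n).1 hn
    rw [II_diag h hx, ha, smul_zero, zero_add]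
    exact Submodule.smul_mem _ _ (Submodule.mem_span_singleton_self _)
  have h1 := Submodule.finrank_mono hle
  have h2 := finrank_span_le_card (R := ℝ) ({bVec z g x} : Set E6)
  rw [NondegenerateEllipse] at hn
  simp at h2
  omega

theorem f2_dot_ne_zero (hz : IsComplexCoord z) (h : LocalMin (lift z g) z.target)
    (hx : x ∈ z.source) (hn : NoncircularEllipse g x) : f2 z g x ⬝ᵥ f2 z g x ≠ 0 := by
  intro h0
  rw [f2_dot_self] at h0
  obtain ⟨r, hr, hd⟩ := norm_sq_dmap h hx
  have h1 := congrArg Complex.re h0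
  have h2 := congrArg Complex.im h0
  have hI := norm_sq_II h hx
  rw [← real_inner_self_eq_norm_sq, ← real_inner_self_eq_norm_sq] at hI
  generalize hA : inner ℝ (aVec z g x) (aVec z g x) = A at *
  generalize inner ℝ (bVec z g x) (bVec z g x) = B at *
  have hA0 : 0 ≤ A := hA ▸ real_inner_self_nonneg
  simp at h1 h2
  -- Here a ⊥ b and |a|² = |b|² = A. A unit tangent vector has components with |u|² = 1/r, so |II(u,
  -- u)| = 2√A |u|² is constant.
  refine hn ⟨2 * √A / r, fun n hn => ?_⟩
  obtain ⟨v, hv, rfl⟩ := (mem_ellipse_iff hz h hx n).1 hn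
  have := hd v
  rw [hv] at this
  rw [← sq_eq_sq₀ (norm_nonneg _) (by positivity), hI h2 v, div_pow, mul_pow 2, Real.sq_sqrt hA0,
    eq_div_iff (by positivity)]
  have hB : B = A := by linarith
  rw [hB]
  have e : (r * (v.re ^ 2 + v.im ^ 2)) ^ 2 = 1 := by rw [← this]; norm_num
  linear_combination 4 * A * e

/-- In an adapted coordinate |b| > |a| and a ⊥ b, so the major axis of the ellipse is the line of b.
-/
theorem bVec_eq_or_eq_neg (hz : IsComplexCoord z) (h : LocalMin (lift z f) z.target)
    (hx : x ∈ z.source) (hz1 : f2 z f x ⬝ᵥ f2 z f x = -1) (he : IsMajorAxisField f e) :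
    bVec z f x = ‖bVec z f x‖ • e x ∨ bVec z f x = -(‖bVec z f x‖ • e x) := by
  obtain ⟨hab, hb⟩ := f2_dot_self_eq_neg_one hz1
  obtain ⟨n, hn, hmax, hne⟩ := he.major x
  obtain ⟨v, hv, hnv⟩ := (mem_ellipse_iff hz h hx n).1 hn
  obtain ⟨r, hr, hd⟩ := norm_sq_dmap h hx
  have hv' := hd v
  rw [hv, one_pow] at hv'
  -- The unit tangent vector with components s(1 + i) is sent by II to a multiple of b of norm
  -- 2|b|/r, to be compared with the longest vector n.
  set s : ℝ := √((2 * r)⁻¹) with hs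
  have hs2 : s ^ 2 = (2 * r)⁻¹ := Real.sq_sqrt (by positivity)
  have hm := hmax _ ((mem_ellipse_iff hz h hx _).2 ⟨⟨s, s⟩, by
    rw [← sq_eq_sq₀ (norm_nonneg _) zero_le_one, hd]
    simp only [hs2]; field_simp; norm_num, rfl⟩)
  rw [← sq_le_sq₀ (norm_nonneg _) (norm_nonneg _), hnv, norm_sq_II h hx hab, norm_sq_II h hx hab]
    at hm
  simp only [sub_self, ← sq, hs2] at hm
  rw [hb] at hm
  set α := ‖aVec z f x‖ ^ 2
  have hα : 0 ≤ α := sq_nonneg _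
  have h1 : (v.re ^ 2 + v.im ^ 2) ^ 2 = 4 * ((2 * r)⁻¹) ^ 2 := by
    have : v.re ^ 2 + v.im ^ 2 = r⁻¹ := by field_simp; linarith
    rw [this]; field_simp; norm_num
  -- Since |b|² = |a|² + 1, the value at v falls short of 4|b|²/r² by 4(re² - im²)², which
  -- maximality forces to vanish.
  have h2 : (v.re ^ 2 - v.im ^ 2) ^ 2 = 0 := by
    refine le_antisymm ?_ (sq_nonneg _)
    nlinarith [sq_nonneg (v.re ^ 2 - v.im ^ 2)]
  have h3 : v.re ^ 2 - v.im ^ 2 = 0 := pow_eq_zero_iff (two_ne_zero) |>.1 h2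
  have h4 : II z f x v v = (4 * (v.re * v.im)) • bVec z f x := by
    rw [II_diag h hx, h3]; simp
  have hb0 : 0 < ‖bVec z f x‖ := by
    have : 0 < ‖bVec z f x‖ ^ 2 := by rw [hb]; positivity
    exact lt_of_le_of_ne (norm_nonneg _) fun h0 => by rw [← h0] at this; norm_num at this
  rw [hnv, h4, norm_smul] at hne
  have ht : 4 * (v.re * v.im) ≠ 0 := by
    intro h0
    have h5 : (v.re ^ 2 + v.im ^ 2) ^ 2 = 0 := by
      linear_combination h2 + (v.re * v.im) * h0
    rw [h1] at h5
    exact absurd h5 (by positivity)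
  rcases lt_or_gt_of_ne ht with ht' | ht'
  · right
    rw [Real.norm_eq_abs, abs_of_neg ht'] at hne
    have := congrArg (fun y => (4 * (v.re * v.im))⁻¹ • y) hne
    simp only [smul_smul] at this
    rw [inv_mul_cancel₀ ht, one_smul] at this
    refine this.trans ?_
    rw [← neg_smul, neg_mul, mul_neg, inv_mul_cancel_left₀ ht]
  · left
    rw [Real.norm_eq_abs, abs_of_pos ht'] at hne
    have := congrArg (fun y => (4 * (v.re * v.im))⁻¹ • y) hne
    simp only [smul_smul] at this
    rw [inv_mul_cancel₀ ht, one_smul, inv_mul_cancel_left₀ ht] at this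
    exact this

/-- With φ = (f₂, f₂), such a K composed with the given coordinate is an adapted coordinate: f₂ is
divided by the square of K'. -/
theorem exists_fourth_root_primitive {φ : ℂ → ℂ} {U : Set ℂ} {w₀ : ℂ} (hU : IsOpen U)
    (hφ : DifferentiableOn ℂ φ U) (hw : w₀ ∈ U) (h0 : φ w₀ ≠ 0) :
    ∃ (K : ℂ → ℂ) (V : Set ℂ), IsOpen V ∧ w₀ ∈ V ∧ V ⊆ U ∧
      ∀ w ∈ V, AnalyticAt ℂ K w ∧ deriv K w ^ 4 = -φ w ∧ deriv K w ≠ 0 := by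
  obtain ⟨c, hc⟩ := IsAlgClosed.exists_pow_nat_eq (-φ w₀) (n := 4) (by norm_num)
  have hcont : ContinuousAt (fun w => φ w / φ w₀) w₀ :=
    (hφ.continuousOn.continuousAt (hU.mem_nhds hw)).div_const _
  have hev : ∀ᶠ w in 𝓝 w₀, φ w / φ w₀ ∈ slitPlane ∧ w ∈ U := by
    refine (hcont.eventually (isOpen_slitPlane.mem_nhds ?_)).and (hU.mem_nhds hw)
    simp [div_self h0]
  obtain ⟨ε, hε, hball⟩ := Metric.eventually_nhds_iff_ball.1 hev
  -- Dividing by φ(w₀) keeps the argument near 1, in the slit plane, where the principal fourth root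
  -- is holomorphic; c restores the constant. A disc is chosen so that a primitive exists.
  have hk : DifferentiableOn ℂ (fun w => c * (φ w / φ w₀) ^ ((4 : ℕ) : ℂ)⁻¹) (Metric.ball w₀ ε) := by
    intro w hw
    have h1 : DifferentiableAt ℂ φ w := hφ.differentiableAt (hU.mem_nhds (hball w hw).2)
    exact (((h1.div_const _).cpow (differentiableAt_const _) (hball w hw).1).const_mul
      c).differentiableWithinAt
  obtain ⟨K, hK⟩ := hk.isExactOn_ball
  refine ⟨K, Metric.ball w₀ ε, Metric.isOpen_ball, Metric.mem_ball_self hε,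
    fun w hw => (hball w hw).2, fun w hw => ?_⟩
  have hpow : deriv K w ^ 4 = -φ w := by
    rw [(hK w hw).deriv, mul_pow, hc, Complex.cpow_nat_inv_pow _ (by norm_num)]
    field_simp
  refine ⟨?_, hpow, ?_⟩
  · exact DifferentiableOn.analyticAt
      (fun y hy => (hK y hy).differentiableAt.differentiableWithinAt)
      (Metric.isOpen_ball.mem_nhds hw)
  · intro hz
    rw [hz] at hpow
    have : φ w / φ w₀ = 0 := by
      rw [show φ w = 0 by linear_combination hpow]; simp
    exact slitPlane_ne_zero (hball w hw).1 this

/-- A holomorphic function with nonvanishing derivative of a complex coordinate is, locally, again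
a complex coordinate. -/
theorem exists_coord_comp (hz : IsComplexCoord z) {K : ℂ → ℂ} {V : Set ℂ} (hV : IsOpen V)
    (hK : ∀ w ∈ V, AnalyticAt ℂ K w ∧ deriv K w ≠ 0) (hx : x ∈ z.source) (hxV : z x ∈ V) :
    ∃ z₁ : OpenPartialHomeomorph S ℂ, IsComplexCoord z₁ ∧ x ∈ z₁.source ∧
      ∀ y ∈ z₁.source, y ∈ z.source ∧ z y ∈ V ∧
        deriv (z₁ ∘ z.symm) (z y) = deriv K (z y) := by
  have hfd := (hK _ hxV).1.hasStrictDerivAt.hasStrictFDerivAt_equiv (hK _ hxV).2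
  set R := (hfd.toOpenPartialHomeomorph K).restr V with hR
  have hRs : R.source = (hfd.toOpenPartialHomeomorph K).source ∩ V := by
    rw [hR, OpenPartialHomeomorph.restr_source, hV.interior_eq]
  have hRc : ∀ w, R w = K w := fun w => rfl
  have hR1 : ContDiffOn ℂ ω R R.source := by
    intro w hw
    rw [hRs] at hw
    exact ((hK w hw.2).1.contDiffAt (n := ω)).contDiffWithinAt
  have hR2 : ContDiffOn ℂ ω R.symm R.target := by
    intro w hw
    have hw' := R.map_target hw
    rw [hRs] at hw'
    exact (R.contDiffAt_symm_deriv (hK _ hw'.2).2 hw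
      (hK _ hw'.2).1.differentiableAt.hasDerivAt
      ((hK _ hw'.2).1.contDiffAt (n := ω))).contDiffWithinAt
  refine ⟨z ≫ₕ R, ?_, ?_, ?_⟩
  · refine OpenPartialHomeomorph.mem_maximalAtlas_of_contMDiffOn _ ?_ ?_
    · have h1 := contMDiffOn_of_mem_maximalAtlas hz
      exact (contMDiffOn_iff_contDiffOn.2 hR1).comp (h1.mono (by simp)) (by intro y; simp)
    · have h1 := contMDiffOn_symm_of_mem_maximalAtlas hz
      exact h1.comp ((contMDiffOn_iff_contDiffOn.2 hR2).mono (by simp)) (by intro y; simp)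
  · simp [hx, hRs, hxV, hfd.mem_toOpenPartialHomeomorph_source]
  · intro y hy
    simp [hRs] at hy
    refine ⟨hy.1, hy.2.2, Filter.EventuallyEq.deriv_eq ?_⟩
    filter_upwards [z.open_target.mem_nhds (z.map_source hy.1)] with w hw
    simp [z.right_inv hw, hRc]

theorem isAdapted_of_f2_eq (hf : IsMinimalImmersion f) (hz : IsComplexCoord z)
    (hz' : IsComplexCoord z') {K : ℂ → ℂ}
    (h : ∀ y ∈ z'.source, y ∈ z.source ∧ deriv (z' ∘ z.symm) (z y) = deriv K (z y) ∧
      deriv K (z y) ^ 4 = -(f2 z f y ⬝ᵥ f2 z f y) ∧ deriv K (z y) ≠ 0) : IsAdapted f z' := by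
  refine ⟨hz', fun y hy => ?_⟩
  obtain ⟨hy', h1, h2, h3⟩ := h y hy
  have := f2_transition hz hz' hy' hy (lift_contDiffAt (hf.localMin hz') hy)
  rw [h1] at this
  rw [this, smul_dotProduct, dotProduct_smul, smul_smul, smul_eq_mul] at h2
  have h4 : deriv K (z y) ^ 4 ≠ 0 := pow_ne_zero _ h3
  apply mul_left_cancel₀ h4
  linear_combination h2

theorem exists_adapted (hf : IsMinimalImmersion f) (hx : NoncircularEllipse f x) :
    ∃ z : OpenPartialHomeomorph S ℂ, IsAdapted f z ∧ x ∈ z.source := by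
  have hc := isComplexCoord_chartAt x
  have hxc := mem_chart_source ℂ x
  have h := hf.localMin hc
  set c := chartAt ℂ x
  have hφ : DifferentiableOn ℂ (fun w => sec (lift c f) w ⬝ᵥ sec (lift c f) w) c.target := by
    intro w hw
    have hd := (contDiffOn_dot h.smooth_sec h.smooth_sec).diffAt h.isOpen hw
    refine (differentiableAt_complex_iff_differentiableAt_real.2 ⟨hd, ?_⟩).differentiableWithinAt
    rw [fderiv_I_eq, fderiv_one_eq, h.dzb_sec_dot_sec hw, sub_zero, add_zero]
  obtain ⟨K, V, hV, hxV, hVU, hK⟩ := exists_fourth_root_primitive h.isOpen hφ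
    (c.map_source hxc) (by rw [← f2_eq_sec h hxc]; exact f2_dot_ne_zero hc h hxc hx)
  obtain ⟨z₁, hz₁, hx₁, H⟩ := exists_coord_comp hc hV (fun w hw => ⟨(hK w hw).1, (hK w hw).2.2⟩)
    hxc hxV
  refine ⟨z₁, isAdapted_of_f2_eq hf hc hz₁ (K := K) fun y hy => ?_, hx₁⟩
  obtain ⟨h1, h2, h3⟩ := H y hy
  exact ⟨h1, h3, by rw [f2_eq_sec h h1, (hK _ h2).2.1], (hK _ h2).2.2⟩

theorem exists_positivelyAdapted (hf : IsMinimalImmersion f) (hx : NoncircularEllipse f x)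
    (he : IsMajorAxisField f e) :
    ∃ z : OpenPartialHomeomorph S ℂ, IsPositivelyAdapted f e z ∧ x ∈ z.source := by
  obtain ⟨z, hz, hxz, hb⟩ : ∃ z : OpenPartialHomeomorph S ℂ, IsAdapted f z ∧ x ∈ z.source ∧
      bVec z f x = ‖bVec z f x‖ • e x := by
    obtain ⟨z, hz, hxz⟩ := exists_adapted hf hx
    rcases bVec_eq_or_eq_neg hz.1 (hf.localMin hz.1) hxz (hz.2 x hxz) he with hb | hb
    · exact ⟨z, hz, hxz, hb⟩
    -- Replacing z by iz multiplies f₂ by -1. This preserves (f₂, f₂) and reverses b.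
    · have hd : ∀ w : ℂ, HasDerivAt (fun w => I * w) I w := fun w => by
        simpa using (hasDerivAt_id w).const_mul I
      obtain ⟨z₁, hz₁, hx₁, H⟩ := exists_coord_comp hz.1 z.open_target
        (K := fun w => I * w) (fun w hw => ⟨analyticAt_const.mul analyticAt_id, by
          rw [(hd w).deriv]; exact I_ne_zero⟩) hxz (z.map_source hxz)
      refine ⟨z₁, isAdapted_of_f2_eq hf hz.1 hz₁ (K := fun w => I * w) fun y hy => ?_, hx₁, ?_⟩
      · obtain ⟨h1, h2, h3⟩ := H y hy
        refine ⟨h1, h3, ?_, ?_⟩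
        · rw [(hd _).deriv, hz.2 y h1]; simp [I_pow_four]
        · rw [(hd _).deriv]; exact I_ne_zero
      · have := f2_transition hz.1 hz₁ hxz hx₁ (lift_contDiffAt (hf.localMin hz₁) hx₁)
        rw [(H x hx₁).2.2, (hd _).deriv, I_sq, neg_smul, one_smul] at this
        have e1 : bVec z₁ f x = -bVec z f x := by
          rw [bVec_eq_rePart, bVec_eq_rePart, this, ← map_neg]
          congr 1
          rw [star_neg]; module
        rw [e1, norm_neg]
        nth_rw 1 [hb]
        rw [neg_neg]
  have hlm := hf.localMin hz.1
  -- The right sign at x extends to the open set where b and e have positive inner product, as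
  -- elsewhere b could only be a negative multiple of e.
  set s : Set S := z.source ∩ {y | 0 < (inner ℝ (e y) (bVec z f y) : ℝ)} with hs
  have hso : IsOpen s := by
    have : ContinuousOn (fun y => (inner ℝ (e y) (bVec z f y) : ℝ)) z.source :=
      he.cont.continuousOn.inner (continuousOn_bVec hlm)
    exact this.isOpen_inter_preimage z.open_source isOpen_Ioi
  have hpos : ∀ y ∈ z.source, 0 < ‖bVec z f y‖ := by
    intro y hy
    obtain ⟨-, h2⟩ := f2_dot_self_eq_neg_one (hz.2 y hy)
    rw [norm_pos_iff]
    intro h0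
    rw [h0, norm_zero] at h2
    nlinarith [sq_nonneg ‖aVec z f y‖]
  refine ⟨z.restr s, ⟨⟨restr_mem_maximalAtlas _ hz.1 hso, fun y hy => ?_⟩, fun y hy => ?_⟩, ?_⟩
  · exact hz.2 y (by simpa using hy.1)
  · rw [OpenPartialHomeomorph.restr_source, hso.interior_eq] at hy
    change bVec z f y = ‖bVec z f y‖ • e y
    rcases bVec_eq_or_eq_neg hz.1 hlm hy.1 (hz.2 y hy.1) he with hb' | hb'
    · exact hb'
    · exfalso
      have h1 : 0 < (inner ℝ (e y) (bVec z f y) : ℝ) := hy.2.2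
      rw [hb', inner_neg_right, inner_smul_right, real_inner_self_eq_norm_sq, he.norm_eq_one] at h1
      nlinarith [hpos y hy.1]
  · rw [OpenPartialHomeomorph.restr_source, hso.interior_eq]
    refine ⟨hxz, hxz, ?_⟩
    change 0 < (inner ℝ (e x) (bVec z f x) : ℝ)
    rw [hb, inner_smul_right, real_inner_self_eq_norm_sq, he.norm_eq_one]
    simpa using hpos x hxz

/-- Equality of the normalizations gives a fourth root of unity; the values ±i would turn b into -b,
against the choice of e. -/
theorem transition_eq_one_or (hf : IsMinimalImmersion f) (hz : IsPositivelyAdapted f e z)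
    (hz' : IsPositivelyAdapted f e z') (hx : x ∈ z.source) (hx' : x ∈ z'.source) :
    deriv (z' ∘ z.symm) (z x) = 1 ∨ deriv (z' ∘ z.symm) (z x) = -1 := by
  have h := f2_transition hz.1.1 hz'.1.1 hx hx' (lift_contDiffAt (hf.localMin hz'.1.1) hx')
  have h1 := hz.1.2 x hx
  have h2 := hz'.1.2 x hx'
  rw [h, smul_dotProduct, dotProduct_smul, h2, smul_smul, smul_eq_mul] at h1
  rcases sq_eq_sq_iff_eq_or_eq_neg.1 (show ((deriv (z' ∘ z.symm) (z x)) ^ 2) ^ 2 = 1 ^ 2 by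
    linear_combination -h1) with h3 | h3
  · exact sq_eq_sq_iff_eq_or_eq_neg.1 (h3.trans (one_pow 2).symm)
  · exfalso
    rw [h3, neg_smul, one_smul] at h
    have e1 : bVec z f x = -bVec z' f x := by
      rw [bVec_eq_rePart, bVec_eq_rePart, h, ← map_neg]
      congr 1
      rw [star_neg]; module
    have e2 := hz.2 x hx
    rw [e1, norm_neg] at e2
    have e3 := hz'.2 x hx'
    rw [← e3] at e2
    have e4 : (2 : ℝ) • bVec z' f x = 0 := by
      rw [two_smul]; nth_rw 1 [← e2]; exact neg_add_cancel _
    rw [smul_eq_zero, or_iff_right two_ne_zero] at e4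
    obtain ⟨-, h5⟩ := f2_dot_self_eq_neg_one h2
    rw [e4, norm_zero] at h5
    nlinarith [sq_nonneg ‖aVec z' f x‖]

/-! ### The cross product of the frame and the normal vector N. -/

section FrameVol

variable {S : Type*} [TopologicalSpace S] {z : OpenPartialHomeomorph S ℂ} {g : S → E6} {x : S}

/-- The matrix whose determinant is `frameVol`. -/
def frameMatReal (z : OpenPartialHomeomorph S ℂ) (g : S → E6) (x : S) (v : E6) :
    Matrix (Fin 6) (Fin 6) ℝ :=
  Matrix.of fun i j : Fin 6 =>
    (![g x, dmap z g x 1, dmap z g x I, II z g x 1 1, II z g x 1 I, v] i) j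

theorem frameVol_eq_det (v : E6) : frameVol z g x v = (frameMatReal z g x v).det := rfl

theorem frameMatReal_updateRow (u v : E6) :
    frameMatReal z g x v = (frameMatReal z g x u).updateRow 5 (fun j => v j) := by
  ext i j
  fin_cases i <;> simp [frameMatReal, Matrix.updateRow_apply]

theorem inner_crossVec (v : E6) : inner ℝ (crossVec z g x) v = frameVol z g x v := by
  let L : E6 →ₗ[ℝ] ℝ :=
    { toFun := frameVol z g x
      map_add' := fun u v => by
        rw [frameVol_eq_det, frameVol_eq_det, frameVol_eq_det, frameMatReal_updateRow 0 (u + v),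
          frameMatReal_updateRow 0 u, frameMatReal_updateRow 0 v, ← Matrix.det_updateRow_add]
        rfl
      map_smul' := fun c u => by
        rw [frameVol_eq_det, frameVol_eq_det, frameMatReal_updateRow 0 (c • u),
          frameMatReal_updateRow 0 u, smul_eq_mul, RingHom.id_apply, ← Matrix.det_updateRow_smul]
        rfl }
  change _ = L v
  conv_rhs => rw [← (EuclideanSpace.basisFun (Fin 6) ℝ).sum_repr v]
  rw [map_sum]
  simp only [map_smul, smul_eq_mul, EuclideanSpace.basisFun_repr, EuclideanSpace.basisFun_apply]
  simp only [crossVec, PiLp.inner_apply]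
  exact Finset.sum_congr rfl fun i _ => by simp [L]

theorem crossVec_orthogonal : inner ℝ (crossVec z g x) (g x) = (0 : ℝ) ∧
    inner ℝ (crossVec z g x) (dmap z g x 1) = (0 : ℝ) ∧
    inner ℝ (crossVec z g x) (dmap z g x I) = (0 : ℝ) ∧
    inner ℝ (crossVec z g x) (II z g x 1 1) = (0 : ℝ) ∧
    inner ℝ (crossVec z g x) (II z g x 1 I) = (0 : ℝ) := by
  simp only [inner_crossVec, frameVol_eq_det]
  refine ⟨Matrix.det_zero_of_row_eq (i := 0) (j := 5) (by decide) rfl,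
    Matrix.det_zero_of_row_eq (i := 1) (j := 5) (by decide) rfl,
    Matrix.det_zero_of_row_eq (i := 2) (j := 5) (by decide) rfl,
    Matrix.det_zero_of_row_eq (i := 3) (j := 5) (by decide) rfl,
    Matrix.det_zero_of_row_eq (i := 4) (j := 5) (by decide) rfl⟩

theorem eq_zero_of_frameVol {u v : E6} (hv : frameVol z g x v ≠ 0)
    (h0 : inner ℝ (g x) u = (0 : ℝ)) (h1 : inner ℝ (dmap z g x 1) u = (0 : ℝ))
    (h2 : inner ℝ (dmap z g x I) u = (0 : ℝ)) (h3 : inner ℝ (II z g x 1 1) u = (0 : ℝ))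
    (h4 : inner ℝ (II z g x 1 I) u = (0 : ℝ)) (h5 : inner ℝ v u = (0 : ℝ)) : u = 0 := by
  have : (fun j => u j) = (0 : Fin 6 → ℝ) := by
    refine Matrix.eq_zero_of_mulVec_eq_zero hv (funext fun i => ?_)
    simp only [PiLp.inner_apply, RCLike.inner_apply, conj_trivial] at h0 h1 h2 h3 h4 h5
    fin_cases i <;> simp only [Matrix.mulVec, dotProduct, mul_comm] <;> assumption
  ext j
  exact congrFun this j

theorem exists_orthogonal (w : Fin 5 → E6) : ∃ v : E6, v ≠ 0 ∧ ∀ i, inner ℝ (w i) v = (0 : ℝ) := by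
  have h1 : Submodule.span ℝ (Set.range w) ≠ ⊤ := by
    intro h
    have := finrank_range_le_card (R := ℝ) w
    rw [Set.finrank, h, finrank_top] at this
    simp at this
  have h2 : (Submodule.span ℝ (Set.range w))ᗮ ≠ ⊥ := by
    rwa [Ne, Submodule.orthogonal_eq_bot_iff]
  obtain ⟨v, hv, hv0⟩ := Submodule.exists_mem_ne_zero_of_ne_bot h2
  exact ⟨v, hv0, fun i => (Submodule.mem_orthogonal _ _).1 hv _
    (Submodule.subset_span (Set.mem_range_self i))⟩

theorem II_mem_normalSpace (u v : ℂ) : II z g x u v ∈ normalSpace z g x :=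
  Submodule.starProjection_apply_mem _ _

theorem inner_self_II (u v : ℂ) : inner ℝ (g x) (II z g x u v) = (0 : ℝ) :=
  (Submodule.mem_orthogonal _ _).1 (II_mem_normalSpace u v) _
    (Submodule.mem_sup_left (Submodule.mem_span_singleton_self _))

theorem inner_dmap_II (t u v : ℂ) : inner ℝ (dmap z g x t) (II z g x u v) = (0 : ℝ) :=
  (Submodule.mem_orthogonal _ _).1 (II_mem_normalSpace u v) _
    (Submodule.mem_sup_right ⟨t, rfl⟩)

end FrameVol

/-! ### The transforms and their characterization in an adapted coordinate. -/

variable {S : Type*} [TopologicalSpace S] {z : OpenPartialHomeomorph S ℂ} {g G : S → E6} {x : S}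
  {ε : ℝ}

/-- `g` is a minimal immersion on the domain of the adapted coordinate `z`, with nondegenerate
ellipses of curvature. -/
structure AdaptedMin (z : OpenPartialHomeomorph S ℂ) (g : S → E6) : Prop where
  min : LocalMin (lift z g) z.target
  adapted : ∀ x ∈ z.source, f2 z g x ⬝ᵥ f2 z g x = -1
  nondeg : ∀ x ∈ z.source, aVec z g x ≠ 0

namespace AdaptedMin

variable (h : AdaptedMin z g) (hx : x ∈ z.source)
include h

theorem inner_ab (hx : x ∈ z.source) : inner ℝ (aVec z g x) (bVec z g x) = (0 : ℝ) :=
  (f2_dot_self_eq_neg_one (h.adapted x hx)).1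

theorem norm_sq_b (hx : x ∈ z.source) : ‖bVec z g x‖ ^ 2 = 1 + ‖aVec z g x‖ ^ 2 :=
  (f2_dot_self_eq_neg_one (h.adapted x hx)).2

theorem norm_a_pos (hx : x ∈ z.source) : 0 < ‖aVec z g x‖ := norm_pos_iff.2 (h.nondeg x hx)

theorem norm_b_pos (hx : x ∈ z.source) : 0 < ‖bVec z g x‖ := by
  have := h.norm_sq_b hx
  refine lt_of_le_of_ne (norm_nonneg _) fun h0 => ?_
  rw [← h0] at this
  nlinarith [sq_nonneg ‖aVec z g x‖]

/-- The five frame vectors are nonzero and pairwise orthogonal. With a nonzero v orthogonal to all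
of them they have nonzero volume, so the linear form represented by `crossVec` does not vanish at v.
-/
theorem crossVec_ne_zero (hx : x ∈ z.source) : crossVec z g x ≠ 0 := by
  obtain ⟨v, hv0, hv⟩ := exists_orthogonal
    ![g x, dmap z g x 1, dmap z g x I, II z g x 1 1, II z g x 1 I]
  have v0 : inner ℝ (g x) v = (0 : ℝ) := hv 0
  have v1 : inner ℝ (dmap z g x 1) v = (0 : ℝ) := hv 1
  have v2 : inner ℝ (dmap z g x I) v = (0 : ℝ) := hv 2
  have v3 : inner ℝ (II z g x 1 1) v = (0 : ℝ) := hv 3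
  have v4 : inner ℝ (II z g x 1 I) v = (0 : ℝ) := hv 4
  have hII : inner ℝ (II z g x 1 1) (II z g x 1 I) = (0 : ℝ) := by
    rw [II_one_one h.min hx, II_one_I, inner_smul_left, inner_smul_right, h.inner_ab hx]; simp
  obtain ⟨c1, c2, c3⟩ := conf_of_localMin h.min hx
  have hr := rho_re_ne h.min hx
  have g0 := inner_self_of_localMin h.min hx
  have g1 := inner_dmap_of_localMin h.min hx 1
  have g2 := inner_dmap_of_localMin h.min hx I
  have g3 : ∀ u v, inner ℝ (g x) (II z g x u v) = (0 : ℝ) := inner_self_II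
  have g4 : ∀ t u v, inner ℝ (dmap z g x t) (II z g x u v) = (0 : ℝ) := inner_dmap_II
  have hA : 0 < ‖II z g x 1 1‖ := by
    rw [II_one_one h.min hx, norm_smul, Real.norm_two]
    exact mul_pos two_pos (h.norm_a_pos hx)
  have hB : 0 < ‖II z g x 1 I‖ := by
    rw [II_one_I, norm_smul, Real.norm_two]
    exact mul_pos two_pos (h.norm_b_pos hx)
  intro h0
  have hdet := inner_crossVec (z := z) (g := g) (x := x) v
  rw [h0, inner_zero_left, frameVol_eq_det] at hdet
  obtain ⟨c, hc0, hc⟩ := Matrix.exists_vecMul_eq_zero_iff.2 hdet.symm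
  have hsum : c 0 • g x + c 1 • dmap z g x 1 + c 2 • dmap z g x I + c 3 • II z g x 1 1 +
      c 4 • II z g x 1 I + c 5 • v = 0 := by
    ext j
    have := congrFun hc j
    simp only [Matrix.vecMul, dotProduct, Fin.sum_univ_six, frameMatReal] at this
    simpa using this
  have c1' := (real_inner_comm (dmap z g x 1) (dmap z g x I)).trans c1
  have hII' := (real_inner_comm (II z g x 1 1) (II z g x 1 I)).trans hII
  have g1' := (real_inner_comm (g x) (dmap z g x 1)).trans g1
  have g2' := (real_inner_comm (g x) (dmap z g x I)).trans g2
  have g3' : ∀ u v, inner ℝ (II z g x u v) (g x) = (0 : ℝ) := fun u v =>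
    (real_inner_comm _ _).trans (g3 u v)
  have g4' : ∀ t u v, inner ℝ (II z g x u v) (dmap z g x t) = (0 : ℝ) := fun t u v =>
    (real_inner_comm _ _).trans (g4 t u v)
  have v0' := (real_inner_comm (g x) v).trans v0
  have v1' := (real_inner_comm (dmap z g x 1) v).trans v1
  have v2' := (real_inner_comm (dmap z g x I) v).trans v2
  have v3' := (real_inner_comm (II z g x 1 1) v).trans v3
  have v4' := (real_inner_comm (II z g x 1 I) v).trans v4
  have key : ∀ u : E6, inner ℝ u (c 0 • g x + c 1 • dmap z g x 1 + c 2 • dmap z g x I +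
      c 3 • II z g x 1 1 + c 4 • II z g x 1 I + c 5 • v) = (0 : ℝ) := fun u => by
    rw [hsum, inner_zero_right]
  simp only [inner_add_right, inner_smul_right] at key
  have k0 := key (g x)
  have k1 := key (dmap z g x 1)
  have k2 := key (dmap z g x I)
  have k3 := key (II z g x 1 1)
  have k4 := key (II z g x 1 I)
  have k5 := key v
  simp only [g0, g1, g2, g3, v0, mul_zero, mul_one, add_zero] at k0
  simp only [c1, c2, g1', g4, v1, mul_zero, add_zero, zero_add, mul_eq_zero, hr, or_false] at k1
  simp only [c1', c3, g2', g4, v2, mul_zero, add_zero, zero_add, mul_eq_zero, hr, or_false] at k2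
  simp only [g3', g4', hII, v3, mul_zero, add_zero, zero_add, mul_eq_zero, inner_self_eq_zero,
    norm_pos_iff.1 hA, or_false] at k3
  simp only [g3', g4', hII', v4, mul_zero, add_zero, zero_add, mul_eq_zero, inner_self_eq_zero,
    norm_pos_iff.1 hB, or_false] at k4
  simp only [v0', v1', v2', v3', v4', mul_zero, add_zero, zero_add, mul_eq_zero,
    inner_self_eq_zero, hv0, or_false] at k5
  refine hc0 (funext fun i => ?_)
  fin_cases i <;> assumption

theorem norm_crossVec_pos (hx : x ∈ z.source) : 0 < ‖crossVec z g x‖ :=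
  norm_pos_iff.2 (h.crossVec_ne_zero hx)

theorem norm_unitN (hx : x ∈ z.source) : ‖unitN z g x‖ = 1 := by
  rw [unitN, norm_smul, norm_inv, norm_norm, inv_mul_cancel₀ (h.norm_crossVec_pos hx).ne']

theorem frameVol_unitN (hx : x ∈ z.source) : frameVol z g x (unitN z g x) = ‖crossVec z g x‖ := by
  have := h.norm_crossVec_pos hx
  rw [← inner_crossVec, unitN, inner_smul_right, real_inner_self_eq_norm_sq]
  field_simp

omit h in
theorem unitN_orthogonal : inner ℝ (unitN z g x) (g x) = (0 : ℝ) ∧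
    (∀ u, inner ℝ (unitN z g x) (dmap z g x u) = (0 : ℝ)) ∧
    inner ℝ (unitN z g x) (II z g x 1 1) = (0 : ℝ) ∧
    inner ℝ (unitN z g x) (II z g x 1 I) = (0 : ℝ) := by
  obtain ⟨h0, h1, h2, h3, h4⟩ := crossVec_orthogonal (z := z) (g := g) (x := x)
  refine ⟨?_, fun u => ?_, ?_, ?_⟩
  · rw [unitN, inner_smul_left, h0, mul_zero]
  · rw [show u = u.re • (1 : ℂ) + u.im • I by apply Complex.ext <;> simp, map_add, map_smul,
      map_smul, unitN, inner_smul_left, inner_add_right, inner_smul_right, inner_smul_right, h1, h2]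
    simp
  · rw [unitN, inner_smul_left, h3, mul_zero]
  · rw [unitN, inner_smul_left, h4, mul_zero]

theorem unitN_ab (hx : x ∈ z.source) : inner ℝ (aVec z g x) (unitN z g x) = (0 : ℝ) ∧
    inner ℝ (bVec z g x) (unitN z g x) = (0 : ℝ) := by
  obtain ⟨-, -, h3, h4⟩ := unitN_orthogonal (z := z) (g := g) (x := x)
  rw [II_one_one h.min hx, inner_smul_right] at h3
  rw [II_one_I, inner_smul_right] at h4
  rw [real_inner_comm, real_inner_comm _ (bVec z g x)]
  constructor <;> linarith

theorem transformAt_eq (hx : x ∈ z.source) : transformAt ε z g x =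
    -((‖bVec z g x‖ ^ 2)⁻¹ • bVec z g x) +
      (ε * (‖aVec z g x‖ / ‖bVec z g x‖)) • unitN z g x := by
  have hb := h.norm_b_pos hx
  have hc : Real.cosh (phi z g x) = ‖bVec z g x‖ := by
    rw [phi, Real.cosh_arsinh, ← h.norm_sq_b hx, Real.sqrt_sq hb.le]
  have ht : Real.tanh (phi z g x) = ‖aVec z g x‖ / ‖bVec z g x‖ := by
    rw [Real.tanh_eq_sinh_div_cosh, hc, phi, Real.sinh_arsinh]
  rw [transformAt, hc, ht, smul_smul]
  congr 3
  field_simp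

theorem inner_ab_self (hx : x ∈ z.source) : inner ℝ (g x) (aVec z g x) = (0 : ℝ) ∧
    inner ℝ (g x) (bVec z g x) = (0 : ℝ) ∧
    ∀ t, inner ℝ (dmap z g x t) (aVec z g x) = (0 : ℝ) ∧
      inner ℝ (dmap z g x t) (bVec z g x) = (0 : ℝ) := by
  have h1 := inner_self_II (z := z) (g := g) (x := x) 1 1
  have h2 := inner_self_II (z := z) (g := g) (x := x) 1 I
  have h3 := fun t => inner_dmap_II (z := z) (g := g) (x := x) t 1 1
  have h4 := fun t => inner_dmap_II (z := z) (g := g) (x := x) t 1 I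
  simp only [II_one_one h.min hx, II_one_I, inner_smul_right] at h1 h2 h3 h4
  exact ⟨by linarith, by linarith, fun t => ⟨by linarith [h3 t], by linarith [h4 t]⟩⟩

/-- The properties that characterize the transforms. -/
theorem transformAt_spec (hε : ε ^ 2 = 1) (hx : x ∈ z.source) :
    inner ℝ (transformAt ε z g x) (transformAt ε z g x) = (1 : ℝ) ∧
    inner ℝ (g x) (transformAt ε z g x) = (0 : ℝ) ∧
    (∀ u, inner ℝ (dmap z g x u) (transformAt ε z g x) = (0 : ℝ)) ∧
    inner ℝ (aVec z g x) (transformAt ε z g x) = (0 : ℝ) ∧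
    inner ℝ (bVec z g x) (transformAt ε z g x) = (-1 : ℝ) ∧
    frameVol z g x (transformAt ε z g x) =
      ε * (‖aVec z g x‖ / ‖bVec z g x‖) * ‖crossVec z g x‖ := by
  obtain ⟨n0, n1, -, -⟩ := unitN_orthogonal (z := z) (g := g) (x := x)
  obtain ⟨na, nb⟩ := h.unitN_ab hx
  obtain ⟨i1, i2, i3⟩ := h.inner_ab_self hx
  have hb := h.norm_b_pos hx
  have hbb := h.norm_sq_b hx
  have hab := h.inner_ab hx
  have nb' := (real_inner_comm (bVec z g x) (unitN z g x)).trans nb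
  have n0' := (real_inner_comm (unitN z g x) (g x)).trans n0
  have n1' := fun u => (real_inner_comm (unitN z g x) (dmap z g x u)).trans (n1 u)
  have cb : frameVol z g x (bVec z g x) = 0 := by
    have := (crossVec_orthogonal (z := z) (g := g) (x := x)).2.2.2.2
    rw [II_one_I, inner_smul_right, inner_crossVec] at this
    linarith
  rw [h.transformAt_eq hx]
  refine ⟨?_, ?_, fun u => ?_, ?_, ?_, ?_⟩
  · simp only [inner_add_left, inner_add_right, inner_neg_left, inner_neg_right, inner_smul_left,
      inner_smul_right, nb, nb', real_inner_self_eq_norm_sq, h.norm_unitN hx, conj_trivial]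
    field_simp
    linear_combination ‖bVec z g x‖ * ‖aVec z g x‖ ^ 2 * hε - ‖bVec z g x‖ * hbb
  · simp only [inner_add_right, inner_neg_right, inner_smul_right, i2, n0']; simp
  · simp only [inner_add_right, inner_neg_right, inner_smul_right, (i3 u).2, n1']; simp
  · simp only [inner_add_right, inner_neg_right, inner_smul_right, hab, na]; simp
  · simp only [inner_add_right, inner_neg_right, inner_smul_right, nb, real_inner_self_eq_norm_sq]
    field_simp; simp
  · rw [← inner_crossVec, inner_add_right, inner_neg_right, inner_smul_right, inner_smul_right,
      inner_crossVec, inner_crossVec, cb, h.frameVol_unitN hx]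
    simp

/-- The linear conditions fix v up to its N-component, unit length fixes the square of that
component as tanh² φ, and the orientation fixes its sign. -/
theorem eq_transformAt (hε : ε ^ 2 = 1) (hx : x ∈ z.source) {v : E6} (h0 : inner ℝ v v = (1 : ℝ))
    (h1 : inner ℝ (g x) v = (0 : ℝ)) (h2 : ∀ u, inner ℝ (dmap z g x u) v = (0 : ℝ))
    (h3 : inner ℝ (aVec z g x) v = (0 : ℝ)) (h4 : inner ℝ (bVec z g x) v = (-1 : ℝ))
    (h5 : 0 ≤ ε * frameVol z g x v) : v = transformAt ε z g x := by
  obtain ⟨n0, n1, n2, n3⟩ := unitN_orthogonal (z := z) (g := g) (x := x)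
  obtain ⟨na, nb⟩ := h.unitN_ab hx
  obtain ⟨i1, i2, i3⟩ := h.inner_ab_self hx
  have hb := h.norm_b_pos hx
  have ha := h.norm_a_pos hx
  have hc := h.norm_crossVec_pos hx
  have hbb := h.norm_sq_b hx
  have hab := h.inner_ab hx
  have nb' := (real_inner_comm (bVec z g x) (unitN z g x)).trans nb
  have n0' := (real_inner_comm (unitN z g x) (g x)).trans n0
  have n1' := fun u => (real_inner_comm (unitN z g x) (dmap z g x u)).trans (n1 u)
  obtain ⟨s, hs⟩ : ∃ s : ℝ, inner ℝ (unitN z g x) v = s := ⟨_, rfl⟩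
  have hv : v = -((‖bVec z g x‖ ^ 2)⁻¹ • bVec z g x) + s • unitN z g x := by
    rw [← sub_eq_zero]
    refine eq_zero_of_frameVol (z := z) (g := g) (x := x) (v := unitN z g x)
      (by rw [h.frameVol_unitN hx]; exact hc.ne') ?_ ?_ ?_ ?_ ?_ ?_
    · simp only [inner_sub_right, inner_add_right, inner_neg_right, inner_smul_right, h1, i2, n0']
      simp
    · simp only [inner_sub_right, inner_add_right, inner_neg_right, inner_smul_right, h2,
        (i3 1).2, n1']
      simp
    · simp only [inner_sub_right, inner_add_right, inner_neg_right, inner_smul_right, h2,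
        (i3 I).2, n1']
      simp
    · rw [II_one_one h.min hx]
      simp only [inner_sub_right, inner_add_right, inner_neg_right, inner_smul_right,
        inner_smul_left, h3, hab, na]
      simp
    · rw [II_one_I]
      simp only [inner_sub_right, inner_add_right, inner_neg_right, inner_smul_right,
        inner_smul_left, h4, nb, real_inner_self_eq_norm_sq]
      field_simp
      simp
    · simp only [inner_sub_right, inner_add_right, inner_neg_right, inner_smul_right, nb', hs,
        real_inner_self_eq_norm_sq, h.norm_unitN hx]
      simp
  have hs2 : s ^ 2 = (‖aVec z g x‖ / ‖bVec z g x‖) ^ 2 := by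
    rw [hv] at h0
    simp only [inner_add_left, inner_add_right, inner_neg_left, inner_neg_right, inner_smul_left,
      inner_smul_right, nb, nb', real_inner_self_eq_norm_sq, h.norm_unitN hx, conj_trivial] at h0
    field_simp at h0 ⊢
    nlinarith
  have hfv : frameVol z g x v = s * ‖crossVec z g x‖ := by
    have e : crossVec z g x = ‖crossVec z g x‖ • unitN z g x := by
      rw [unitN, smul_smul, mul_inv_cancel₀ hc.ne', one_smul]
    rw [← inner_crossVec, e, inner_smul_left, hs, norm_smul, h.norm_unitN hx, norm_norm]
    simp [mul_comm]
  rw [hfv] at h5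
  have hse : s = ε * (‖aVec z g x‖ / ‖bVec z g x‖) := by
    have h6 : 0 ≤ ε * s := by
      by_contra! h7
      nlinarith
    have h8 : 0 < ‖aVec z g x‖ / ‖bVec z g x‖ := div_pos ha hb
    have h9 : ε * s = ‖aVec z g x‖ / ‖bVec z g x‖ := by
      rw [← sq_eq_sq₀ h6 h8.le, mul_pow, hε, hs2, one_mul]
    rw [← h9, ← mul_assoc, ← sq, hε, one_mul]
  rw [h.transformAt_eq hx, ← hse]
  exact hv

end AdaptedMin

/-! ### Smoothness of the transforms, and their inversion. -/

section Smoothness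

variable {S : Type*} [TopologicalSpace S] {z : OpenPartialHomeomorph S ℂ} {g G : S → E6} {x : S}
  {ε : ℝ}

theorem contDiffOn_frameVol {f₁ f₂ f₃ f₄ f₅ f₆ : ℂ → E6} {U : Set ℂ} (h₁ : ContDiffOn ℝ ∞ f₁ U)
    (h₂ : ContDiffOn ℝ ∞ f₂ U) (h₃ : ContDiffOn ℝ ∞ f₃ U) (h₄ : ContDiffOn ℝ ∞ f₄ U)
    (h₅ : ContDiffOn ℝ ∞ f₅ U) (h₆ : ContDiffOn ℝ ∞ f₆ U) :
    ContDiffOn ℝ ∞ (fun w => Matrix.det (Matrix.of fun i j : Fin 6 =>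
      (![f₁ w, f₂ w, f₃ w, f₄ w, f₅ w, f₆ w] i) j)) U := by
  simp only [Matrix.det_apply]
  refine ContDiffOn.sum fun σ _ => ContDiffOn.const_smul _ (contDiffOn_prod fun i _ => ?_)
  have key : ∀ k : Fin 6, ContDiffOn ℝ ∞
      (fun w => ![f₁ w, f₂ w, f₃ w, f₄ w, f₅ w, f₆ w] k) U := by
    intro k
    fin_cases k <;> assumption
  exact (EuclideanSpace.proj i : E6 →L[ℝ] ℝ).contDiff.comp_contDiffOn (key (σ i))

theorem contDiffOn_dmap (h : LocalMin (lift z g) z.target) (u : ℂ) :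
    ContDiffOn ℝ ∞ (fun w => dmap z g (z.symm w) u) z.target := by
  have := (contDiffOn_of_lift h.smooth).fderiv_of_isOpen h.isOpen (m := ∞) (by simp)
  refine (this.clm_apply (contDiffOn_const (c := u))).congr fun w hw => ?_
  rw [dmap, z.right_inv hw]

theorem contDiffOn_comp_symm_of_localMin (h : LocalMin (lift z g) z.target) :
    ContDiffOn ℝ ∞ (fun w => g (z.symm w)) z.target := contDiffOn_of_lift h.smooth

namespace AdaptedMin

variable (h : AdaptedMin z g)
include h

theorem contDiffOn_crossVec : ContDiffOn ℝ ∞ (fun w => crossVec z g (z.symm w)) z.target := by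
  refine contDiffOn_piLp' (p := 2) fun j => ?_
  have h4 := (contDiffOn_aVec h.min).const_smul (2 : ℝ)
  have h5 := (contDiffOn_bVec h.min).const_smul (2 : ℝ)
  refine (contDiffOn_frameVol (contDiffOn_comp_symm_of_localMin h.min) (contDiffOn_dmap h.min 1)
    (contDiffOn_dmap h.min I) h4 h5 (contDiffOn_const (c := EuclideanSpace.single j 1))).congr
    fun w hw => ?_
  have e1 := II_one_one h.min (z.map_target hw)
  have e2 := II_one_I (z := z) (g := g) (z.symm w)
  simp only [crossVec, frameVol, e1, e2]

theorem contDiffOn_unitN : ContDiffOn ℝ ∞ (fun w => unitN z g (z.symm w)) z.target := by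
  have hc := h.contDiffOn_crossVec
  have hn : ∀ w ∈ z.target, crossVec z g (z.symm w) ≠ 0 := fun w hw =>
    h.crossVec_ne_zero (z.map_target hw)
  exact ((hc.norm ℝ hn).inv fun w hw => norm_ne_zero_iff.2 (hn w hw)).smul hc

theorem contDiffOn_transformAt :
    ContDiffOn ℝ ∞ (fun w => transformAt ε z g (z.symm w)) z.target := by
  -- The norm is smooth only away from zero; the transforms are smooth because the ellipses do not
  -- degenerate.
  have ha : ContDiffOn ℝ ∞ (fun w => ‖aVec z g (z.symm w)‖) z.target :=
    (contDiffOn_aVec h.min).norm ℝ fun w hw => h.nondeg _ (z.map_target hw)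
  have hb : ContDiffOn ℝ ∞ (fun w => ‖bVec z g (z.symm w)‖) z.target :=
    (contDiffOn_bVec h.min).norm ℝ fun w hw => norm_pos_iff.1 (h.norm_b_pos (z.map_target hw))
  have hb0 : ∀ w ∈ z.target, ‖bVec z g (z.symm w)‖ ≠ 0 := fun w hw =>
    (h.norm_b_pos (z.map_target hw)).ne'
  refine ContDiffOn.congr ((((hb.pow 2).inv fun w hw => pow_ne_zero 2 (hb0 w hw)).smul
    (contDiffOn_bVec h.min)).neg.add
    ((contDiffOn_const (c := ε)).mul (ha.div hb hb0) |>.smul h.contDiffOn_unitN))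
    fun w hw => h.transformAt_eq (z.map_target hw)

/-- The transforms of an adapted minimal immersion. -/
theorem polar (hε : ε ^ 2 = 1) (hG : ∀ x ∈ z.source, G x = transformAt ε z g x) :
    Polar (lift z g) (lift z G) z.target := by
  have hGw : ∀ w ∈ z.target, G (z.symm w) = transformAt ε z g (z.symm w) :=
    fun w hw => hG _ (z.map_target hw)
  have hs : ∀ w ∈ z.target, sec (lift z g) w = f2 z g (z.symm w) := fun w hw => by
    rw [f2_eq_sec h.min (z.map_target hw), z.right_inv hw]
  have hsp := fun w (hw : w ∈ z.target) => h.transformAt_spec hε (z.map_target hw)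
  refine ⟨h.min, fun w hw => ?_, fun w hw => ?_, ?_, fun w _ => star_cx _, fun w hw => ?_,
    fun w hw => ?_, fun w hw => ?_, fun w hw => ?_, fun w hw => ?_⟩
  · rw [hs w hw, h.adapted _ (z.map_target hw)]
  · rw [hs w hw, f2_dot_star, real_inner_self_eq_norm_sq, real_inner_self_eq_norm_sq,
      h.norm_sq_b (z.map_target hw)]
    have := h.norm_a_pos (z.map_target hw)
    intro h1
    have h2 : ‖aVec z g (z.symm w)‖ ^ 2 + (1 + ‖aVec z g (z.symm w)‖ ^ 2) = 1 := by
      exact_mod_cast h1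
    nlinarith
  · exact cx.contDiff.comp_contDiffOn (h.contDiffOn_transformAt.congr hGw)
  · rw [lift, hGw w hw, cx_dot, (hsp w hw).1]; simp
  · rw [lift, lift, hGw w hw, cx_dot, (hsp w hw).2.1]; simp
  · have := dz_lift h.min (z.map_target hw)
    rw [z.right_inv hw] at this
    rw [this, lift, hGw w hw]
    simp [cx_dot, (hsp w hw).2.2.1]
  · rw [hs w hw, f2_eq, lift, hGw w hw]
    simp [cx_dot, (hsp w hw).2.2.2.1, (hsp w hw).2.2.2.2.1]
  · have := det_frameMat_lift h.min (z.map_target hw) (G (z.symm w))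
    rw [z.right_inv hw] at this
    rw [lift, this, hGw w hw, (hsp w hw).2.2.2.2.2]
    have h1 := h.norm_a_pos (z.map_target hw)
    have h2 := h.norm_b_pos (z.map_target hw)
    have h3 := h.norm_crossVec_pos (z.map_target hw)
    have h4 : ε ≠ 0 := fun h0 => by rw [h0] at hε; norm_num at hε
    have h5 : ε * (‖aVec z g (z.symm w)‖ / ‖bVec z g (z.symm w)‖) *
        ‖crossVec z g (z.symm w)‖ ≠ 0 := by positivity
    exact mul_ne_zero (by norm_num) (Complex.ofReal_ne_zero.2 h5)

theorem adaptedMin_transform (hε : ε ^ 2 = 1) (hG : ∀ x ∈ z.source, G x = transformAt ε z g x)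
    (ha : ∀ x ∈ z.source, aVec z G x ≠ 0) : AdaptedMin z G := by
  have hp := h.polar hε hG
  refine ⟨hp.localMin, fun x hx => ?_, ha⟩
  rw [f2_eq_sec hp.localMin hx, hp.adapted' (z.map_source hx)]

/-- The opposite transform of the transform is the original immersion: symmetry of the polar
relation supplies the linear conditions, the orientation of the frames the sign. -/
theorem transformAt_transform (hε : ε ^ 2 = 1) (hG : ∀ x ∈ z.source, G x = transformAt ε z g x)
    (hG' : AdaptedMin z G) (hx : x ∈ z.source) : transformAt (-ε) z G x = g x := by
  have hp := h.polar hε hG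
  have hw := z.map_source hx
  have h1 := hp.dz_dot_F hw
  have h2 := hp.dzb_dot_F hw
  have h3 := hp.sec_dot_F hw
  rw [← f2_eq_sec hG'.min hx, lift_apply hx, f2_eq] at h3
  simp only [sub_dotProduct, smul_dotProduct, cx_dot, smul_eq_mul] at h3
  have h4 := congrArg Complex.re h3
  have h5 := congrArg Complex.im h3
  simp at h4 h5
  symm
  refine hG'.eq_transformAt (by rw [neg_sq, hε]) hx (inner_self_of_localMin h.min hx) ?_
    (fun u => ?_) h4 (by linarith) ?_
  · rw [hG x hx, real_inner_comm]
    exact (h.transformAt_spec hε hx).2.1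
  · have e : cx (dmap z G x u) ⬝ᵥ lift z g (z x) = 0 := by
      rw [← lift_fderiv hG'.min hx, show u = u.re • (1 : ℂ) + u.im • I by
        apply Complex.ext <;> simp, map_add, map_smul, map_smul, fderiv_one_eq, fderiv_I_eq]
      simp [h1, h2]
    rw [lift_apply hx, cx_dot] at e
    exact_mod_cast e
  -- The frame volumes of the two maps differ by the factor -|Δ|² ≤ 0, hence the change from ε to
  -- -ε. A weak inequality is all that `eq_transformAt` asks for.
  · obtain ⟨Δ, hΔ⟩ := hp.det_frameMat hw
    rw [lift_apply hx, lift_apply hx, det_frameMat_lift h.min hx, det_frameMat_lift hG'.min hx]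
      at hΔ
    have e : frameVol z G x (g x) = -(Complex.normSq Δ) * frameVol z g x (G x) := by
      have : (frameVol z G x (g x) : ℂ) = -(Complex.normSq Δ : ℂ) * frameVol z g x (G x) := by
        linear_combination -4 * hΔ
      exact_mod_cast this
    rw [e, hG x hx, (h.transformAt_spec hε hx).2.2.2.2.2]
    have h6 := Complex.normSq_nonneg Δ
    have : -ε * (-(Complex.normSq Δ) * (ε * (‖aVec z g x‖ / ‖bVec z g x‖) *
        ‖crossVec z g x‖)) = ε ^ 2 * (Complex.normSq Δ * ((‖aVec z g x‖ / ‖bVec z g x‖) *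
        ‖crossVec z g x‖)) := by ring
    rw [this, hε]
    positivity

end AdaptedMin

/-! ### Effect of an orthogonal transformation of the ambient space. -/

section Isometry

variable (A : E6 ≃ₗᵢ[ℝ] E6)

theorem dmap_comp (u : ℂ) : dmap z (fun y => A (g y)) x u = A (dmap z g x u) := by
  have : (fun y => A (g y)) ∘ z.symm = A ∘ (g ∘ z.symm) := rfl
  rw [dmap, this, A.comp_fderiv]
  rfl

theorem normalSpace_comp : normalSpace z (fun y => A (g y)) x =
    (normalSpace z g x).map (A.toLinearEquiv : E6 →ₗ[ℝ] E6) := by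
  have h1 : LinearMap.range (dmap z (fun y => A (g y)) x).toLinearMap =
      (LinearMap.range (dmap z g x).toLinearMap).map (A.toLinearEquiv : E6 →ₗ[ℝ] E6) := by
    rw [← LinearMap.range_comp]
    congr 1
    ext u
    all_goals exact congrArg (fun v : E6 => v _) (dmap_comp A _)
  have h2 : Submodule.span ℝ {A (g x)} =
      (Submodule.span ℝ {g x}).map (A.toLinearEquiv : E6 →ₗ[ℝ] E6) := by
    rw [Submodule.map_span, Set.image_singleton]; rfl
  rw [normalSpace, normalSpace, h1, h2, ← Submodule.map_sup]
  exact (Submodule.map_orthogonal_equiv _ A).symm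

theorem II_comp (u v : ℂ) : II z (fun y => A (g y)) x u v = A (II z g x u v) := by
  have h1 : (fun w => fderiv ℝ ((fun y => A (g y)) ∘ z.symm) w v) =
      A ∘ fun w => fderiv ℝ (g ∘ z.symm) w v := by
    ext1 w
    have : (fun y => A (g y)) ∘ z.symm = A ∘ (g ∘ z.symm) := rfl
    rw [this, A.comp_fderiv]
    rfl
  have h2 : ∀ y, (normalSpace z (fun y => A (g y)) x).starProjection y =
      ((normalSpace z g x).map (A.toLinearEquiv : E6 →ₗ[ℝ] E6)).starProjection y := by
    simp only [normalSpace_comp, implies_true]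
  rw [II, II, h1, A.comp_fderiv, h2]
  have := Submodule.starProjection_map_apply A (normalSpace z g x)
    (A (fderiv ℝ (fun w => fderiv ℝ (g ∘ z.symm) w v) (z x) u))
  rw [A.symm_apply_apply] at this
  exact this

theorem frameVol_comp (v : E6) : frameVol z (fun y => A (g y)) x (A v) =
    LinearMap.det (A.toLinearEquiv : E6 →ₗ[ℝ] E6) * frameVol z g x v := by
  set b := (EuclideanSpace.basisFun (Fin 6) ℝ).toBasis
  have h1 : ∀ (u : E6) (j : Fin 6), (A u) j =
      ∑ k, LinearMap.toMatrix b b (A.toLinearEquiv : E6 →ₗ[ℝ] E6) j k * u k := by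
    intro u j
    have := congrFun (LinearMap.toMatrix_mulVec_repr b b (A.toLinearEquiv : E6 →ₗ[ℝ] E6) u) j
    simp only [Matrix.mulVec, dotProduct] at this
    simpa [b] using this.symm
  have h2 : frameMatReal z (fun y => A (g y)) x (A v) = frameMatReal z g x v *
      (LinearMap.toMatrix b b (A.toLinearEquiv : E6 →ₗ[ℝ] E6))ᵀ := by
    ext i j
    rw [Matrix.mul_apply]
    simp only [frameMatReal, dmap_comp, II_comp, Matrix.of_apply, Matrix.transpose_apply]
    fin_cases i <;> exact (h1 _ _).trans (Finset.sum_congr rfl fun _ _ => mul_comm _ _)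
  rw [frameVol_eq_det, frameVol_eq_det, h2, Matrix.det_mul, Matrix.det_transpose,
    LinearMap.det_toMatrix, mul_comm]

theorem det_eq_neg_one_of_neg (hA : LinearMap.det (A.toLinearEquiv : E6 →ₗ[ℝ] E6) < 0) :
    LinearMap.det (A.toLinearEquiv : E6 →ₗ[ℝ] E6) = -1 := by
  have h1 : ‖LinearMap.det (A.toLinearEquiv : E6 →ₗ[ℝ] E6)‖ = 1 := by
    rw [← LinearMap.normDet_eq_norm_det]
    exact LinearIsometry.normDet_eq_one A.toLinearIsometry
  rw [Real.norm_eq_abs, abs_of_neg hA] at h1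
  linarith

/-- A carries a, b to their counterparts, but reverses orientation and so sends N to minus the new
N. The (+)transform and the (-)transform change places. -/
theorem transformAt_comp (hA : LinearMap.det (A.toLinearEquiv : E6 →ₗ[ℝ] E6) = -1) :
    transformAt ε z (fun y => A (g y)) x = A (transformAt (-ε) z g x) := by
  have ha : aVec z (fun y => A (g y)) x = A (aVec z g x) := by
    simp only [aVec, II_comp, ← map_sub, ← map_smul]
  have hb : bVec z (fun y => A (g y)) x = A (bVec z g x) := by
    simp only [bVec, II_comp, ← map_smul]
  have hc : crossVec z (fun y => A (g y)) x = -A (crossVec z g x) := by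
    refine ext_inner_right ℝ fun v => ?_
    rw [← A.apply_symm_apply v, inner_crossVec, frameVol_comp, hA, inner_neg_left,
      A.inner_map_map, inner_crossVec]
    ring
  have hN : unitN z (fun y => A (g y)) x = -A (unitN z g x) := by
    rw [unitN, unitN, hc, norm_neg, A.norm_map, smul_neg, map_smul]
  have hphi : phi z (fun y => A (g y)) x = phi z g x := by
    rw [phi, phi, ha, A.norm_map]
  rw [transformAt, transformAt, hphi, hb, hN, A.norm_map, map_add, map_neg, map_smul, map_smul,
    map_smul]
  module

end Isometry

/-! ### Independence of the positively adapted coordinate. -/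

section Transition

variable [ChartedSpace ℂ S] {z' : OpenPartialHomeomorph S ℂ} {f e : S → E6}

/-- The transition derivative is ±1. The sign drops out of II, which is quadratic in it, and out of
the determinant, where it affects both tangent rows. -/
theorem frame_transition [IsManifold 𝓘(ℂ) ω S] (hf : IsMinimalImmersion f)
    (hz : IsPositivelyAdapted f e z)
    (hz' : IsPositivelyAdapted f e z') (hx : x ∈ z.source) (hx' : x ∈ z'.source)
    (hg : LocalMin (lift z' g) z'.target) : aVec z g x = aVec z' g x ∧
      bVec z g x = bVec z' g x ∧ crossVec z g x = crossVec z' g x := by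
  have hg2 := lift_contDiffAt hg hx'
  obtain ⟨ζ, hζ, hd, hII⟩ : ∃ ζ : ℝ, ζ ^ 2 = 1 ∧ (∀ u, dmap z g x u = ζ • dmap z' g x u) ∧
      ∀ u v, II z g x u v = II z' g x u v := by
    rcases transition_eq_one_or hf hz hz' hx hx' with h1 | h1
    · refine ⟨1, by norm_num, fun u => ?_, fun u v => ?_⟩
      · rw [dmap_transition hz.1.1 hz'.1.1 hx hx' hg2, h1, one_mul, one_smul]
      · rw [II_transition hz.1.1 hz'.1.1 hx hx' hg2, h1, one_mul, one_mul]
    · refine ⟨-1, by norm_num, fun u => ?_, fun u v => ?_⟩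
      · rw [dmap_transition hz.1.1 hz'.1.1 hx hx' hg2, h1, neg_one_mul, map_neg, neg_one_smul]
      · rw [II_transition hz.1.1 hz'.1.1 hx hx' hg2, h1, II_expand hg2,
          II_expand hg2 u v]
        simp
  have hv : ∀ v, frameVol z g x v = frameVol z' g x v := by
    intro v
    have h1 : frameMatReal z g x v =
        Matrix.of fun i j => (![1, ζ, ζ, 1, 1, 1] : Fin 6 → ℝ) i * frameMatReal z' g x v i j := by
      ext i j
      fin_cases i <;> simp [frameMatReal, hd, hII]
    rw [frameVol_eq_det, frameVol_eq_det, h1, Matrix.det_mul_column]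
    simp [Fin.prod_univ_succ, ← sq, hζ]
  exact ⟨by simp only [aVec, hII], by simp only [bVec, hII], by simp only [crossVec, hv]⟩

theorem unitN_transition [IsManifold 𝓘(ℂ) ω S] (hf : IsMinimalImmersion f)
    (hz : IsPositivelyAdapted f e z)
    (hz' : IsPositivelyAdapted f e z') (hx : x ∈ z.source) (hx' : x ∈ z'.source)
    (hg : LocalMin (lift z' g) z'.target) : unitN z g x = unitN z' g x := by
  rw [unitN, unitN, (frame_transition hf hz hz' hx hx' hg).2.2]

theorem transformAt_transition [IsManifold 𝓘(ℂ) ω S] (hf : IsMinimalImmersion f)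
    (hz : IsPositivelyAdapted f e z)
    (hz' : IsPositivelyAdapted f e z') (hx : x ∈ z.source) (hx' : x ∈ z'.source)
    (hg : LocalMin (lift z' g) z'.target) : transformAt ε z g x = transformAt ε z' g x := by
  obtain ⟨ha, hb, -⟩ := frame_transition hf hz hz' hx hx' hg
  rw [transformAt, transformAt, phi, phi, unitN_transition hf hz hz' hx hx' hg, ha, hb]

end Transition

end Smoothness

/-! ### Images in a hyperplane, and constancy of N. -/

section Normal

variable {S : Type*} [TopologicalSpace S] {z : OpenPartialHomeomorph S ℂ} {g : S → E6} {x : S}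
  {c : E6}

theorem inner_fderiv_eq_zero {γ : ℂ → E6} (h : ∀ w, inner ℝ c (γ w) = (0 : ℝ)) (w u : ℂ) :
    inner ℝ c (fderiv ℝ γ w u) = (0 : ℝ) := by
  by_cases hd : DifferentiableAt ℝ γ w
  · have := fderiv_inner_apply (𝕜 := ℝ) (differentiableAt_const c) hd u
    simp only [h] at this
    simpa using this.symm
  -- Where the map is not differentiable, `fderiv` has the default value 0, so no smoothness is
  -- required.
  · rw [fderiv_zero_of_not_differentiableAt hd]; simp

theorem dot_fderiv_eq_zero {γ : ℂ → C6} {c : C6} (h : ∀ w, γ w ⬝ᵥ c = 0) (w u : ℂ) :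
    fderiv ℝ γ w u ⬝ᵥ c = 0 := by
  by_cases hd : DifferentiableAt ℝ γ w
  · have := fderiv_dot hd (differentiableAt_const c) u
    simp only [h] at this
    simpa using this.symm
  · rw [fderiv_zero_of_not_differentiableAt hd]; simp

variable (hc : ∀ y, inner ℝ c (g y) = (0 : ℝ))
include hc

theorem inner_dmap_of_orthogonal (u : ℂ) : inner ℝ c (dmap z g x u) = (0 : ℝ) :=
  inner_fderiv_eq_zero (γ := g ∘ z.symm) (fun _ => hc _) _ _

theorem inner_II_of_orthogonal (u v : ℂ) : inner ℝ c (II z g x u v) = (0 : ℝ) := by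
  have hmem : c ∈ normalSpace z g x := by
    rw [normalSpace, Submodule.mem_orthogonal]
    intro y hy
    obtain ⟨p, hp, t, ⟨s, rfl⟩, rfl⟩ := Submodule.mem_sup.1 hy
    obtain ⟨k, rfl⟩ := Submodule.mem_span_singleton.1 hp
    rw [real_inner_comm, inner_add_right, inner_smul_right, hc, mul_zero, zero_add]
    exact inner_dmap_of_orthogonal hc s
  rw [II, ← Submodule.inner_starProjection_left_eq_right,
    Submodule.starProjection_eq_self_iff.2 hmem]
  exact inner_fderiv_eq_zero (fun w => inner_fderiv_eq_zero (γ := g ∘ z.symm) (fun _ => hc _) _ _)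
    _ _

theorem mem_span_crossVec (h0 : crossVec z g x ≠ 0) :
    c ∈ Submodule.span ℝ {crossVec z g x} := by
  obtain ⟨n0, n1, n2, n3, n4⟩ := crossVec_orthogonal (z := z) (g := g) (x := x)
  have hn : frameVol z g x (crossVec z g x) ≠ 0 := by
    rw [← inner_crossVec]; exact fun h => h0 (inner_self_eq_zero.1 h)
  rw [Submodule.mem_span_singleton]
  refine ⟨inner ℝ (crossVec z g x) c / inner ℝ (crossVec z g x) (crossVec z g x), ?_⟩
  rw [eq_comm, ← sub_eq_zero]
  have hne : (inner ℝ (crossVec z g x) (crossVec z g x) : ℝ) ≠ 0 := by rwa [inner_crossVec]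
  refine eq_zero_of_frameVol hn ?_ ?_ ?_ ?_ ?_ ?_
  · rw [real_inner_comm, inner_sub_left, inner_smul_left, n0, hc]; simp
  · rw [real_inner_comm, inner_sub_left, inner_smul_left, n1, inner_dmap_of_orthogonal hc]; simp
  · rw [real_inner_comm, inner_sub_left, inner_smul_left, n2, inner_dmap_of_orthogonal hc]; simp
  · rw [real_inner_comm, inner_sub_left, inner_smul_left, n3, inner_II_of_orthogonal hc]; simp
  · rw [real_inner_comm, inner_sub_left, inner_smul_left, n4, inner_II_of_orthogonal hc]; simp
  · rw [inner_sub_right, inner_smul_right, div_mul_cancel₀ _ hne, sub_self]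

/-- f₂ takes values in the hyperplane orthogonal to c, hence so does its derivative, and N is a
multiple of c. -/
theorem alpha_eq_zero_of_orthogonal (hc0 : c ≠ 0) : alpha z g x = 0 := by
  have hN : ∃ m : ℝ, unitN z g x = m • c := by
    by_cases h0 : crossVec z g x = 0
    -- If the frame degenerates, `unitN` has the default value 0.
    · exact ⟨0, by rw [unitN, h0]; simp⟩
    · obtain ⟨k, hk⟩ := Submodule.mem_span_singleton.1 (mem_span_crossVec hc h0)
      have hk0 : k ≠ 0 := by
        rintro rfl
        exact hc0 (by rw [← hk, zero_smul])
      refine ⟨‖crossVec z g x‖⁻¹ * k⁻¹, ?_⟩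
      rw [unitN, ← hk, smul_smul, mul_assoc, inv_mul_cancel₀ hk0, mul_one]
  obtain ⟨m, hm⟩ := hN
  have h1 : ∀ y, f2 z g y ⬝ᵥ cx c = 0 := by
    intro y
    rw [f2_eq, sub_dotProduct, smul_dotProduct, cx_dot, cx_dot, real_inner_comm,
      real_inner_comm c (bVec z g y), aVec, bVec, inner_smul_right, inner_smul_right,
      inner_sub_right, inner_II_of_orthogonal hc, inner_II_of_orthogonal hc,
      inner_II_of_orthogonal hc]
    simp
  have h2 := fun u => dot_fderiv_eq_zero (γ := f2 z g ∘ z.symm) (fun w => h1 (z.symm w)) (z x) u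
  have h3 : (fun j => (unitN z g x j : ℂ)) = (m : ℂ) • cx c := by
    rw [hm]
    ext j
    simp [cx_apply]
  rw [alpha, h3, dotProduct_smul, del, smul_dotProduct, sub_dotProduct, smul_dotProduct, h2, h2]
  simp

end Normal

section Constant

variable {S : Type*} [TopologicalSpace S] {z : OpenPartialHomeomorph S ℂ} {g : S → E6}

/-- Differentiating the orthogonality relations of N, every pairing of ∂N with the frame vanishes
except the one with sec, which is -α. Since N is real, ∂̄N is the conjugate of ∂N. -/
theorem AdaptedMin.fderiv_unitN_eq_zero (h : AdaptedMin z g)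
    (hα : ∀ x ∈ z.source, alpha z g x = 0) {w : ℂ} (hw : w ∈ z.target) :
    fderiv ℝ (fun w => unitN z g (z.symm w)) w = 0 := by
  have hU := h.min.isOpen
  have hN := h.contDiffOn_unitN
  have hNc : ContDiffOn ℝ ∞ (lift z (unitN z g)) z.target := cx.contDiff.comp_contDiffOn hN
  have hs : ∀ w ∈ z.target, sec (lift z g) w = f2 z g (z.symm w) := fun w hw => by
    rw [f2_eq_sec h.min (z.map_target hw), z.right_inv hw]
  have o := fun w => unitN_orthogonal (z := z) (g := g) (x := z.symm w)
  have e0 : ∀ w ∈ z.target, lift z (unitN z g) w ⬝ᵥ lift z g w = 0 := fun w hw => by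
    rw [lift, lift, cx_dot, (o w).1]; simp
  have e1 : ∀ w ∈ z.target, lift z (unitN z g) w ⬝ᵥ dz (lift z g) w = 0 := fun w hw => by
    have := dz_lift h.min (z.map_target hw)
    rw [z.right_inv hw] at this
    rw [this, lift]
    simp [cx_dot, (o w).2.1]
  have e2 : ∀ w ∈ z.target, lift z (unitN z g) w ⬝ᵥ dzb (lift z g) w = 0 := fun w hw => by
    have := dzb_lift h.min (z.map_target hw)
    rw [z.right_inv hw] at this
    rw [this, lift]
    simp [cx_dot, (o w).2.1]
  have e3 : ∀ w ∈ z.target, lift z (unitN z g) w ⬝ᵥ sec (lift z g) w = 0 := fun w hw => by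
    obtain ⟨h1, h2⟩ := h.unitN_ab (z.map_target hw)
    rw [hs w hw, f2_eq, lift, dotProduct_sub, dotProduct_smul, cx_dot, cx_dot, real_inner_comm,
      h1, real_inner_comm, h2]
    simp
  have e4 : ∀ w ∈ z.target, lift z (unitN z g) w ⬝ᵥ star (sec (lift z g) w) = 0 := fun w hw => by
    have := congrArg star (e3 w hw)
    rwa [← star_dot, lift, star_cx, star_zero] at this
  have e5 : ∀ w ∈ z.target, lift z (unitN z g) w ⬝ᵥ lift z (unitN z g) w = 1 := fun w hw => by
    rw [lift, cx_dot, real_inner_self_eq_norm_sq, h.norm_unitN (z.map_target hw)]; simp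
  have eα : lift z (unitN z g) w ⬝ᵥ dz (sec (lift z g)) w = 0 := by
    have h1 := hα _ (z.map_target hw)
    have h2 : dz (sec (lift z g)) w = del z (f2 z g) (z.symm w) := by
      rw [dz_congr (Filter.eventuallyEq_of_mem (hU.mem_nhds hw) hs), del, z.right_inv hw]
      rfl
    rw [h2, dotProduct_comm]
    exact h1
  have hdz : dz (lift z (unitN z g)) w = 0 := by
    have hdet : (frameMat (lift z g) w (lift z (unitN z g) w)).det ≠ 0 := by
      have := det_frameMat_lift h.min (z.map_target hw) (unitN z g (z.symm w))
      rw [z.right_inv hw] at this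
      rw [lift, this, h.frameVol_unitN (z.map_target hw)]
      exact mul_ne_zero (by norm_num)
        (Complex.ofReal_ne_zero.2 (h.norm_crossVec_pos (z.map_target hw)).ne')
    refine eq_zero_of_frameMat hdet ?_ ?_ ?_ ?_ ?_ ?_
    · have := dz_dot_of_const hU hNc h.min.smooth e0 hw
      rwa [e1 w hw, add_zero] at this
    · have := dz_dot_of_const hU hNc h.min.smooth_dz e1 hw
      have e : dz (dz (lift z g)) w = sec (lift z g) w + ((dz (dz (lift z g)) w ⬝ᵥ
          dzb (lift z g) w) / (dz (lift z g) w ⬝ᵥ dzb (lift z g) w)) • dz (lift z g) w := by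
        rw [sec]; module
      rw [e, dotProduct_add, dotProduct_smul, e3 w hw, e1 w hw] at this
      simpa using this
    · have := dz_dot_of_const hU hNc h.min.smooth_dzb e2 hw
      rwa [h.min.dz_dzb hw, dotProduct_smul, e0 w hw, smul_zero, add_zero] at this
    · have := dz_dot_of_const hU hNc h.min.smooth_sec e3 hw
      rwa [eα, add_zero] at this
    · have := dz_dot_of_const hU hNc h.min.smooth_star_sec e4 hw
      obtain ⟨κ, hκ⟩ := h.min.exists_dz_star_sec hw
      rwa [hκ, dotProduct_smul, e2 w hw, smul_zero, add_zero] at this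
    · have := dz_dot_of_const hU hNc hNc e5 hw
      rw [dotProduct_comm (lift z (unitN z g) w), ← two_mul] at this
      simpa using this
  have hdzb : dzb (lift z (unitN z g)) w = 0 := by
    rw [dzb_eq_star (F := lift z (unitN z g)) hU (fun w _ => star_cx _) hw, hdz, star_zero]
  have h0 := fderiv_eq_zero_of_dz hdz hdzb
  ext1 u
  apply cx_injective
  rw [← fderiv_cx (hN.diffAt hU hw)]
  change fderiv ℝ (lift z (unitN z g)) w u = _
  rw [h0]; simp

end Constant

/-! ### The global transforms and the two-sided sequence. -/

variable {S : Type*} [TopologicalSpace S] [ChartedSpace ℂ S] [IsManifold 𝓘(ℂ) ω S]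
  {f e g : S → E6} {ε : ℝ}

/-- The transform computed in the coordinates adapted to `f` and `e`. -/
def transform (f e : S → E6) (ε : ℝ) (g : S → E6) : S → E6 :=
  fun x => transformAt ε (adaptedCoord f e x) g x

/-- `g` is an adapted minimal immersion in all the coordinates adapted to `f` and `e`. -/
def IsAdaptedMin (f e g : S → E6) : Prop :=
  ∀ z : OpenPartialHomeomorph S ℂ, IsPositivelyAdapted f e z → AdaptedMin z g

section Sequence

variable (hf : IsMinimalImmersion f) (hcirc : ∀ x, NoncircularEllipse f x)
  (he : IsMajorAxisField f e)
include hf hcirc he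

theorem adaptedCoord_spec (x : S) :
    IsPositivelyAdapted f e (adaptedCoord f e x) ∧ x ∈ (adaptedCoord f e x).source := by
  have h := exists_positivelyAdapted hf (hcirc x) he
  rw [adaptedCoord, dif_pos h]
  exact h.choose_spec

theorem transform_apply (hg : IsAdaptedMin f e g) {z : OpenPartialHomeomorph S ℂ}
    (hz : IsPositivelyAdapted f e z) {x : S} (hx : x ∈ z.source) :
    transform f e ε g x = transformAt ε z g x :=
  transformAt_transition hf (adaptedCoord_spec hf hcirc he x).1 hz
    (adaptedCoord_spec hf hcirc he x).2 hx (hg z hz).min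

theorem isAdaptedMin_transform (hε : ε ^ 2 = 1) (hg : IsAdaptedMin f e g)
    (hn : ∀ x, NondegenerateEllipse (transform f e ε g) x) :
    IsAdaptedMin f e (transform f e ε g) := fun z hz =>
  (hg z hz).adaptedMin_transform hε (fun _ hx => transform_apply hf hcirc he hg hz hx)
    fun x hx => aVec_ne_zero hz.1.1
      ((hg z hz).polar hε fun _ hx => transform_apply hf hcirc he hg hz hx).localMin hx (hn x)

theorem transform_transform (hε : ε ^ 2 = 1) (hg : IsAdaptedMin f e g)
    (hg' : IsAdaptedMin f e (transform f e ε g)) :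
    transform f e (-ε) (transform f e ε g) = g := by
  ext1 x
  obtain ⟨hz, hx⟩ := adaptedCoord_spec hf hcirc he x
  exact (hg _ hz).transformAt_transform hε
    (fun _ hx => transform_apply hf hcirc he hg hz hx) (hg' _ hz) hx

variable (hnondeg : ∀ (p : ℤ) (x : S), NondegenerateEllipse (transformSeq f e p) x)
include hnondeg

theorem isAdaptedMin_transformSeq (p : ℤ) : IsAdaptedMin f e (transformSeq f e p) := by
  have h0 : IsAdaptedMin f e f := fun z hz =>
    ⟨hf.localMin hz.1.1, hz.1.2, fun x hx => aVec_ne_zero hz.1.1 (hf.localMin hz.1.1) hx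
      (hnondeg 0 x)⟩
  have h1 : ∀ n : ℕ, IsAdaptedMin f e (transformSeq f e (Int.ofNat n)) := by
    intro n
    induction n with
    | zero => exact h0
    | succ n ih =>
      have e1 : transformSeq f e (Int.ofNat (n + 1)) =
          transform f e 1 (transformSeq f e (Int.ofNat n)) := Function.iterate_succ_apply' _ _ _
      have := isAdaptedMin_transform hf hcirc he (ε := 1) (by norm_num) ih
        (by rw [← e1]; exact hnondeg _)
      rwa [← e1] at this
  have h2 : ∀ n : ℕ, IsAdaptedMin f e (transformSeq f e (Int.negSucc n)) := by
    intro n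
    induction n with
    | zero =>
      exact isAdaptedMin_transform hf hcirc he (ε := -1) (by norm_num) h0 (hnondeg (Int.negSucc 0))
    | succ n ih =>
      have e1 : transformSeq f e (Int.negSucc (n + 1)) =
          transform f e (-1) (transformSeq f e (Int.negSucc n)) :=
        Function.iterate_succ_apply' _ _ _
      have := isAdaptedMin_transform hf hcirc he (ε := -1) (by norm_num) ih
        (by rw [← e1]; exact hnondeg _)
      rwa [← e1] at this
  cases p with
  | ofNat n => exact h1 n
  | negSucc n => exact h2 n

/-- Definition for p ≥ 0. For p < 0 the sequence was built by (-)transforms, and the inversion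
formula applies. -/
theorem transformSeq_add_one (p : ℤ) :
    transformSeq f e (p + 1) = transform f e 1 (transformSeq f e p) := by
  have hA := isAdaptedMin_transformSeq hf hcirc he hnondeg
  cases p with
  | ofNat n => exact Function.iterate_succ_apply' _ _ _
  -- `Int.negSucc n` is -(n + 1), so n = 0 is the step from index -1 to index 0.
  | negSucc n =>
    cases n with
    | zero =>
      have := transform_transform hf hcirc he (ε := -1) (by norm_num) (hA 0) (hA (Int.negSucc 0))
      rw [neg_neg] at this
      exact this.symm
    | succ n =>
      have e1 : transformSeq f e (Int.negSucc (n + 1)) =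
          transform f e (-1) (transformSeq f e (Int.negSucc n)) :=
        Function.iterate_succ_apply' _ _ _
      have h2 := hA (Int.negSucc (n + 1))
      rw [e1] at h2
      have := transform_transform hf hcirc he (ε := -1) (by norm_num) (hA (Int.negSucc n)) h2
      rw [neg_neg, ← e1] at this
      exact this.symm

theorem transformSeq_sub_one (p : ℤ) :
    transformSeq f e (p - 1) = transform f e (-1) (transformSeq f e p) := by
  have hA := isAdaptedMin_transformSeq hf hcirc he hnondeg
  have e1 := transformSeq_add_one hf hcirc he hnondeg (p - 1)
  rw [sub_add_cancel] at e1
  have h2 := hA p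
  rw [e1] at h2 ⊢
  exact (transform_transform hf hcirc he (ε := 1) (by norm_num) (hA (p - 1)) h2).symm

end Sequence

/-! ### Linear fullness and the reflection. -/

omit [IsManifold 𝓘(ℂ) ω S] in
theorem transform_comp (A : E6 ≃ₗᵢ[ℝ] E6)
    (hA : LinearMap.det (A.toLinearEquiv : E6 →ₗ[ℝ] E6) = -1) :
    transform f e ε (fun y => A (g y)) = fun x => A (transform f e (-ε) g x) :=
  funext fun _ => transformAt_comp A hA

omit [ChartedSpace ℂ S] [IsManifold 𝓘(ℂ) ω S] [TopologicalSpace S] in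
theorem exists_orthogonal_of_not_full (h : ¬ LinearlyFull g) :
    ∃ c : E6, c ≠ 0 ∧ ∀ y, inner ℝ c (g y) = (0 : ℝ) := by
  have h2 : (Submodule.span ℝ (Set.range g))ᗮ ≠ ⊥ := by
    rwa [Ne, Submodule.orthogonal_eq_bot_iff]
  obtain ⟨c, hc, hc0⟩ := Submodule.exists_mem_ne_zero_of_ne_bot h2
  exact ⟨c, hc0, fun y => by
    rw [real_inner_comm]
    exact (Submodule.mem_orthogonal _ _).1 hc _ (Submodule.subset_span (Set.mem_range_self y))⟩

omit [ChartedSpace ℂ S] [IsManifold 𝓘(ℂ) ω S] in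
-- At a single point, every vector orthogonal to the image is a multiple of `crossVec`, so the
-- orthogonal complement of the span is at most a line.
theorem finrank_span_of_not_full {z : OpenPartialHomeomorph S ℂ} (hg : AdaptedMin z g) {x : S}
    (hx : x ∈ z.source) (h : ¬ LinearlyFull g) :
    Module.finrank ℝ (Submodule.span ℝ (Set.range g)) = 5 ∧
      Module.finrank ℝ (Submodule.span ℝ (Set.range g))ᗮ = 1 := by
  have hle : (Submodule.span ℝ (Set.range g))ᗮ ≤ Submodule.span ℝ {crossVec z g x} := by
    intro c hc
    refine mem_span_crossVec (fun y => ?_) (hg.crossVec_ne_zero hx)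
    rw [real_inner_comm]
    exact (Submodule.mem_orthogonal _ _).1 hc _ (Submodule.subset_span (Set.mem_range_self y))
  have h1 := Submodule.finrank_mono hle
  rw [finrank_span_singleton (hg.crossVec_ne_zero hx)] at h1
  have h2 : Module.finrank ℝ (Submodule.span ℝ (Set.range g))ᗮ ≠ 0 := by
    rw [Ne, Submodule.finrank_eq_zero, Submodule.orthogonal_eq_bot_iff]
    exact h
  have h3 := Submodule.finrank_add_finrank_orthogonal (Submodule.span ℝ (Set.range g))
  rw [finrank_euclideanSpace, Fintype.card_fin] at h3
  omega

theorem not_full_of_alpha_eq_zero [ConnectedSpace S] (hf : IsMinimalImmersion f)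
    (hcirc : ∀ x, NoncircularEllipse f x) (he : IsMajorAxisField f e) (hg : IsAdaptedMin f e g)
    (hα : ∀ z : OpenPartialHomeomorph S ℂ, IsAdapted g z → ∀ x ∈ z.source, alpha z g x = 0) :
    ¬ LinearlyFull g := by
  set N : S → E6 := fun x => unitN (adaptedCoord f e x) g x with hN
  have hNz : ∀ z : OpenPartialHomeomorph S ℂ, IsPositivelyAdapted f e z → ∀ x ∈ z.source,
      N x = unitN z g x := fun z hz x hx =>
    unitN_transition hf (adaptedCoord_spec hf hcirc he x).1 hz
      (adaptedCoord_spec hf hcirc he x).2 hx (hg z hz).min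
  -- N does not depend on the positively adapted coordinate, so it is a global field; its derivative
  -- vanishes in each such coordinate, and connectedness of S makes it constant.
  have hloc : IsLocallyConstant N := by
    rw [IsLocallyConstant.iff_eventually_eq]
    intro x
    obtain ⟨hz, hx⟩ := adaptedCoord_spec hf hcirc he x
    set z := adaptedCoord f e x
    have hgz := hg z hz
    have hd := fun w (hw : w ∈ z.target) =>
      hgz.fderiv_unitN_eq_zero (hα z ⟨hz.1.1, hgz.adapted⟩) hw
    obtain ⟨r, hr, hball⟩ := Metric.isOpen_iff.1 z.open_target _ (z.map_source hx)
    have hsrc : ∀ᶠ y in 𝓝 x, y ∈ z.source := z.open_source.mem_nhds hx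
    have hev : ∀ᶠ y in 𝓝 x, y ∈ z.source ∧ z y ∈ Metric.ball (z x) r :=
      hsrc.and
        ((z.continuousAt hx).eventually (Metric.ball_mem_nhds _ hr))
    filter_upwards [hev] with y hy
    have := Metric.isOpen_ball.is_const_of_fderiv_eq_zero (𝕜 := ℝ)
      (convex_ball (z x) r).isPreconnected
      ((hgz.contDiffOn_unitN.differentiableOn (by simp)).mono hball)
      (fun w hw => hd w (hball hw)) hy.2 (Metric.mem_ball_self hr)
    simp only [z.left_inv hy.1, z.left_inv hx] at this
    rw [hNz z hz y hy.1, hNz z hz x hx]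
    exact this
  obtain ⟨x₀⟩ := (inferInstance : Nonempty S)
  have hconst : ∀ x, N x = N x₀ := fun x => hloc.apply_eq_of_preconnectedSpace x x₀
  intro hfull
  have h1 : Submodule.span ℝ (Set.range g) ≤ (Submodule.span ℝ {N x₀})ᗮ := by
    rw [Submodule.span_le]
    rintro _ ⟨x, rfl⟩
    rw [SetLike.mem_coe, Submodule.mem_orthogonal_singleton_iff_inner_right, ← hconst x]
    exact AdaptedMin.unitN_orthogonal.1
  rw [LinearlyFull] at hfull
  rw [hfull] at h1
  have h2 := Submodule.mem_orthogonal_singleton_iff_inner_right.1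
    (h1 (Submodule.mem_top (x := N x₀)))
  obtain ⟨hz, hx⟩ := adaptedCoord_spec hf hcirc he x₀
  rw [real_inner_self_eq_norm_sq, (hg _ hz).norm_unitN hx] at h2
  norm_num at h2

theorem det_reflection_eq_neg_one {K : Submodule ℝ E6} (hK : Module.finrank ℝ Kᗮ = 1) :
    LinearMap.det (K.reflection.toLinearEquiv : E6 →ₗ[ℝ] E6) = -1 := by
  have := Submodule.det_reflection K
  rw [hK, pow_one] at this
  exact this

end MinimalSphere

end

/-! ### The main theorem. -/

theorem theorem3 {S : Type*} [TopologicalSpace S] [T2Space S] [ConnectedSpace S]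
    [ChartedSpace ℂ S] [IsManifold 𝓘(ℂ) ω S]
    (f e : S → MinimalSphere.E6)
    (hf : MinimalSphere.IsMinimalImmersion f)
    (hcirc : ∀ x, MinimalSphere.NoncircularEllipse f x)
    (he : MinimalSphere.IsMajorAxisField f e)
    (hnondeg : ∀ (p : ℤ) (x : S),
      MinimalSphere.NondegenerateEllipse (MinimalSphere.transformSeq f e p) x)
    (q : ℤ) :
    [ (∀ z : OpenPartialHomeomorph S ℂ,
        MinimalSphere.IsAdapted (MinimalSphere.transformSeq f e q) z →
          ∀ x ∈ z.source, MinimalSphere.alpha z (MinimalSphere.transformSeq f e q) x = 0),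
      ¬ MinimalSphere.LinearlyFull (MinimalSphere.transformSeq f e q),
      (∃ A : MinimalSphere.E6 ≃ₗᵢ[ℝ] MinimalSphere.E6,
        LinearMap.det (A.toLinearEquiv : MinimalSphere.E6 →ₗ[ℝ] MinimalSphere.E6) < 0 ∧
          ∀ x, MinimalSphere.transformSeq f e (q + 1) x =
            A (MinimalSphere.transformSeq f e (q - 1) x)) ].TFAE ∧
    (¬ MinimalSphere.LinearlyFull (MinimalSphere.transformSeq f e q) →
      Module.finrank ℝ (Submodule.span ℝ (Set.range (MinimalSphere.transformSeq f e q))) = 5 ∧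
      ∀ (r : ℤ) (x : S), MinimalSphere.transformSeq f e (q + r) x =
        (Submodule.span ℝ (Set.range (MinimalSphere.transformSeq f e q))).reflection
          (MinimalSphere.transformSeq f e (q - r) x)) := by
  open MinimalSphere in
  have hA := isAdaptedMin_transformSeq hf hcirc he hnondeg
  have hadd := transformSeq_add_one hf hcirc he hnondeg
  have hsub := transformSeq_sub_one hf hcirc he hnondeg
  obtain ⟨x₀⟩ := (inferInstance : Nonempty S)
  obtain ⟨hz₀, hx₀⟩ := adaptedCoord_spec hf hcirc he x₀
  set K := Submodule.span ℝ (Set.range (transformSeq f e q)) with hK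
  have hfin : ¬ LinearlyFull (transformSeq f e q) →
      Module.finrank ℝ K = 5 ∧ Module.finrank ℝ Kᗮ = 1 :=
    finrank_span_of_not_full (hA q _ hz₀) hx₀
  -- The reflection fixes f^q and, having determinant -1, exchanges the transforms; each step
  -- applies them to both sides.
  have hnat : ¬ LinearlyFull (transformSeq f e q) → ∀ n : ℕ,
      transformSeq f e (q + n) = fun x => K.reflection (transformSeq f e (q - n) x) := by
    intro h n
    have hdet := det_reflection_eq_neg_one (hfin h).2
    induction n with
    | zero =>
      ext1 x
      simp only [Nat.cast_zero, add_zero, sub_zero]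
      exact (K.reflection_mem_subspace_eq_self
        (Submodule.subset_span (Set.mem_range_self x))).symm
    | succ n ih =>
      push_cast
      rw [← add_assoc, hadd, ih, transform_comp _ hdet, ← sub_sub, hsub]
  refine ⟨?_, fun h => ⟨(hfin h).1, fun r x => ?_⟩⟩
  · tfae_have 1 → 2 := not_full_of_alpha_eq_zero hf hcirc he (hA q)
    tfae_have 2 → 1 := fun h z _ x _ => by
      obtain ⟨c, hc0, hc⟩ := exists_orthogonal_of_not_full h
      exact alpha_eq_zero_of_orthogonal hc hc0
    tfae_have 2 → 3 := fun h => by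
      refine ⟨K.reflection, ?_, fun x => ?_⟩
      · rw [det_reflection_eq_neg_one (hfin h).2]; norm_num
      · have := congrFun (hnat h 1) x
        simpa using this
    tfae_have 3 → 2 := fun ⟨A, hdet, hAx⟩ hfull => by
      have hdet' := det_eq_neg_one_of_neg A hdet
      have e1 : transformSeq f e (q + 1) = fun x => A (transformSeq f e (q - 1) x) := funext hAx
      -- The (-)transform of f^{q+1} = A f^{q-1} is f^q on the left and A (f^{q-1})^+ = A f^q on the
      -- right.
      have e2 : transformSeq f e q = fun x => A (transformSeq f e q x) := by
        have h1 := hsub (q + 1)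
        have h2 := hadd (q - 1)
        rw [add_sub_cancel_right, e1, transform_comp A hdet', neg_neg, ← h2, sub_add_cancel] at h1
        exact h1
      have e3 : (A.toLinearEquiv : E6 →ₗ[ℝ] E6) = LinearMap.id := by
        refine LinearMap.ext_on hfull ?_
        rintro _ ⟨x, rfl⟩
        exact (congrFun e2 x).symm
      rw [e3, LinearMap.det_id] at hdet
      norm_num at hdet
    tfae_finish
  · obtain ⟨n, rfl | rfl⟩ := r.eq_nat_or_neg
    · exact congrFun (hnat h n) x
    · have := congrFun (hnat h n) x
      rw [sub_neg_eq_add, this, Submodule.reflection_reflection, sub_eq_add_neg]
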